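/- Let $\mathbb D=\{z:|z|<1\}$, and let $\mathcal A$ be the class of functions $f$ analytic in $\mathbb D$ with $f(0)=0$, $f'(0)=1$. For functions in $\mathbb D$ write $h\prec\varphi$ if $h=\varphi\circ\omega$ for some analytic $\omega$ in $\mathbb D$ with $\omega(0)=0$ and $|\omega(z)|\le|z|$, and write $g\ll f$ ($g$ is majorized by $f$) if $g=\Phi f$ in $\mathbb D$ for some analytic $\Phi$ with $|\Phi|\le 1$ in $\mathbb D$. Let $$\mathcal C_c(\varphi)=\Big\{f\in\mathcal A:\ \frac{2(zf'(z))'}{\big(f(z)+\overline{f(\bar z)}\big)'}\prec\varphi(z)\Big\}.$$ **Theorem 2.1.** Let $\varphi$ be convex in $\mathbb D$ (analytic and univalent with $\varphi(\mathbb D)$ convex), with $\varphi(0)=1$, $\operatorname{Re}\varphi>0$ in $\mathbb D$, and $\varphi(\mathbb D)$ symmetric with respect to the real axis. Let $\psi$ be analytic and zero-free in $\mathbb D$ with $$\psi(z)+\frac{z\psi'(z)}{\psi(z)}=\varphi(z)\qquad(z\in\mathbb D),$$ and put $m(r)=\min_{|z|=r}|\psi(z)|$. Then the equation $(1-r^2)m(r)-2r=0$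 has a smallest root $r_\psi$ in $(0,1)$, and: 1. If $f\in\mathcal C_c(\varphi)$ and $g$ is analytic in $\mathbb D$ with $g\ll f$, then $|g'(z)|\le|f'(z)|$ for $|z|\le r_\psi$. 2. The radius $r_\psi$ is sharp when $m(r)=\psi(-r)$ for all $r\in(0,1)$: in that case, for every $r\in(r_\psi,1)$ there are $f\in\mathcal C_c(\varphi)$, a function $g$ analytic in $\mathbb D$ with $g\ll f$, and a point $z$ with $|z|=r$ such that $|g'(z)|>|f'(z)|$. -/

import Mathlib

open scoped ComplexConjugate

/-- The class `𝒜`: functions analytic in the open unit disc with `f(0) = 0` and `f'(0) = 1`. -/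
structure ClassA (f : ℂ → ℂ) : Prop where
  analytic : AnalyticOnNhd ℂ f (Metric.ball 0 1)
  map_zero : f 0 = 0
  deriv_zero : deriv f 0 = 1

/-- Subordination `g ≺ h` in the open unit disc: `g = h ∘ ω` for an analytic `ω` with
`ω(0) = 0` and `|ω(z)| ≤ |z|`. -/
def Subordinate (g h : ℂ → ℂ) : Prop :=
  ∃ ω : ℂ → ℂ, AnalyticOnNhd ℂ ω (Metric.ball 0 1) ∧ ω 0 = 0 ∧
    (∀ z ∈ Metric.ball (0 : ℂ) 1, ‖ω z‖ ≤ ‖z‖) ∧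
    ∀ z ∈ Metric.ball (0 : ℂ) 1, g z = h (ω z)

/-- Majorization `g ≪ f` in the open unit disc: `g = Φ f` for an analytic `Φ` with `|Φ| ≤ 1`. -/
def MajorizedBy (g f : ℂ → ℂ) : Prop :=
  ∃ Φ : ℂ → ℂ, AnalyticOnNhd ℂ Φ (Metric.ball 0 1) ∧
    (∀ z ∈ Metric.ball (0 : ℂ) 1, ‖Φ z‖ ≤ 1) ∧
    ∀ z ∈ Metric.ball (0 : ℂ) 1, g z = Φ z * f z

/-- The function `z ↦ f(z) + conj (f (conj z))`. -/
noncomputable def conjSum (f : ℂ → ℂ) : ℂ → ℂ := fun z => f z + conj (f (conj z))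

/-- The class `𝒞_c(φ)` of convex functions with respect to conjugate points: `f ∈ 𝒜` with
`2 (z f'(z))' / (f(z) + conj (f (conj z)))' ≺ φ(z)`. That the denominator has no zero in the disc
is part of the quotient being a function on the disc. -/
structure ClassCc (φ f : ℂ → ℂ) : Prop where
  classA : ClassA f
  denom_ne_zero : ∀ z ∈ Metric.ball (0 : ℂ) 1, deriv (conjSum f) z ≠ 0
  subordinate :
    Subordinate (fun z => 2 * deriv (fun w => w * deriv f w) z / deriv (conjSum f) z) φ

/-- `φ` is convex in the open unit disc: analytic and univalent there, with convex image. -/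
structure IsConvexFunction (φ : ℂ → ℂ) : Prop where
  analytic : AnalyticOnNhd ℂ φ (Metric.ball 0 1)
  univalent : Set.InjOn φ (Metric.ball 0 1)
  convex_image : Convex ℝ (φ '' Metric.ball 0 1)

/-- `ψ` is a solution, analytic and without zeros in the open unit disc, of the Briot–Bouquet
equation `ψ(z) + z ψ'(z) / ψ(z) = φ(z)`. -/
structure IsBriotBouquetSolution (φ ψ : ℂ → ℂ) : Prop where
  analytic : AnalyticOnNhd ℂ ψ (Metric.ball 0 1)
  ne_zero : ∀ z ∈ Metric.ball (0 : ℂ) 1, ψ z ≠ 0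
  equation : ∀ z ∈ Metric.ball (0 : ℂ) 1, ψ z + z * deriv ψ z / ψ z = φ z

/-- `m(r) = min_{|z| = r} |ψ(z)|`. For `0 ≤ r < 1` and `ψ` continuous in the disc, the circle is
compact and nonempty, so that the infimum is attained. -/
noncomputable def minModulus (ψ : ℂ → ℂ) (r : ℝ) : ℝ :=
  sInf ((fun z => ‖ψ z‖) '' Metric.sphere (0 : ℂ) r)

/-!
After a rotation of the disc (`exists_rotation_isRealConvex`) the function `φ` is real on the real
axis and increasing there; the rotation changes neither the class nor `min_{|z| = r} |ψ(z)|`.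

*The reduction.* If `g = Φ f`, then the Schwarz–Pick inequality for `Φ` turns the estimate
`2 |f| ≤ (1 - |z|²) |f'|` into `|g'| ≤ |f'|` (`MajorizedBy.norm_deriv_le`). So one needs a sharp
lower bound of `|z f' / f|` in the class. The candidate is the value at `-ρ` of the function with
`z f' / f = ψ`: the function `M(ρ) = Re (1 / ψ(-ρ))` solves `ρ M' = 1 - φ(-ρ) M` (`IsMajorant`),
and `|f / (z f')| ≤ M(r)` is to be shown on the circle of radius `r` with `2 r M(r) = 1 - r²`
(`IsMajorant.exists_radius`); this radius lies between `1 / 3` and `√2 - 1`. By the maximum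
principle and the monotonicity of `(1 - t²) / (2 t)` this settles all `|z| ≤ r`
(`ClassCc.two_mul_norm_le`). The root of the statement is at most `r`, because `m(r) ≤ 1 / M(r)` and
`(1 - t²) m(t) - 2 t` decreases (`exists_isLeast_root`).

*The system.* With `2 F(z) = f(z) + conj (f (conj z))`, the functions `S = f' / F'` and
`v = f / (z F')` solve a linear first-order system whose coefficients are `a = φ ∘ ω₁` and
`b = φ ∘ ω₂`, the subordinate functions of `f` and of its reflection (`ConjSystem`,
`ClassCc.exists_conjSystem`). One has `f / (z f') = v / S` and
`z (v / S)' = 1 - (a / S) (v / S)`. Were `S = 1`, the bound by `M` would be a comparison of linear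
equations. In general `S` is only close to `1`: `|S - 1| ≤ |z| + |z|³ / 3`
(`ConjSystem.norm_S_sub_one_le`), and `a / S` may lie to the left of `φ(-|z|)`.

*The barrier.* This loss at one radius is compensated at others, because `z (1 / S)'` involves the
same coefficients. For a unit number `e` one considers
`M - λ + ε - Re (e v / S) + λ Re ((1 + i Im e) / S) + m φ'(-|z|) (|z| + Re ω₁)` (`barrier`). The
weight `λ(ρ) = ∫_ρ^r φ(-t) M(t) dt / t` vanishes at `r`, and the correction `m ≥ 0` vanishes for
`|z| ≥ 1 / 3`; so positivity for `|z| = r` and all `ε > 0` is the desired bound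
(`ConjSystem.norm_quot_le`). Positivity holds near the origin (`ConjSystem.exists_barrier_pos`) and
propagates outwards by a first-contact principle (`pos_of_contact`): where the barrier and its
angular derivative vanish, its radial derivative must be positive.

*The inequality at a contact.* There the radial derivative exceeds, up to a positive factor,
an explicit expression `contactForm` in real quantities subject to the inequalities `IsContact`
(`ConjSystem.exists_contact`). These come from the geometry of convex functions: for `|w| ≤ ρ` the
value `φ(w)` lies in a disc that touches the line `Re = φ(-ρ)` at `φ(-ρ)`
(`IsRealConvex.normSq_sub_le`), and `Re (1 - φ(-ρ) / φ(w))` is comparable with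
`φ'(-ρ) (ρ + Re w)` (`IsRealConvex.le_re_one_sub_div`, `IsRealConvex.re_one_sub_div_le`). After
minimization over a disc (`core_reduce`), the form becomes a polynomial in two variables, the slope
`T` and the coordinate `σ = Im e`, that is bounded below by quadratic forms; it is affine in the
weight and in the multiplier, hence need only be checked at the ends of their ranges. For
`|z| ≤ 1 / 100` the estimates are made by hand (`contactForm_nonneg_of_small_radius`); beyond, all
bounds are monotone enough to be verified on finitely many annuli, where they are inequalities
between rational numbers (`rowTable`, `outerRowTable`).

*Sharpness.* If `m(r) = ψ(-r)`, then `ψ` is real on the real axis, the function with `z f' / f = ψ`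
equals its own reflection and belongs to the class (`IsBriotBouquetSolution.exists_extremal`).
Beyond the root one takes `g = Φ f` for a disc automorphism `Φ` with `Φ(-r)` close to `1`
(`exists_majorizedBy_norm_deriv_lt`).
-/

open Metric Set Filter Topology

/-! ### Functions with positive real part and the Schwarz–Pick inequality -/

/-- A univalent analytic function has a nowhere vanishing derivative and an analytic inverse. -/
theorem exists_analytic_inverse {φ : ℂ → ℂ} (hφ : AnalyticOnNhd ℂ φ (ball 0 1))
    (hinj : InjOn φ (ball 0 1)) :
    ∃ g : ℂ → ℂ, DifferentiableOn ℂ g (φ '' ball 0 1) ∧ IsOpen (φ '' ball 0 1) ∧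
      ∀ z ∈ ball (0 : ℂ) 1, g (φ z) = z ∧ deriv φ z ≠ 0 := by
  classical
  set g := Function.invFunOn φ (ball (0 : ℂ) 1) with hg
  have hgl : ∀ z ∈ ball (0 : ℂ) 1, g (φ z) = z := fun z hz => hinj.leftInvOn_invFunOn hz
  have hopenmap : ∀ s ⊆ ball (0 : ℂ) 1, IsOpen s → IsOpen (φ '' s) := by
    rcases hφ.is_constant_or_isOpen (convex_ball 0 1).isPreconnected with ⟨w, hw⟩ | h
    · exfalso
      have h1 : (0 : ℂ) ∈ ball (0 : ℂ) 1 := by simp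
      have h2 : (1 / 2 : ℂ) ∈ ball (0 : ℂ) 1 := by simp; norm_num
      have := hinj h1 h2 (by rw [hw _ h1, hw _ h2])
      norm_num at this
    · exact h
  have hO : IsOpen (φ '' ball 0 1) := hopenmap _ subset_rfl isOpen_ball
  have hcont : ∀ z ∈ ball (0 : ℂ) 1, ContinuousAt g (φ z) := by
    intro z hz
    rw [ContinuousAt, hgl z hz, tendsto_def]
    intro s hs
    obtain ⟨t, hts, hto, hzt⟩ := _root_.mem_nhds_iff.1 hs
    have : φ '' (t ∩ ball 0 1) ∈ 𝓝 (φ z) :=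
      (hopenmap _ inter_subset_right (hto.inter isOpen_ball)).mem_nhds ⟨z, ⟨hzt, hz⟩, rfl⟩
    filter_upwards [this]
    rintro _ ⟨x, ⟨hx, hxb⟩, rfl⟩
    exact hts (by rw [hgl x hxb]; exact hx)
  have hdg : ∀ z ∈ ball (0 : ℂ) 1, deriv φ z ≠ 0 → DifferentiableAt ℂ g (φ z) := by
    intro z hz hd
    have h1 : HasDerivAt φ (deriv φ z) (g (φ z)) := by
      rw [hgl z hz]; exact (hφ z hz).differentiableAt.hasDerivAt
    refine (HasDerivAt.of_local_left_inverse (hcont z hz) h1 hd ?_).differentiableAt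
    filter_upwards [hO.mem_nhds ⟨z, hz, rfl⟩]
    rintro _ ⟨x, hx, rfl⟩
    rw [hgl x hx]
  have hdg' : ∀ z ∈ ball (0 : ℂ) 1, DifferentiableAt ℂ g (φ z) := by
    intro z hz
    by_cases hd : deriv φ z = 0
    swap
    · exact hdg z hz hd
    have hev : ∀ᶠ x in 𝓝[≠] z, deriv φ x ≠ 0 := by
      rcases (hφ.deriv z hz).eventually_eq_zero_or_eventually_ne_zero with h | h
      · exfalso
        have h0 : EqOn (deriv φ) 0 (ball 0 1) :=
          hφ.deriv.eqOn_zero_of_preconnected_of_eventuallyEq_zero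
            (convex_ball 0 1).isPreconnected hz h
        have h1 : (0 : ℂ) ∈ ball (0 : ℂ) 1 := by simp
        have h2 : (1 / 2 : ℂ) ∈ ball (0 : ℂ) 1 := by simp; norm_num
        have := isOpen_ball.is_const_of_deriv_eq_zero (convex_ball (0 : ℂ) 1).isPreconnected
          (fun x hx => (hφ x hx).differentiableAt.differentiableWithinAt) h0 h1 h2
        have := hinj h1 h2 this
        norm_num at this
      · exact h
    obtain ⟨t, hto, hzt, ht⟩ := mem_nhdsWithin.1 hev
    set V := φ '' (t ∩ ball 0 1) with hV
    have hVn : V ∈ 𝓝 (φ z) :=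
      (hopenmap _ inter_subset_right (hto.inter isOpen_ball)).mem_nhds ⟨z, ⟨hzt, hz⟩, rfl⟩
    have := (Complex.differentiableOn_compl_singleton_and_continuousAt_iff (f := g) hVn).1
      ⟨?_, hcont z hz⟩
    · exact this.differentiableAt hVn
    · rintro _ ⟨⟨x, ⟨hx, hxb⟩, rfl⟩, hne⟩
      have hxz : x ≠ z := by rintro rfl; exact hne rfl
      exact (hdg x hxb (ht ⟨hx, hxz⟩)).differentiableWithinAt
  refine ⟨g, ?_, hO, fun z hz => ⟨hgl z hz, ?_⟩⟩
  · rintro _ ⟨z, hz, rfl⟩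
    exact (hdg' z hz).differentiableWithinAt
  · intro h0
    have h1 := (hdg' z hz).hasDerivAt.comp z (hφ z hz).differentiableAt.hasDerivAt
    have h2 : g ∘ φ =ᶠ[𝓝 z] id := by
      filter_upwards [isOpen_ball.mem_nhds hz] with x hx
      exact hgl x hx
    have h3 := (h2.hasDerivAt_iff.1 h1).unique (hasDerivAt_id z)
    rw [h0, mul_zero] at h3
    exact zero_ne_one h3

/-- Schwarz's lemma for functions with positive real part: the Cayley transform of `p` is bounded
by the modulus of the variable. -/
theorem norm_sub_one_le_of_re_nonneg {p : ℂ → ℂ} (hp : DifferentiableOn ℂ p (ball 0 1))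
    (h0 : p 0 = 1) (hre : ∀ z ∈ ball (0 : ℂ) 1, 0 ≤ (p z).re) {z : ℂ} (hz : ‖z‖ < 1) :
    ‖p z - 1‖ ≤ ‖z‖ * ‖p z + 1‖ := by
  have hne : ∀ w ∈ ball (0 : ℂ) 1, p w + 1 ≠ 0 := by
    intro w hw h
    have := congrArg Complex.re h
    simp at this
    linarith [hre w hw]
  set q : ℂ → ℂ := fun w => (p w - 1) / (p w + 1) with hq
  have hqd : DifferentiableOn ℂ q (ball 0 1) := (hp.sub_const 1).div (hp.add_const 1) hne
  have hmaps : MapsTo q (ball 0 1) (closedBall 0 1) := by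
    intro w hw
    simp only [mem_closedBall, dist_zero_right, hq, norm_div]
    rw [div_le_one (norm_pos_iff.2 (hne w hw)), ← sq_le_sq₀ (norm_nonneg _) (norm_nonneg _),
      ← Complex.normSq_eq_norm_sq, ← Complex.normSq_eq_norm_sq, Complex.normSq_apply,
      Complex.normSq_apply]
    simp
    nlinarith [hre w hw]
  have h := Complex.norm_le_norm_of_mapsTo_ball hqd hmaps (by simp [hq, h0]) hz
  have h2 := norm_pos_iff.2 (hne z (by simpa using hz))
  simp only [hq, norm_div] at h
  rwa [div_le_iff₀ h2] at h

/-- The disc `|w - 1| ≤ ρ |w + 1|` in real coordinates. -/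
theorem normSq_le_of_norm_sub_one_le {w : ℂ} {ρ : ℝ} (h : ‖w - 1‖ ≤ ρ * ‖w + 1‖) :
    (1 - ρ ^ 2) * (w.re ^ 2 + w.im ^ 2 + 1) ≤ 2 * (1 + ρ ^ 2) * w.re := by
  have h1 : ‖w - 1‖ ^ 2 ≤ ρ ^ 2 * ‖w + 1‖ ^ 2 := by
    rw [← mul_pow]; exact pow_le_pow_left₀ (norm_nonneg _) h 2
  rw [← Complex.normSq_eq_norm_sq, ← Complex.normSq_eq_norm_sq, Complex.normSq_apply,
    Complex.normSq_apply] at h1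
  simp at h1
  nlinarith

theorem one_sub_conj_mul_ne_zero {a b : ℂ} (ha : ‖a‖ < 1) (hb : ‖b‖ ≤ 1) :
    1 - conj a * b ≠ 0 := by
  intro h
  have h1 : conj a * b = 1 := (sub_eq_zero.1 h).symm
  have h2 : ‖a‖ * ‖b‖ = 1 := by rw [← Complex.norm_conj a, ← norm_mul, h1, norm_one]
  nlinarith [norm_nonneg a, norm_nonneg b]

theorem norm_sub_le_norm_one_sub_conj_mul {a b : ℂ} (ha : ‖a‖ ≤ 1) (hb : ‖b‖ ≤ 1) :
    ‖b - a‖ ≤ ‖1 - conj a * b‖ := by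
  rw [← sq_le_sq₀ (norm_nonneg _) (norm_nonneg _)]
  have ha2 : ‖a‖ ^ 2 ≤ 1 := pow_le_one₀ (norm_nonneg _) ha
  have hb2 : ‖b‖ ^ 2 ≤ 1 := pow_le_one₀ (norm_nonneg _) hb
  simp only [← Complex.normSq_eq_norm_sq, Complex.normSq_apply] at *
  simp
  nlinarith [mul_nonneg (sub_nonneg.2 ha2) (sub_nonneg.2 hb2)]

/-- The Schwarz–Pick inequality for the derivative. -/
theorem schwarz_pick_deriv {Φ : ℂ → ℂ} (hΦ : DifferentiableOn ℂ Φ (ball 0 1))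
    (hb : ∀ z ∈ ball (0 : ℂ) 1, ‖Φ z‖ ≤ 1) {z : ℂ} (hz : ‖z‖ < 1) :
    (1 - ‖z‖ ^ 2) * ‖deriv Φ z‖ ≤ 1 - ‖Φ z‖ ^ 2 := by
  have hzb : z ∈ ball (0 : ℂ) 1 := by simpa using hz
  rcases (hb z hzb).eq_or_lt with h1 | h1
  · have hmax : IsMaxOn (norm ∘ Φ) (ball 0 1) z := fun w hw => by
      simpa [h1] using hb w hw
    have hc := Complex.eqOn_of_isPreconnected_of_isMaxOn_norm
      (convex_ball (0 : ℂ) 1).isPreconnected isOpen_ball hΦ hzb hmax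
    have : Φ =ᶠ[𝓝 z] fun _ => Φ z := by
      filter_upwards [isOpen_ball.mem_nhds hzb] with w hw using hc hw
    rw [this.deriv_eq]
    simp [h1]
  set α := Φ z with hα
  set T : ℂ → ℂ := fun w => (w + z) / (1 + conj z * w) with hT
  have hTne : ∀ w ∈ ball (0 : ℂ) 1, 1 + conj z * w ≠ 0 := by
    intro w hw
    have := one_sub_conj_mul_ne_zero (a := z) (b := -w) hz (by simpa using le_of_lt (by simpa using hw))
    simpa using this
  have hTmaps : MapsTo T (ball 0 1) (ball 0 1) := by
    intro w hw
    have hw' : ‖w‖ < 1 := by simpa using hw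
    simp only [mem_ball, dist_zero_right, hT, norm_div]
    rw [div_lt_one (norm_pos_iff.2 (hTne w hw)), ← sq_lt_sq₀ (norm_nonneg _) (norm_nonneg _)]
    have hz2 : ‖z‖ ^ 2 < 1 := pow_lt_one₀ (norm_nonneg _) hz two_ne_zero
    have hw2 : ‖w‖ ^ 2 < 1 := pow_lt_one₀ (norm_nonneg _) hw' two_ne_zero
    simp only [← Complex.normSq_eq_norm_sq, Complex.normSq_apply] at *
    simp
    nlinarith [mul_pos (sub_pos.2 hz2) (sub_pos.2 hw2)]
  have hTd : DifferentiableOn ℂ T (ball 0 1) := by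
    apply DifferentiableOn.div (by fun_prop) (by fun_prop) hTne
  have hGne : ∀ w ∈ ball (0 : ℂ) 1, 1 - conj α * Φ (T w) ≠ 0 := fun w hw =>
    one_sub_conj_mul_ne_zero h1 (hb _ (hTmaps hw))
  set G : ℂ → ℂ := fun w => (Φ (T w) - α) / (1 - conj α * Φ (T w)) with hG
  have hGd : DifferentiableOn ℂ G (ball 0 1) := by
    have : DifferentiableOn ℂ (fun w => Φ (T w)) (ball 0 1) := hΦ.comp hTd hTmaps
    exact (this.sub_const _).div ((this.const_mul _).const_sub _) hGne
  have hT0 : T 0 = z := by simp [hT]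
  have hG0 : G 0 = 0 := by simp [hG, hT0, hα]
  have hGmaps : MapsTo G (ball 0 1) (closedBall (G 0) 1) := by
    intro w hw
    rw [hG0]
    simp only [mem_closedBall, dist_zero_right, hG, norm_div]
    rw [div_le_one (norm_pos_iff.2 (hGne w hw))]
    exact norm_sub_le_norm_one_sub_conj_mul h1.le (hb _ (hTmaps hw))
  have hle := Complex.norm_deriv_le_one_of_mapsTo_ball hGd hGmaps one_pos
  have hTder : HasDerivAt T (1 - conj z * z) 0 := by
    have a1 : HasDerivAt (fun w : ℂ => w + z) 1 0 := (hasDerivAt_id 0).add_const z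
    have a2 : HasDerivAt (fun w : ℂ => 1 + conj z * w) (conj z) 0 := by
      simpa using ((hasDerivAt_id (0 : ℂ)).const_mul (conj z)).const_add 1
    have := a1.div a2 (by simp)
    refine this.congr_deriv ?_
    simp [mul_comm]
  have hΦder : HasDerivAt Φ (deriv Φ z) (T 0) := by
    rw [hT0]; exact (hΦ.differentiableAt (isOpen_ball.mem_nhds hzb)).hasDerivAt
  have hc := hΦder.comp 0 hTder
  have hαne : (1 : ℂ) - conj α * α ≠ 0 := one_sub_conj_mul_ne_zero h1 h1.le
  have hGder := (hc.sub_const α).div ((hc.const_mul (conj α)).const_sub 1)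
    (by simpa [hT0] using hGne 0 (by simp))
  have hval : deriv G 0 = deriv Φ z * (1 - conj z * z) / (1 - conj α * α) := by
    have : deriv G 0 = _ := hGder.deriv
    rw [this]
    simp only [Function.comp_apply, hT0, ← hα, sub_self, zero_mul, sub_zero]
    field_simp
  have e1 : ∀ x : ℂ, ‖x‖ ≤ 1 → ‖(1 : ℂ) - conj x * x‖ = 1 - ‖x‖ ^ 2 := by
    intro x hx
    have : (1 : ℂ) - conj x * x = ((1 - ‖x‖ ^ 2 : ℝ) : ℂ) := by
      rw [Complex.conj_mul']; push_cast; ring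
    rw [this, Complex.norm_real, Real.norm_of_nonneg]
    nlinarith [norm_nonneg x]
  rw [hval, norm_div, norm_mul, e1 z hz.le, e1 α h1.le] at hle
  have hpos : 0 < 1 - ‖α‖ ^ 2 := by nlinarith [norm_nonneg α]
  rw [div_le_one hpos] at hle
  linarith

/-- The bound `(1 - |z|²) |p'(z)| ≤ 2 Re p(z)` for functions with positive real part. -/
theorem norm_deriv_le_of_re_pos {p : ℂ → ℂ} (hp : DifferentiableOn ℂ p (ball 0 1))
    (hre : ∀ z ∈ ball (0 : ℂ) 1, 0 < (p z).re) {z : ℂ} (hz : ‖z‖ < 1) :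
    (1 - ‖z‖ ^ 2) * ‖deriv p z‖ ≤ 2 * (p z).re := by
  have hzb : z ∈ ball (0 : ℂ) 1 := by simpa using hz
  have hne : ∀ w ∈ ball (0 : ℂ) 1, p w + 1 ≠ 0 := by
    intro w hw h
    have := congrArg Complex.re h
    simp at this
    linarith [hre w hw]
  set q : ℂ → ℂ := fun w => (p w - 1) / (p w + 1) with hq
  have hqd : DifferentiableOn ℂ q (ball 0 1) := (hp.sub_const 1).div (hp.add_const 1) hne
  have hid : ∀ w ∈ ball (0 : ℂ) 1,
      ‖p w + 1‖ ^ 2 - ‖p w - 1‖ ^ 2 = 4 * (p w).re := by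
    intro w _
    simp only [← Complex.normSq_eq_norm_sq, Complex.normSq_apply]
    simp
    ring
  have hb : ∀ w ∈ ball (0 : ℂ) 1, ‖q w‖ ≤ 1 := by
    intro w hw
    simp only [hq, norm_div]
    rw [div_le_one (norm_pos_iff.2 (hne w hw)), ← sq_le_sq₀ (norm_nonneg _) (norm_nonneg _)]
    linarith [hid w hw, hre w hw]
  have h := schwarz_pick_deriv hqd hb hz
  have hpd := (hp.differentiableAt (isOpen_ball.mem_nhds hzb)).hasDerivAt
  have hqder : deriv q z = 2 * deriv p z / (p z + 1) ^ 2 := by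
    have := ((hpd.sub_const 1).div (hpd.add_const 1) (hne z hzb)).deriv
    have h' : deriv q z = _ := this
    rw [h']
    ring
  have hpos := norm_pos_iff.2 (hne z hzb)
  rw [hqder] at h
  simp only [hq, norm_div, norm_mul, norm_pow, Complex.norm_ofNat] at h
  rw [div_pow, one_sub_div (by positivity), hid z hzb, ← mul_div_assoc, div_le_div_iff_of_pos_right
    (by positivity)] at h
  linarith

/-! ### Chords of convex functions -/

/-- For a convex function `φ` and `|κ| ≤ 1`, the chord from `φ(λ)` to `φ(κ λ)` points into the
image of the disc of radius `|λ|`: the function `φ⁻¹((1 - t) φ + t φ(κ ·))` is a Schwarz function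
for every `t ∈ [0, 1]`, and one differentiates at `t = 0`. -/
theorem IsConvexFunction.re_chord_nonneg {φ : ℂ → ℂ} (hφ : IsConvexFunction φ) {κ l : ℂ}
    (hκ : ‖κ‖ ≤ 1) (hl : ‖l‖ < 1) (hl0 : l ≠ 0) :
    0 ≤ ((φ l - φ (κ * l)) / (l * deriv φ l)).re := by
  obtain ⟨g, hg, hO, hgφ⟩ := exists_analytic_inverse hφ.analytic hφ.univalent
  have hlb : l ∈ ball (0 : ℂ) 1 := by simpa using hl
  have hκb : ∀ z ∈ ball (0 : ℂ) 1, κ * z ∈ ball (0 : ℂ) 1 := by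
    intro z hz
    simp only [mem_ball, dist_zero_right, norm_mul] at hz ⊢
    nlinarith [norm_nonneg z, norm_nonneg κ]
  have hd := (hgφ l hlb).2
  have hφd : DifferentiableOn ℂ φ (ball 0 1) := hφ.analytic.differentiableOn
  have hgmaps : ∀ w ∈ φ '' ball (0 : ℂ) 1, g w ∈ ball (0 : ℂ) 1 := by
    rintro _ ⟨z, hz, rfl⟩
    rwa [(hgφ z hz).1]
  have hmem : ∀ t : ℝ, 0 ≤ t → t ≤ 1 → ∀ z ∈ ball (0 : ℂ) 1,
      φ z + t * (φ (κ * z) - φ z) ∈ φ '' ball (0 : ℂ) 1 := by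
    intro t h0 h1 z hz
    have := hφ.convex_image (mem_image_of_mem φ hz) (mem_image_of_mem φ (hκb z hz))
      (sub_nonneg.2 h1) h0 (by ring)
    convert this using 1
    simp [Complex.real_smul]
    ring
  have hS : ∀ t : ℝ, 0 ≤ t → t ≤ 1 → ‖g (φ l + t * (φ (κ * l) - φ l))‖ ≤ ‖l‖ := by
    intro t h0 h1
    have hcd : DifferentiableOn ℂ (fun z => φ z + t * (φ (κ * z) - φ z)) (ball 0 1) := by
      have : DifferentiableOn ℂ (fun z => φ (κ * z)) (ball 0 1) :=
        hφd.comp (by fun_prop) hκb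
      exact hφd.add ((this.sub hφd).const_mul _)
    exact Complex.norm_le_norm_of_mapsTo_ball (f := fun z => g (φ z + t * (φ (κ * z) - φ z)))
      (hg.comp hcd (hmem t h0 h1))
      (fun z hz => ball_subset_closedBall (hgmaps _ (hmem t h0 h1 z hz)))
      (by simpa using (hgφ 0 (by simp)).1) hl
  have hgd : HasDerivAt g (deriv φ l)⁻¹ (φ l) := by
    have h1 := (hg.differentiableAt (hO.mem_nhds ⟨l, hlb, rfl⟩)).hasDerivAt
    have h2 := h1.comp l (hφ.analytic l hlb).differentiableAt.hasDerivAt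
    have h3 : g ∘ φ =ᶠ[𝓝 l] id := by
      filter_upwards [isOpen_ball.mem_nhds hlb] with x hx using (hgφ x hx).1
    have h4 := (h3.hasDerivAt_iff.1 h2).unique (hasDerivAt_id l)
    rwa [eq_inv_of_mul_eq_one_left h4] at h1
  have hH : HasDerivAt (fun t : ℝ => g (φ l + t * (φ (κ * l) - φ l)))
      ((deriv φ l)⁻¹ * (φ (κ * l) - φ l)) 0 := by
    have h1 : HasDerivAt (fun t : ℝ => φ l + (t : ℂ) * (φ (κ * l) - φ l))
        (φ (κ * l) - φ l) 0 := by
      simpa using ((hasDerivAt_id (0 : ℝ)).ofReal_comp.mul_const (φ (κ * l) - φ l)).const_add (φ l)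
    have h2 : HasDerivAt g (deriv φ l)⁻¹ (φ l + ((0 : ℝ) : ℂ) * (φ (κ * l) - φ l)) := by
      simpa using hgd
    exact h2.comp (0 : ℝ) h1
  have hF : HasDerivAt (fun t : ℝ => (conj l * g (φ l + t * (φ (κ * l) - φ l))).re)
      (conj l * ((deriv φ l)⁻¹ * (φ (κ * l) - φ l))).re 0 := by
    have := (hH.const_mul (conj l))
    exact (Complex.reCLM.hasFDerivAt.comp_hasDerivAt (0 : ℝ) this)
  have hle : (conj l * ((deriv φ l)⁻¹ * (φ (κ * l) - φ l))).re ≤ 0 := by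
    have ht := hF.tendsto_slope.mono_left (nhdsWithin_mono 0 (s := Ioi 0) (by
      intro x hx; exact ne_of_gt hx))
    refine le_of_tendsto ht ?_
    filter_upwards [Ioc_mem_nhdsGT (zero_lt_one' ℝ)] with t ht
    rw [slope_def_field, sub_zero]
    refine div_nonpos_of_nonpos_of_nonneg ?_ ht.1.le
    have h1 : (conj l * g (φ l + t * (φ (κ * l) - φ l))).re ≤ ‖l‖ * ‖l‖ :=
      (Complex.re_le_norm _).trans (by
        rw [norm_mul, Complex.norm_conj]
        exact mul_le_mul_of_nonneg_left (hS t ht.1.le ht.2) (norm_nonneg _))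
    have h2 : (conj l * g (φ l + ((0 : ℝ) : ℂ) * (φ (κ * l) - φ l))).re = ‖l‖ * ‖l‖ := by
      simp only [Complex.ofReal_zero, zero_mul, add_zero, (hgφ l hlb).1]
      rw [Complex.conj_mul']
      norm_cast
      rw [sq]
    linarith
  have hconv : ((φ l - φ (κ * l)) / (l * deriv φ l))
      = ((-(‖l‖ ^ 2)⁻¹ : ℝ) : ℂ) * (conj l * ((deriv φ l)⁻¹ * (φ (κ * l) - φ l))) := by
    have h3 : ((‖l‖ : ℂ)) ^ 2 = conj l * l := (Complex.conj_mul' l).symm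
    have h4 : conj l ≠ 0 := by simpa using hl0
    push_cast
    rw [h3]
    field_simp
    ring
  rw [hconv, Complex.re_ofReal_mul]
  have : -(‖l‖ ^ 2)⁻¹ ≤ 0 := by simp
  nlinarith

/-- The analytic characterization of convexity, by the second derivative test applied to the
chords from `φ(λ)` to `φ(e^{it} λ)`. -/
theorem IsConvexFunction.re_one_add_nonneg {φ : ℂ → ℂ} (hφ : IsConvexFunction φ) {l : ℂ}
    (hl : ‖l‖ < 1) : 0 ≤ (1 + l * deriv (deriv φ) l / deriv φ l).re := by
  by_cases hl0 : l = 0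
  · simp [hl0]
  obtain ⟨g, hg, hO, hgφ⟩ := exists_analytic_inverse hφ.analytic hφ.univalent
  have hlb : l ∈ ball (0 : ℂ) 1 := by simpa using hl
  have hd := (hgφ l hlb).2
  set E : ℝ → ℂ := fun t => Complex.exp (t * Complex.I) * l with hE
  have hEb : ∀ t, E t ∈ ball (0 : ℂ) 1 := by
    intro t
    simpa [hE, Complex.norm_exp_ofReal_mul_I] using hl
  have hEd : ∀ t, HasDerivAt E (Complex.I * E t) t := by
    intro t
    have h1 : HasDerivAt (fun t : ℝ => (t : ℂ) * Complex.I) Complex.I t := by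
      simpa using (hasDerivAt_id t).ofReal_comp.mul_const Complex.I
    have := (h1.cexp).mul_const l
    refine this.congr_deriv ?_
    simp only [hE]
    ring
  set H : ℝ → ℝ := fun t => ((φ l - φ (E t)) / (l * deriv φ l)).re with hH
  have hH1 : ∀ t, HasDerivAt H (-(Complex.I * (E t * deriv φ (E t)) / (l * deriv φ l)).re) t := by
    intro t
    have h1 : HasDerivAt (fun t => φ (E t)) (deriv φ (E t) * (Complex.I * E t)) t :=
      ((hφ.analytic _ (hEb t)).differentiableAt.hasDerivAt).comp t (hEd t)
    have h2 := ((h1.const_sub (φ l)).div_const (l * deriv φ l))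
    have h3 := Complex.reCLM.hasFDerivAt.comp_hasDerivAt t h2
    have h4 : Complex.reCLM (-(deriv φ (E t) * (Complex.I * E t)) / (l * deriv φ l))
        = -(Complex.I * (E t * deriv φ (E t)) / (l * deriv φ l)).re := by
      rw [Complex.reCLM_apply, neg_div, Complex.neg_re]
      ring_nf
    rw [← h4]
    exact h3
  have hE0 : E 0 = l := by simp [hE]
  have hderiv : deriv H = fun t => -(Complex.I * (E t * deriv φ (E t)) / (l * deriv φ l)).re :=
    funext fun t => (hH1 t).deriv
  have hH2 : HasDerivAt (deriv H) (1 + l * deriv (deriv φ) l / deriv φ l).re 0 := by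
    rw [hderiv]
    have h1 : HasDerivAt (deriv φ) (deriv (deriv φ) l) (E 0) := by
      rw [hE0]; exact (hφ.analytic.deriv l hlb).differentiableAt.hasDerivAt
    have h2 := h1.comp (0 : ℝ) (hEd 0)
    have h3 := (((hEd 0).mul h2).const_mul Complex.I).div_const (l * deriv φ l)
    have h4 := (Complex.reCLM.hasFDerivAt.comp_hasDerivAt (0 : ℝ) h3).neg
    have h5 : -Complex.reCLM (Complex.I * (Complex.I * E 0 * (deriv φ ∘ E) 0
        + E 0 * (deriv (deriv φ) l * (Complex.I * E 0))) / (l * deriv φ l))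
        = (1 + l * deriv (deriv φ) l / deriv φ l).re := by
      rw [Complex.reCLM_apply, ← Complex.neg_re, Function.comp_apply, hE0]
      congr 1
      field_simp
      ring_nf
      simp only [Complex.I_sq]
      ring
    rw [← h5]
    exact h4
  by_contra hneg
  push Not at hneg
  have hnn : ∀ t, 0 ≤ H t := by
    intro t
    exact hφ.re_chord_nonneg (κ := Complex.exp (t * Complex.I))
      (by rw [Complex.norm_exp_ofReal_mul_I]) hl hl0
  have hH0 : H 0 = 0 := by simp [hH, hE0]
  have hd0 : deriv H 0 = 0 := by
    apply IsLocalMin.deriv_eq_zero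
    exact Eventually.of_forall fun t => by rw [hH0]; exact hnn t
  have hmax : IsLocalMax H 0 := by
    apply isLocalMax_of_deriv_deriv_neg _ hd0 (hH1 0).continuousAt
    rw [hH2.deriv]; exact hneg
  have hzero : H =ᶠ[𝓝 0] fun _ => 0 := by
    filter_upwards [hmax] with t ht
    exact le_antisymm (by rwa [hH0] at ht) (hnn t)
  have := hzero.deriv.deriv_eq
  rw [hH2.deriv] at this
  rw [this] at hneg
  simp at hneg

/-! ### Convex functions that are real on the real axis -/

/-- A convex function with positive real part, real on the real axis and increasing there, with
`φ(0) = 1`. -/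
structure IsRealConvex (φ : ℂ → ℂ) : Prop where
  convex : IsConvexFunction φ
  map_zero : φ 0 = 1
  re_pos : ∀ z ∈ ball (0 : ℂ) 1, 0 < (φ z).re
  map_conj : ∀ z ∈ ball (0 : ℂ) 1, φ (conj z) = conj (φ z)
  deriv_zero_pos : 0 < (deriv φ 0).re

/-- A harmonic function `Re f` that is nonnegative on a circle is nonnegative inside it. -/
theorem re_nonneg_of_sphere {f : ℂ → ℂ} {ρ : ℝ} (hρ : ρ < 1)
    (hf : DifferentiableOn ℂ f (ball 0 1)) (h : ∀ w : ℂ, ‖w‖ = ρ → 0 ≤ (f w).re) {w : ℂ}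
    (hw : ‖w‖ ≤ ρ) : 0 ≤ (f w).re := by
  rcases hw.eq_or_lt with h1 | h1
  · exact h w h1
  have hρ0 : 0 < ρ := (norm_nonneg w).trans_lt h1
  have hsub : closedBall (0 : ℂ) ρ ⊆ ball 0 1 := closedBall_subset_ball hρ
  have hd : DiffContOnCl ℂ (fun w => Complex.exp (-f w)) (ball 0 ρ) :=
    ((hf.neg.cexp).mono hsub).diffContOnCl_ball subset_rfl
  have := Complex.norm_le_of_forall_mem_frontier_norm_le isBounded_ball hd (C := 1) (fun z hz => by
    rw [frontier_ball _ hρ0.ne', mem_sphere, dist_zero_right] at hz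
    rw [Complex.norm_exp, Complex.neg_re, Real.exp_le_one_iff]
    linarith [h z hz]) (subset_closure (show w ∈ ball (0 : ℂ) ρ by simpa using h1))
  rw [Complex.norm_exp, Complex.neg_re, Real.exp_le_one_iff] at this
  linarith

/-- A differentiable function bounded on a circle is bounded inside it. -/
theorem norm_le_of_sphere {f : ℂ → ℂ} {ρ C : ℝ} (hρ : ρ < 1)
    (hf : DifferentiableOn ℂ f (ball 0 1)) (h : ∀ w : ℂ, ‖w‖ = ρ → ‖f w‖ ≤ C) {w : ℂ}
    (hw : ‖w‖ ≤ ρ) : ‖f w‖ ≤ C := by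
  rcases hw.eq_or_lt with h1 | h1
  · exact h w h1
  have hρ0 : 0 < ρ := (norm_nonneg w).trans_lt h1
  have hsub : closedBall (0 : ℂ) ρ ⊆ ball 0 1 := closedBall_subset_ball hρ
  exact Complex.norm_le_of_forall_mem_frontier_norm_le isBounded_ball
    ((hf.mono hsub).diffContOnCl_ball subset_rfl) (fun z hz => by
    rw [frontier_ball _ hρ0.ne', mem_sphere, dist_zero_right] at hz
    exact h z hz) (subset_closure (show w ∈ ball (0 : ℂ) ρ by simpa using h1))

theorem neg_ofReal_mem_ball {ρ : ℝ} (h0 : 0 ≤ ρ) (h1 : ρ < 1) : (-(ρ : ℂ)) ∈ ball (0 : ℂ) 1 := by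
  simpa [abs_of_nonneg h0] using h1

theorem hasDerivAt_neg_ofReal (ρ : ℝ) : HasDerivAt (fun t : ℝ => -(t : ℂ)) (-1) ρ :=
  HasDerivAt.neg (HasDerivAt.ofReal_comp (hasDerivAt_id ρ))

namespace IsRealConvex

variable {φ : ℂ → ℂ}

theorem differentiableOn (hφ : IsRealConvex φ) : DifferentiableOn ℂ φ (ball 0 1) :=
  hφ.convex.analytic.differentiableOn

theorem deriv_ne_zero (hφ : IsRealConvex φ) {z : ℂ} (hz : z ∈ ball (0 : ℂ) 1) :
    deriv φ z ≠ 0 := by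
  obtain ⟨g, -, -, h⟩ := exists_analytic_inverse hφ.convex.analytic hφ.convex.univalent
  exact (h z hz).2

theorem ne_zero (hφ : IsRealConvex φ) {z : ℂ} (hz : z ∈ ball (0 : ℂ) 1) : φ z ≠ 0 := by
  intro h
  have := hφ.re_pos z hz
  rw [h] at this
  simp at this

theorem apply_neg (hφ : IsRealConvex φ) {ρ : ℝ} (h0 : 0 ≤ ρ) (h1 : ρ < 1) :
    φ (-(ρ : ℂ)) = ((φ (-(ρ : ℂ))).re : ℂ) := by
  have := hφ.map_conj _ (neg_ofReal_mem_ball h0 h1)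
  rw [map_neg, Complex.conj_ofReal] at this
  exact (Complex.conj_eq_iff_re.1 this.symm).symm

theorem deriv_conj (hφ : IsRealConvex φ) {z : ℂ} (hz : z ∈ ball (0 : ℂ) 1) :
    deriv φ (conj z) = conj (deriv φ z) := by
  have hz' : conj z ∈ ball (0 : ℂ) 1 := by simpa using hz
  have h1 : (conj ∘ φ ∘ conj) =ᶠ[𝓝 (conj z)] φ := by
    filter_upwards [isOpen_ball.mem_nhds hz'] with x hx
    simp [hφ.map_conj x hx]
  rw [← h1.deriv_eq, deriv_conj_conj]
  simp

theorem deriv_neg (hφ : IsRealConvex φ) {ρ : ℝ} (h0 : 0 ≤ ρ) (h1 : ρ < 1) :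
    deriv φ (-(ρ : ℂ)) = ((deriv φ (-(ρ : ℂ))).re : ℂ) := by
  have := hφ.deriv_conj (neg_ofReal_mem_ball h0 h1)
  rw [map_neg, Complex.conj_ofReal] at this
  exact (Complex.conj_eq_iff_re.1 this.symm).symm

theorem deriv_neg_pos (hφ : IsRealConvex φ) {ρ : ℝ} (h0 : 0 ≤ ρ) (h1 : ρ < 1) :
    0 < (deriv φ (-(ρ : ℂ))).re := by
  by_contra hneg
  push Not at hneg
  have hc : ContinuousOn (fun t : ℝ => (deriv φ (-(t : ℂ))).re) (Icc 0 ρ) := by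
    apply Complex.continuous_re.comp_continuousOn
    apply hφ.convex.analytic.deriv.continuousOn.comp (by fun_prop)
    intro t ht
    exact neg_ofReal_mem_ball ht.1 (ht.2.trans_lt h1)
  have := intermediate_value_Icc' h0 hc
  obtain ⟨t, ht, ht0⟩ := this ⟨hneg, by simpa using hφ.deriv_zero_pos.le⟩
  have ht1 := ht.2.trans_lt h1
  have h2 := hφ.deriv_ne_zero (neg_ofReal_mem_ball ht.1 ht1)
  rw [hφ.deriv_neg ht.1 ht1] at h2
  simp only at ht0
  rw [ht0] at h2
  simp at h2

/-- The Carathéodory disc of the values of `φ` on `|w| ≤ ρ`. -/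
theorem norm_sub_one_le (hφ : IsRealConvex φ) {ρ : ℝ} (h1 : ρ < 1) {w : ℂ} (hw : ‖w‖ ≤ ρ) :
    ‖φ w - 1‖ ≤ ρ * ‖φ w + 1‖ :=
  (norm_sub_one_le_of_re_nonneg hφ.differentiableOn hφ.map_zero
    (fun z hz => (hφ.re_pos z hz).le) (hw.trans_lt h1)).trans
    (mul_le_mul_of_nonneg_right hw (norm_nonneg _))

/-- The Schwarz–Pick bound of `φ'(-ρ)` by `φ(-ρ)`. -/
theorem deriv_neg_le (hφ : IsRealConvex φ) {ρ : ℝ} (h0 : 0 ≤ ρ) (h1 : ρ < 1) :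
    (1 - ρ ^ 2) * (deriv φ (-(ρ : ℂ))).re ≤ 2 * (φ (-(ρ : ℂ))).re := by
  have h := norm_deriv_le_of_re_pos hφ.differentiableOn hφ.re_pos (z := -(ρ : ℂ))
    (by simpa [abs_of_nonneg h0] using h1)
  rw [norm_neg, Complex.norm_real, Real.norm_of_nonneg h0] at h
  have : 0 ≤ 1 - ρ ^ 2 := by nlinarith
  exact (mul_le_mul_of_nonneg_left (Complex.re_le_norm _) this).trans h

/-- Harnack's inequality at a negative real point, for a function with nonnegative real part that
is real there. -/
theorem _root_.harnack_neg {p : ℂ → ℂ} (hp : DifferentiableOn ℂ p (ball 0 1)) (h0 : p 0 = 1)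
    (hre : ∀ z ∈ ball (0 : ℂ) 1, 0 ≤ (p z).re) {ρ x : ℝ} (hρ0 : 0 ≤ ρ) (hρ1 : ρ < 1)
    (hx : p (-(ρ : ℂ)) = x) : 1 - ρ ≤ (1 + ρ) * x := by
  have h := norm_sub_one_le_of_re_nonneg hp h0 hre (z := -(ρ : ℂ))
    (by simpa [abs_of_nonneg hρ0] using hρ1)
  have hx0 := hre _ (neg_ofReal_mem_ball hρ0 hρ1)
  rw [hx] at h hx0
  rw [norm_neg, Complex.norm_real, Real.norm_of_nonneg hρ0] at h
  have e1 : ‖(x : ℂ) - 1‖ = |x - 1| := by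
    rw [← Complex.ofReal_one, ← Complex.ofReal_sub, Complex.norm_real, Real.norm_eq_abs]
  have e2 : ‖(x : ℂ) + 1‖ = |x + 1| := by
    rw [← Complex.ofReal_one, ← Complex.ofReal_add, Complex.norm_real, Real.norm_eq_abs]
  simp at hx0
  rw [e1, e2, abs_of_nonneg (by linarith : 0 ≤ x + 1)] at h
  linarith [(abs_le.1 h).1]

theorem le_apply_neg (hφ : IsRealConvex φ) {ρ : ℝ} (h0 : 0 ≤ ρ) (h1 : ρ < 1) :
    1 - ρ ≤ (1 + ρ) * (φ (-(ρ : ℂ))).re :=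
  harnack_neg hφ.differentiableOn hφ.map_zero (fun z hz => (hφ.re_pos z hz).le) h0 h1
    (hφ.apply_neg h0 h1)

/-- Univalence, in a form that includes the origin: `(φ(z) - φ(κ z)) / z` does not vanish. -/
theorem dslope_ne_zero (hφ : IsRealConvex φ) {κ z : ℂ} (hκ : ‖κ‖ ≤ 1) (hκ1 : κ ≠ 1)
    (hz : z ∈ ball (0 : ℂ) 1) : dslope φ 0 z - κ * dslope φ 0 (κ * z) ≠ 0 := by
  by_cases hz0 : z = 0
  · rw [hz0, mul_zero, dslope_same, ← one_sub_mul]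
    exact mul_ne_zero (sub_ne_zero.2 hκ1.symm) (hφ.deriv_ne_zero (by simp))
  · have hκz : κ * z ∈ ball (0 : ℂ) 1 := by
      simp only [mem_ball, dist_zero_right, norm_mul] at hz ⊢
      nlinarith [norm_nonneg z, norm_nonneg κ]
    have e1 := sub_smul_dslope φ 0 z
    have e2 := sub_smul_dslope φ 0 (κ * z)
    simp only [sub_zero, smul_eq_mul] at e1 e2
    intro h
    have : φ z = φ (κ * z) := by linear_combination (-1 : ℂ) * e1 + e2 + z * h
    have := hφ.convex.univalent hz hκz this
    exact hκ1 (mul_right_cancel₀ hz0 (by rw [one_mul]; exact this.symm))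

theorem differentiableOn_dslope (hφ : IsRealConvex φ) :
    DifferentiableOn ℂ (dslope φ 0) (ball 0 1) :=
  (Complex.differentiableOn_dslope (isOpen_ball.mem_nhds (by simp))).2 hφ.differentiableOn

theorem differentiableOn_deriv (hφ : IsRealConvex φ) :
    DifferentiableOn ℂ (deriv φ) (ball 0 1) :=
  hφ.convex.analytic.deriv.differentiableOn

/-- Harnack's inequality for `(φ - 1) / (z φ')`, which has positive real part: it is the chord
from `φ(z)` to `φ(0)`. -/
theorem mul_deriv_neg_le (hφ : IsRealConvex φ) {ρ : ℝ} (h0 : 0 ≤ ρ) (h1 : ρ < 1) :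
    (1 - ρ) * (ρ * (deriv φ (-(ρ : ℂ))).re) ≤ (1 + ρ) * (1 - (φ (-(ρ : ℂ))).re) := by
  rcases h0.eq_or_lt with h | hρ
  · simp [← h, hφ.map_zero]
  have hne := hφ.deriv_neg_pos h0 h1
  have key : 1 - ρ ≤ (1 + ρ) * ((1 - (φ (-(ρ : ℂ))).re) / (ρ * (deriv φ (-(ρ : ℂ))).re)) := by
    refine harnack_neg (p := fun z => dslope φ 0 z / deriv φ z)
      (hφ.differentiableOn_dslope.div hφ.differentiableOn_deriv fun z hz => hφ.deriv_ne_zero hz)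
      ?_ ?_ h0 h1 ?_
    · simp [hφ.deriv_ne_zero (show (0 : ℂ) ∈ ball (0 : ℂ) 1 by simp)]
    · intro z hz
      by_cases hz0 : z = 0
      · simp [hz0, hφ.deriv_ne_zero (show (0 : ℂ) ∈ ball (0 : ℂ) 1 by simp)]
      · have h := hφ.convex.re_chord_nonneg (κ := 0) (l := z) (by simp) (by simpa using hz) hz0
        rw [zero_mul] at h
        convert h using 2
        rw [dslope_of_ne _ hz0, slope_def_field]
        field_simp
        rw [sub_zero]
    · have hρne : (-(ρ : ℂ)) ≠ 0 := by simpa using hρ.ne'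
      rw [dslope_of_ne _ hρne, slope_def_field, hφ.deriv_neg h0 h1, hφ.apply_neg h0 h1,
        hφ.map_zero]
      push_cast
      have : ((deriv φ (-(ρ : ℂ))).re : ℂ) ≠ 0 := by exact_mod_cast hne.ne'
      have h3 : (ρ : ℂ) ≠ 0 := by exact_mod_cast hρ.ne'
      simp only [Complex.ofReal_re]
      field_simp
      ring
  rw [← mul_div_assoc, le_div_iff₀ (by positivity)] at key
  exact key

theorem apply_neg_le_one (hφ : IsRealConvex φ) {ρ : ℝ} (h0 : 0 ≤ ρ) (h1 : ρ < 1) :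
    (φ (-(ρ : ℂ))).re ≤ 1 := by
  have h := hφ.mul_deriv_neg_le h0 h1
  have : 0 ≤ (1 - ρ) * (ρ * (deriv φ (-(ρ : ℂ))).re) :=
    mul_nonneg (by linarith) (mul_nonneg h0 (hφ.deriv_neg_pos h0 h1).le)
  nlinarith

theorem hasDerivAt_apply_neg (hφ : IsRealConvex φ) {ρ : ℝ} (h0 : 0 ≤ ρ) (h1 : ρ < 1) :
    HasDerivAt (fun t : ℝ => (φ (-(t : ℂ))).re) (-(deriv φ (-(ρ : ℂ))).re) ρ := by
  have h := (hφ.convex.analytic _ (neg_ofReal_mem_ball h0 h1)).differentiableAt.hasDerivAt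
  have h2 := hasDerivAt_neg_ofReal ρ
  have h3 := Complex.reCLM.hasFDerivAt.comp_hasDerivAt ρ (h.comp ρ h2)
  refine h3.congr_deriv ?_
  simp

/-- The function `Γ(ρ) = φ'(-ρ)` satisfies `ρ Γ' ≥ -(2ρ / (1 + ρ)) Γ`, by Harnack's
inequality for `1 + z φ'' / φ'`. -/
theorem hasDerivAt_deriv_neg (hφ : IsRealConvex φ) {ρ : ℝ} (h0 : 0 ≤ ρ) (h1 : ρ < 1) :
    ∃ Γ' : ℝ, HasDerivAt (fun t : ℝ => (deriv φ (-(t : ℂ))).re) Γ' ρ ∧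
      -(2 * ρ) * (deriv φ (-(ρ : ℂ))).re ≤ (1 + ρ) * (ρ * Γ') := by
  have hmem := neg_ofReal_mem_ball h0 h1
  have h := (hφ.convex.analytic.deriv _ hmem).differentiableAt.hasDerivAt
  have h2 := hasDerivAt_neg_ofReal ρ
  have h3 := Complex.reCLM.hasFDerivAt.comp_hasDerivAt ρ (h.comp ρ h2)
  refine ⟨-(deriv (deriv φ) (-(ρ : ℂ))).re, h3.congr_deriv (by simp), ?_⟩
  have hΓ := hφ.deriv_neg_pos h0 h1
  have hreal : deriv (deriv φ) (-(ρ : ℂ)) = ((deriv (deriv φ) (-(ρ : ℂ))).re : ℂ) := by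
    have h1' : (conj ∘ deriv φ ∘ conj) =ᶠ[𝓝 (-(ρ : ℂ))] deriv φ := by
      filter_upwards [isOpen_ball.mem_nhds hmem] with x hx
      simp [hφ.deriv_conj hx]
    have h4 := h1'.deriv_eq
    rw [deriv_conj_conj, Function.comp_apply, Function.comp_apply, map_neg,
      Complex.conj_ofReal] at h4
    exact (Complex.conj_eq_iff_re.1 h4).symm
  have key : 1 - ρ ≤ (1 + ρ) *
      (1 - ρ * (deriv (deriv φ) (-(ρ : ℂ))).re / (deriv φ (-(ρ : ℂ))).re) := by
    refine harnack_neg (p := fun z => 1 + z * deriv (deriv φ) z / deriv φ z)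
      (((differentiableOn_id.mul hφ.convex.analytic.deriv.deriv.differentiableOn).div
        hφ.differentiableOn_deriv fun z hz => hφ.deriv_ne_zero hz).const_add 1)
      (by simp) ?_ h0 h1 ?_
    · intro z hz
      exact hφ.convex.re_one_add_nonneg (by simpa using hz)
    · rw [hreal, hφ.deriv_neg h0 h1]
      simp only [Complex.ofReal_re]
      push_cast
      ring
  have h5 : (1 + ρ) * (1 - ρ * (deriv (deriv φ) (-(ρ : ℂ))).re / (deriv φ (-(ρ : ℂ))).re)
      * (deriv φ (-(ρ : ℂ))).re = (1 + ρ) * ((deriv φ (-(ρ : ℂ))).re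
        - ρ * (deriv (deriv φ) (-(ρ : ℂ))).re) := by
    field_simp
  have h6 := mul_le_mul_of_nonneg_right key hΓ.le
  rw [h5] at h6
  linarith

/-- On the circle `|w| = ρ`, the quantity `2d / (φ(w) - φ(-ρ))` is the sum of a number `τ` in the
hyperbolic disc of functions with positive real part and of the purely imaginary number `i y`. -/
theorem exists_chord (hφ : IsRealConvex φ) {ρ : ℝ} (h0 : 0 < ρ) (h1 : ρ < 1) {w : ℂ}
    (hw : ‖w‖ = ρ) (hne : w ≠ -(ρ : ℂ)) :
    ∃ (τ : ℂ) (y : ℝ), ‖τ - 1‖ ≤ ρ * ‖τ + 1‖ ∧ (ρ + w.re) * (1 + y ^ 2) = 2 * ρ ∧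
      (τ + y * Complex.I) * (φ w - φ (-(ρ : ℂ))) = 2 * (ρ * deriv φ (-(ρ : ℂ))) ∧
      φ w - φ (-(ρ : ℂ)) ≠ 0 := by
  have hρc : (ρ : ℂ) ≠ 0 := by exact_mod_cast h0.ne'
  set κ : ℂ := w / (-(ρ : ℂ)) with hκ
  have hκn : ‖κ‖ = 1 := by
    rw [hκ, norm_div, norm_neg, Complex.norm_real, Real.norm_of_nonneg h0.le, hw,
      div_self h0.ne']
  have hκ1 : κ ≠ 1 := by
    intro h
    apply hne
    rw [hκ, div_eq_one_iff_eq (by simpa using hρc)] at h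
    exact h
  have hκw : κ * (-(ρ : ℂ)) = w := by rw [hκ]; field_simp
  have hsq : κ.re ^ 2 + κ.im ^ 2 = 1 := by
    have : ‖κ‖ ^ 2 = 1 := by rw [hκn]; norm_num
    rw [← Complex.normSq_eq_norm_sq, Complex.normSq_apply] at this
    linarith
  have hre1 : κ.re ≠ 1 := by
    intro h
    apply hκ1
    rw [h] at hsq
    have : κ.im = 0 := by nlinarith
    exact Complex.ext h this
  have hre2 : 1 - κ.re ≠ 0 := sub_ne_zero.2 hre1.symm
  set Y : ℂ := (1 + κ) / (1 - κ) with hY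
  have h1κ : (1 : ℂ) - κ ≠ 0 := sub_ne_zero.2 hκ1.symm
  have hYy : Y = ((κ.im / (1 - κ.re) : ℝ) : ℂ) * Complex.I := by
    obtain ⟨y, hy⟩ : ∃ y : ℝ, y = κ.im / (1 - κ.re) := ⟨_, rfl⟩
    have hy' : y * (1 - κ.re) = κ.im := by rw [hy]; field_simp
    rw [hY, div_eq_iff h1κ, ← hy]
    apply Complex.ext
    · have : (1 - κ.re) * (1 + κ.re - y * κ.im) = 0 := by
        linear_combination -κ.im * hy' - hsq
      simp
      linarith [(mul_eq_zero.1 this).resolve_left hre2]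
    · simp
      linarith
  have hκz : ∀ z ∈ ball (0 : ℂ) 1, κ * z ∈ ball (0 : ℂ) 1 := by
    intro z hz
    simpa [hκn] using hz
  set τ : ℂ → ℂ := fun z => 2 * deriv φ z / (dslope φ 0 z - κ * dslope φ 0 (κ * z)) - Y with hτ
  have hden : ∀ z ∈ ball (0 : ℂ) 1, dslope φ 0 z - κ * dslope φ 0 (κ * z) ≠ 0 :=
    fun z hz => hφ.dslope_ne_zero hκn.le hκ1 hz
  have hτd : DifferentiableOn ℂ τ (ball 0 1) := by
    have h2 : DifferentiableOn ℂ (fun z => dslope φ 0 (κ * z)) (ball 0 1) :=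
      hφ.differentiableOn_dslope.comp (by fun_prop) hκz
    exact ((hφ.differentiableOn_deriv.const_mul 2).div
      (hφ.differentiableOn_dslope.sub (h2.const_mul κ)) hden).sub_const Y
  have hd0 := hφ.deriv_ne_zero (show (0 : ℂ) ∈ ball (0 : ℂ) 1 by simp)
  have hτ0 : τ 0 = 1 := by
    simp only [hτ, mul_zero, dslope_same, hY]
    rw [← one_sub_mul]
    field_simp
    ring
  have hmul : ∀ z, z * (dslope φ 0 z - κ * dslope φ 0 (κ * z)) = φ z - φ (κ * z) := by
    intro z
    have e1 := sub_smul_dslope φ 0 z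
    have e2 := sub_smul_dslope φ 0 (κ * z)
    simp only [sub_zero, smul_eq_mul] at e1 e2
    linear_combination e1 - e2
  have hτre : ∀ z ∈ ball (0 : ℂ) 1, 0 ≤ (τ z).re := by
    intro z hz
    by_cases hz0 : z = 0
    · rw [hz0, hτ0]; simp
    have hc := hφ.convex.re_chord_nonneg hκn.le (by simpa using hz) hz0
    have hdz := hφ.deriv_ne_zero hz
    rw [← hmul z, mul_div_mul_left _ _ hz0] at hc
    have e : τ z = 2 * ((dslope φ 0 z - κ * dslope φ 0 (κ * z)) / deriv φ z)⁻¹ - Y := by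
      simp only [hτ, inv_div]
      ring
    rw [e, hYy, Complex.sub_re, Complex.re_ofReal_mul, Complex.I_re, mul_zero, sub_zero,
      show (2 : ℂ) = ((2 : ℝ) : ℂ) by norm_num, Complex.re_ofReal_mul, Complex.inv_re]
    exact mul_nonneg zero_le_two (div_nonneg hc (Complex.normSq_nonneg _))
  have hmem := neg_ofReal_mem_ball h0.le h1
  have hdm := hden _ hmem
  have hm := hmul (-(ρ : ℂ))
  have hm2 : φ (κ * -(ρ : ℂ)) = φ w := by rw [hκw]
  have hfac : φ w - φ (-(ρ : ℂ))
      = ρ * (dslope φ 0 (-(ρ : ℂ)) - κ * dslope φ 0 (κ * -(ρ : ℂ))) := by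
    linear_combination hm - hm2
  refine ⟨τ (-(ρ : ℂ)), κ.im / (1 - κ.re), ?_, ?_, ?_, ?_⟩
  · have := norm_sub_one_le_of_re_nonneg hτd hτ0 hτre (z := -(ρ : ℂ))
      (by simpa [abs_of_nonneg h0.le] using h1)
    rwa [norm_neg, Complex.norm_real, Real.norm_of_nonneg h0.le] at this
  · have : w.re = -(ρ * κ.re) := by
      rw [← hκw]; simp; ring
    rw [this]
    field_simp
    nlinarith
  · rw [← hYy, hfac]
    simp only [hτ, sub_add_cancel]
    rw [div_mul_eq_mul_div, div_eq_iff hdm]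
    ring
  · rw [hfac]
    exact mul_ne_zero hρc hdm

end IsRealConvex

/-- The hyperbolic disc in terms of its real diameter `[δ, 1 / δ]`, `δ = (1 - ρ) / (1 + ρ)`. -/
theorem harnack_disc {τ : ℂ} {ρ k : ℝ} (h0 : 0 < ρ) (h1 : ρ < 1) (hk : k * (1 - ρ) = 1 + ρ)
    (h : ‖τ - 1‖ ≤ ρ * ‖τ + 1‖) :
    k * (τ.re ^ 2 + τ.im ^ 2 + 1) ≤ (k ^ 2 + 1) * τ.re ∧ τ.re ≤ k ∧ 1 ≤ k * τ.re := by
  have h2 := normSq_le_of_norm_sub_one_le h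
  have hk0 : 0 < k := by
    by_contra hn
    nlinarith
  have e : k * (τ.re ^ 2 + τ.im ^ 2 + 1) ≤ (k ^ 2 + 1) * τ.re := by
    have e1 : (1 - ρ) ^ 2 * (k * (τ.re ^ 2 + τ.im ^ 2 + 1))
        = (1 - ρ ^ 2) * (τ.re ^ 2 + τ.im ^ 2 + 1) := by
      linear_combination (1 - ρ) * (τ.re ^ 2 + τ.im ^ 2 + 1) * hk
    have e2 : (1 - ρ) ^ 2 * ((k ^ 2 + 1) * τ.re) = 2 * (1 + ρ ^ 2) * τ.re := by
      linear_combination (k * (1 - ρ) + (1 + ρ)) * τ.re * hk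
    have e3 : 0 < (1 - ρ) ^ 2 := by nlinarith
    refine le_of_mul_le_mul_left ?_ e3
    rw [e1, e2]; exact h2
  have hfac : (τ.re - k) * (k * τ.re - 1) ≤ 0 := by nlinarith [sq_nonneg τ.im]
  have hk1 : 1 < k := by nlinarith
  refine ⟨e, ?_, ?_⟩
  · by_contra hn
    push Not at hn
    have h3 : 0 < k * τ.re - 1 := by nlinarith
    have := mul_pos (sub_pos.2 hn) h3
    linarith
  · by_contra hn
    push Not at hn
    have h3 : τ.re < k := by
      by_contra h4
      push Not at h4
      nlinarith
    have := mul_pos (sub_pos.2 h3) (sub_pos.2 hn)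
    linarith

/-- The Harnack inequality behind the two-sided comparison of `Re (1 - c / φ(w))` with
`ρ + Re w`, in the form used for the quadratic forms in `y`. -/
theorem harnack_bracket {t i k c d : ℝ} (hc : 0 < c) (hd : 0 < d) (hk : 1 ≤ k)
    (h : k * (t ^ 2 + i ^ 2 + 1) ≤ (k ^ 2 + 1) * t) (ht : t ≤ k) :
    0 ≤ (2 * d + c * k) ^ 2 * (2 * d + c * t)
      - (2 * d + c * k) * ((2 * d + c * t) ^ 2 + c ^ 2 * i ^ 2 + c ^ 2)
      + c ^ 2 * (2 * d + c * t) := by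
  set H := 2 * d + c * k with hH
  have hH0 : 0 < H := by positivity
  have hk0 : 0 < k := by linarith
  have e : k * ((2 * d + c * t) ^ 2 + c ^ 2 * i ^ 2 + c ^ 2)
      ≤ c ^ 2 * (k ^ 2 + 1) * t + k * (4 * d * c * t + 4 * d ^ 2) := by
    nlinarith [mul_le_mul_of_nonneg_left h (sq_nonneg c)]
  have e2 := mul_le_mul_of_nonneg_left e hH0.le
  have e3 : 0 ≤ 2 * d * c * (H * k + c) * (k - t) :=
    mul_nonneg (by positivity) (by linarith)
  have e4 : k * (H ^ 2 * (2 * d + c * t) + c ^ 2 * (2 * d + c * t))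
      - H * (c ^ 2 * (k ^ 2 + 1) * t + k * (4 * d * c * t + 4 * d ^ 2))
      = 2 * d * c * (H * k + c) * (k - t) := by
    rw [hH]; ring
  refine nonneg_of_mul_nonneg_right (a := k) ?_ hk0
  nlinarith

/-- Let `V = 2 d + c (τ + y I)` with `τ` in the hyperbolic disc, `t = Re τ` and `i = Im τ`. Then
`|V|² ≤ (2 d + c k) (2 d + c t) (1 + y²)` for all real `y`: the difference is a quadratic polynomial
in `y` with nonpositive discriminant, by `harnack_bracket`. -/
theorem harnack_lower {t i k c d y : ℝ} (hc : 0 < c) (hd : 0 < d) (hk : 1 ≤ k)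
    (h : k * (t ^ 2 + i ^ 2 + 1) ≤ (k ^ 2 + 1) * t) (ht : t ≤ k) (ht1 : 1 ≤ k * t) :
    (2 * d + c * t) ^ 2 + c ^ 2 * (i + y) ^ 2
      ≤ (2 * d + c * k) * (2 * d + c * t) * (1 + y ^ 2) := by
  have hb := harnack_bracket hc hd hk h ht
  set H := 2 * d + c * k
  set A := 2 * d + c * t with hA
  have ht0 : 0 < t := by nlinarith
  have hA0 : 0 < A := by positivity
  have hlead : 0 < H * A - c ^ 2 := by
    have : H * A - c ^ 2 = 4 * d ^ 2 + 2 * d * c * (k + t) + c ^ 2 * (k * t - 1) := by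
      simp only [H, hA]; ring
    rw [this]
    have : 0 ≤ c ^ 2 * (k * t - 1) := mul_nonneg (sq_nonneg c) (by linarith)
    positivity
  have e : (H * A - c ^ 2) * (H * A * (1 + y ^ 2) - A ^ 2 - c ^ 2 * (i + y) ^ 2)
      = ((H * A - c ^ 2) * y - c ^ 2 * i) ^ 2
        + A * (H ^ 2 * A - H * (A ^ 2 + c ^ 2 * i ^ 2 + c ^ 2) + c ^ 2 * A) := by ring
  have e2 : 0 ≤ (H * A - c ^ 2) * (H * A * (1 + y ^ 2) - A ^ 2 - c ^ 2 * (i + y) ^ 2) := by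
    rw [e]; exact add_nonneg (sq_nonneg _) (mul_nonneg hA0.le hb)
  have := nonneg_of_mul_nonneg_right e2 hlead
  linarith

/-- The reverse comparison, `c² (2 d + c t) (1 + y²) ≤ (2 d + c k) |V|²` in the notation of
`harnack_lower`, for the same reason. -/
theorem harnack_upper {t i k c d y : ℝ} (hc : 0 < c) (hd : 0 < d) (hk : 1 ≤ k)
    (h : k * (t ^ 2 + i ^ 2 + 1) ≤ (k ^ 2 + 1) * t) (ht : t ≤ k) (ht1 : 1 ≤ k * t) :
    c ^ 2 * (2 * d + c * t) * (1 + y ^ 2)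
      ≤ (2 * d + c * k) * ((2 * d + c * t) ^ 2 + c ^ 2 * (i + y) ^ 2) := by
  have hb := harnack_bracket hc hd hk h ht
  set H := 2 * d + c * k with hH
  set A := 2 * d + c * t with hA
  have ht0 : 0 < t := by nlinarith
  have hA0 : 0 < A := by positivity
  have hH0 : 0 < H := by positivity
  have hlead : 0 < H * A - c ^ 2 := by
    have : H * A - c ^ 2 = 4 * d ^ 2 + 2 * d * c * (k + t) + c ^ 2 * (k * t - 1) := by
      simp only [H, hA]; ring
    rw [this]
    have : 0 ≤ c ^ 2 * (k * t - 1) := mul_nonneg (sq_nonneg c) (by linarith)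
    positivity
  have hk0 : 0 < H * A ^ 2 + H * c ^ 2 * i ^ 2 - c ^ 2 * A := by
    have := mul_pos hA0 hlead
    have h3 : 0 ≤ H * c ^ 2 * i ^ 2 := by positivity
    nlinarith
  have e : (H * A ^ 2 + H * c ^ 2 * i ^ 2 - c ^ 2 * A)
        * (H * (A ^ 2 + c ^ 2 * (i + y) ^ 2) - c ^ 2 * A * (1 + y ^ 2))
      = (H * A ^ 2 + H * c ^ 2 * i ^ 2 - c ^ 2 * A + H * c ^ 2 * i * y) ^ 2
        + c ^ 2 * A * (H ^ 2 * A - H * (A ^ 2 + c ^ 2 * i ^ 2 + c ^ 2) + c ^ 2 * A) * y ^ 2 := by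
    ring
  have e2 : 0 ≤ (H * A ^ 2 + H * c ^ 2 * i ^ 2 - c ^ 2 * A)
      * (H * (A ^ 2 + c ^ 2 * (i + y) ^ 2) - c ^ 2 * A * (1 + y ^ 2)) := by
    rw [e]
    exact add_nonneg (sq_nonneg _) (mul_nonneg (mul_nonneg (by positivity) hb) (sq_nonneg _))
  have := nonneg_of_mul_nonneg_right e2 hk0
  linarith

namespace IsRealConvex

variable {φ : ℂ → ℂ}

/-- For `|w| ≤ ρ` the value `φ(w)` lies in the disc with diameter `[c, c + 2d / δ]`, where
`c = φ(-ρ)`, `d = ρ φ'(-ρ)` and `δ = (1 - ρ) / (1 + ρ)`. -/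
theorem normSq_sub_le (hφ : IsRealConvex φ) {ρ : ℝ} (h0 : 0 < ρ) (h1 : ρ < 1) {w : ℂ}
    (hw : ‖w‖ ≤ ρ) :
    (1 - ρ) * (((φ w).re - (φ (-(ρ : ℂ))).re) ^ 2 + (φ w).im ^ 2)
      ≤ 2 * (1 + ρ) * (ρ * (deriv φ (-(ρ : ℂ))).re) * ((φ w).re - (φ (-(ρ : ℂ))).re) := by
  set c := (φ (-(ρ : ℂ))).re with hc
  set Γ := (deriv φ (-(ρ : ℂ))).re with hΓ
  have hΓ0 : 0 < Γ := hφ.deriv_neg_pos h0.le h1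
  have hcc : φ (-(ρ : ℂ)) = (c : ℂ) := hφ.apply_neg h0.le h1
  have hΓc : deriv φ (-(ρ : ℂ)) = (Γ : ℂ) := hφ.deriv_neg h0.le h1
  obtain ⟨k, hk⟩ : ∃ k : ℝ, k * (1 - ρ) = 1 + ρ :=
    ⟨(1 + ρ) / (1 - ρ), div_mul_cancel₀ _ (by linarith)⟩
  have hk0 : 0 < k := by
    by_contra hn
    nlinarith
  have hiff : ∀ v : ℂ, ‖φ v - c - ((k * (ρ * Γ) : ℝ) : ℂ)‖ ≤ k * (ρ * Γ) ↔
      ((φ v).re - c) ^ 2 + (φ v).im ^ 2 ≤ 2 * k * (ρ * Γ) * ((φ v).re - c) := by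
    intro v
    rw [← sq_le_sq₀ (norm_nonneg _) (by positivity), ← Complex.normSq_eq_norm_sq,
      Complex.normSq_apply]
    simp only [Complex.sub_re, Complex.sub_im, Complex.ofReal_re, Complex.ofReal_im, sub_zero]
    constructor <;> intro h <;> nlinarith
  have hcirc : ∀ v : ℂ, ‖v‖ = ρ → ‖φ v - c - ((k * (ρ * Γ) : ℝ) : ℂ)‖ ≤ k * (ρ * Γ) := by
    intro v hv
    rw [hiff]
    by_cases hne : v = -(ρ : ℂ)
    · rw [hne, hcc]; simp
    obtain ⟨τ, y, hτ, -, he, hne0⟩ := hφ.exists_chord h0 h1 hv hne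
    obtain ⟨-, -, h3⟩ := harnack_disc h0 h1 hk hτ
    rw [hcc, hΓc] at he
    have e1 := congrArg Complex.re he
    have e2 := congrArg Complex.im he
    simp at e1 e2
    set x := (φ v).re - c
    set z := (φ v).im
    have : τ.re * (x ^ 2 + z ^ 2) = 2 * (ρ * Γ) * x := by
      linear_combination x * e1 + z * e2
    nlinarith [mul_nonneg (sub_nonneg.2 h3) (add_nonneg (sq_nonneg x) (sq_nonneg z))]
  have h := (hiff w).1 (norm_le_of_sphere h1 ((hφ.differentiableOn.sub_const _).sub_const _)
    hcirc hw)
  have h2 := mul_le_mul_of_nonneg_left h (by linarith : (0 : ℝ) ≤ 1 - ρ)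
  nlinarith

/-- On the circle `|w| = ρ`, `1 - c / φ(w) = 2 d / V` with `c = φ(-ρ)`, `d = ρ φ'(-ρ)`,
`V = 2 d + c (τ + y I)`, and `ρ + Re w = 2 ρ / (1 + y²)`. So both sides of the comparison of
`Re (1 - c / φ(w))` with `ρ + Re w` are explicit in `τ = t + i I` and `y`. -/
theorem re_one_sub_div (hφ : IsRealConvex φ) {ρ : ℝ} (h0 : 0 < ρ) (h1 : ρ < 1) {w : ℂ}
    (hw : ‖w‖ = ρ) (hne : w ≠ -(ρ : ℂ)) {k : ℝ} (hk : k * (1 - ρ) = 1 + ρ) :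
    ∃ t i y : ℝ, k * (t ^ 2 + i ^ 2 + 1) ≤ (k ^ 2 + 1) * t ∧ t ≤ k ∧ 1 ≤ k * t ∧
      (ρ + w.re) * (1 + y ^ 2) = 2 * ρ ∧
      (1 - ((φ (-(ρ : ℂ))).re : ℂ) / φ w).re
        * ((2 * (ρ * (deriv φ (-(ρ : ℂ))).re) + (φ (-(ρ : ℂ))).re * t) ^ 2
          + (φ (-(ρ : ℂ))).re ^ 2 * (i + y) ^ 2)
        = 2 * (ρ * (deriv φ (-(ρ : ℂ))).re)
          * (2 * (ρ * (deriv φ (-(ρ : ℂ))).re) + (φ (-(ρ : ℂ))).re * t) := by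
  set c := (φ (-(ρ : ℂ))).re with hc
  set Γ := (deriv φ (-(ρ : ℂ))).re with hΓ
  have hcc : φ (-(ρ : ℂ)) = (c : ℂ) := hφ.apply_neg h0.le h1
  have hΓc : deriv φ (-(ρ : ℂ)) = (Γ : ℂ) := hφ.deriv_neg h0.le h1
  obtain ⟨τ, y, hτ, hy, he, hne0⟩ := hφ.exists_chord h0 h1 hw hne
  obtain ⟨h3, h4, h5⟩ := harnack_disc h0 h1 hk hτ
  refine ⟨τ.re, τ.im, y, h3, h4, h5, hy, ?_⟩
  have hwb : w ∈ ball (0 : ℂ) 1 := by simp [hw, h1]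
  have hφw := hφ.ne_zero hwb
  rw [hcc, hΓc] at he
  set V : ℂ := 2 * (ρ * Γ) + c * (τ + y * Complex.I) with hV
  have hVre : V.re = 2 * (ρ * Γ) + c * τ.re := by simp [hV]
  have hVim : V.im = c * (τ.im + y) := by simp [hV]
  have hζ : (1 - (c : ℂ) / φ w) * V = 2 * (ρ * Γ) := by
    have h6 : (τ + y * Complex.I) * φ w - c * (τ + y * Complex.I) = 2 * (ρ * Γ) := by
      linear_combination he
    have h7 : V = (τ + y * Complex.I) * φ w := by
      rw [hV]; linear_combination -h6
    rw [h7, sub_mul, div_mul_eq_mul_div, mul_div_assoc, mul_div_cancel_right₀ _ hφw]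
    linear_combination h6
  have e1 := congrArg Complex.re hζ
  have e2 := congrArg Complex.im hζ
  rw [Complex.mul_re, hVre, hVim] at e1
  rw [Complex.mul_im, hVre, hVim] at e2
  simp only [Complex.mul_re, Complex.mul_im, Complex.re_ofNat, Complex.im_ofNat,
    Complex.ofReal_re, Complex.ofReal_im, mul_zero, zero_mul, sub_zero, add_zero] at e1 e2
  linear_combination (2 * (ρ * Γ) + c * τ.re) * e1 + (c * (τ.im + y)) * e2

/-- Lower comparison of `Re (1 - c / φ(w))` with `φ'(-ρ) (ρ + Re w)`. -/
theorem le_re_one_sub_div (hφ : IsRealConvex φ) {ρ : ℝ} (h0 : 0 < ρ) (h1 : ρ < 1) {w : ℂ}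
    (hw : ‖w‖ ≤ ρ) {k : ℝ} (hk : k * (1 - ρ) = 1 + ρ) :
    (deriv φ (-(ρ : ℂ))).re * (ρ + w.re) ≤
      (2 * (ρ * (deriv φ (-(ρ : ℂ))).re) + (φ (-(ρ : ℂ))).re * k)
        * (1 - ((φ (-(ρ : ℂ))).re : ℂ) / φ w).re := by
  have hcc : φ (-(ρ : ℂ)) = ((φ (-(ρ : ℂ))).re : ℂ) := hφ.apply_neg h0.le h1
  have hc0 := hφ.re_pos _ (neg_ofReal_mem_ball h0.le h1)
  have hΓ0 := hφ.deriv_neg_pos h0.le h1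
  set c := (φ (-(ρ : ℂ))).re with hc
  set Γ := (deriv φ (-(ρ : ℂ))).re with hΓ
  have hk1 : 1 ≤ k := by
    by_contra hn
    nlinarith
  have h := re_nonneg_of_sphere (f := fun v => ((2 * (ρ * Γ) + c * k : ℝ) : ℂ) * (1 - (c : ℂ) / φ v)
    - (Γ : ℂ) * (ρ + v)) h1 ?_ ?_ hw
  · rw [Complex.sub_re, Complex.re_ofReal_mul, Complex.re_ofReal_mul, Complex.add_re,
      Complex.ofReal_re] at h
    linarith
  · refine DifferentiableOn.sub (DifferentiableOn.const_mul (DifferentiableOn.const_sub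
      (DifferentiableOn.div (differentiableOn_const _) hφ.differentiableOn
        fun v hv => hφ.ne_zero hv) 1) _) ?_
    fun_prop
  · intro v hv
    rw [Complex.sub_re, Complex.re_ofReal_mul, Complex.re_ofReal_mul, Complex.add_re,
      Complex.ofReal_re]
    by_cases hne : v = -(ρ : ℂ)
    · rw [hne, hcc, div_self (by exact_mod_cast hc0.ne')]
      simp
    obtain ⟨t, i, y, h3, h4, h5, hy, he⟩ := hφ.re_one_sub_div h0 h1 hv hne hk
    rw [← hc, ← hΓ] at he
    have hd : 0 < ρ * Γ := by positivity
    have hl := harnack_lower (y := y) hc0 hd hk1 h3 h4 h5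
    have ht0 : 0 < t := by nlinarith
    have hpos : 0 < (2 * (ρ * Γ) + c * t) ^ 2 + c ^ 2 * (i + y) ^ 2 := by positivity
    have hy1 : 0 < 1 + y ^ 2 := by positivity
    refine nonneg_of_mul_nonneg_right (a := ((2 * (ρ * Γ) + c * t) ^ 2 + c ^ 2 * (i + y) ^ 2)
      * (1 + y ^ 2)) ?_ (by positivity)
    have e : ((2 * (ρ * Γ) + c * t) ^ 2 + c ^ 2 * (i + y) ^ 2) * (1 + y ^ 2)
        * ((2 * (ρ * Γ) + c * k) * (1 - (c : ℂ) / φ v).re - Γ * (ρ + v.re))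
        = 2 * (ρ * Γ) * ((2 * (ρ * Γ) + c * k) * (2 * (ρ * Γ) + c * t) * (1 + y ^ 2)
          - ((2 * (ρ * Γ) + c * t) ^ 2 + c ^ 2 * (i + y) ^ 2)) := by
      linear_combination (1 + y ^ 2) * (2 * (ρ * Γ) + c * k) * he
        - ((2 * (ρ * Γ) + c * t) ^ 2 + c ^ 2 * (i + y) ^ 2) * Γ * hy
    rw [e]
    exact mul_nonneg (by positivity) (by linarith)

/-- Upper comparison of `Re (1 - c / φ(w))` with `φ'(-ρ) (ρ + Re w)`. -/
theorem re_one_sub_div_le (hφ : IsRealConvex φ) {ρ : ℝ} (h0 : 0 < ρ) (h1 : ρ < 1) {w : ℂ}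
    (hw : ‖w‖ ≤ ρ) {k : ℝ} (hk : k * (1 - ρ) = 1 + ρ) :
    (φ (-(ρ : ℂ))).re ^ 2 * (1 - ((φ (-(ρ : ℂ))).re : ℂ) / φ w).re ≤
      (2 * (ρ * (deriv φ (-(ρ : ℂ))).re) + (φ (-(ρ : ℂ))).re * k)
        * ((deriv φ (-(ρ : ℂ))).re * (ρ + w.re)) := by
  have hcc : φ (-(ρ : ℂ)) = ((φ (-(ρ : ℂ))).re : ℂ) := hφ.apply_neg h0.le h1
  have hc0 := hφ.re_pos _ (neg_ofReal_mem_ball h0.le h1)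
  have hΓ0 := hφ.deriv_neg_pos h0.le h1
  set c := (φ (-(ρ : ℂ))).re with hc
  set Γ := (deriv φ (-(ρ : ℂ))).re with hΓ
  have hk1 : 1 ≤ k := by
    by_contra hn
    nlinarith
  have h := re_nonneg_of_sphere (f := fun v => (((2 * (ρ * Γ) + c * k) * Γ : ℝ) : ℂ) * (ρ + v)
    - ((c ^ 2 : ℝ) : ℂ) * (1 - (c : ℂ) / φ v)) h1 ?_ ?_ hw
  · rw [Complex.sub_re, Complex.re_ofReal_mul, Complex.re_ofReal_mul, Complex.add_re,
      Complex.ofReal_re] at h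
    linarith
  · refine DifferentiableOn.sub (by fun_prop) (DifferentiableOn.const_mul
      (DifferentiableOn.const_sub (DifferentiableOn.div (differentiableOn_const _)
        hφ.differentiableOn fun v hv => hφ.ne_zero hv) 1) _)
  · intro v hv
    rw [Complex.sub_re, Complex.re_ofReal_mul, Complex.re_ofReal_mul, Complex.add_re,
      Complex.ofReal_re]
    by_cases hne : v = -(ρ : ℂ)
    · rw [hne, hcc, div_self (by exact_mod_cast hc0.ne')]
      simp
    obtain ⟨t, i, y, h3, h4, h5, hy, he⟩ := hφ.re_one_sub_div h0 h1 hv hne hk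
    rw [← hc, ← hΓ] at he
    have hd : 0 < ρ * Γ := by positivity
    have hl := harnack_upper (y := y) hc0 hd hk1 h3 h4 h5
    have ht0 : 0 < t := by nlinarith
    have hpos : 0 < (2 * (ρ * Γ) + c * t) ^ 2 + c ^ 2 * (i + y) ^ 2 := by positivity
    have hy1 : 0 < 1 + y ^ 2 := by positivity
    refine nonneg_of_mul_nonneg_right (a := ((2 * (ρ * Γ) + c * t) ^ 2 + c ^ 2 * (i + y) ^ 2)
      * (1 + y ^ 2)) ?_ (by positivity)
    have e : ((2 * (ρ * Γ) + c * t) ^ 2 + c ^ 2 * (i + y) ^ 2) * (1 + y ^ 2)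
        * ((2 * (ρ * Γ) + c * k) * Γ * (ρ + v.re) - c ^ 2 * (1 - (c : ℂ) / φ v).re)
        = 2 * (ρ * Γ) * ((2 * (ρ * Γ) + c * k)
          * ((2 * (ρ * Γ) + c * t) ^ 2 + c ^ 2 * (i + y) ^ 2)
          - c ^ 2 * (2 * (ρ * Γ) + c * t) * (1 + y ^ 2)) := by
      linear_combination -(1 + y ^ 2) * c ^ 2 * he
        + ((2 * (ρ * Γ) + c * t) ^ 2 + c ^ 2 * (i + y) ^ 2) * ((2 * (ρ * Γ) + c * k) * Γ) * hy
    rw [e]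
    exact mul_nonneg (by positivity) (by linarith)

end IsRealConvex

/-! ### The first-contact principle and the first-order system -/

/-- First-contact principle: a function on an annulus that is positive on the inner circle and
whose radial derivative is positive at every zero where the angular derivative vanishes, is
positive throughout. -/
theorem pos_of_contact {F : ℂ → ℝ} {r₀ r₁ : ℝ} (hr₀ : 0 < r₀)
    (hc : ContinuousOn F {z | r₀ ≤ ‖z‖ ∧ ‖z‖ ≤ r₁}) (h₀ : ∀ z : ℂ, ‖z‖ = r₀ → 0 < F z)
    (h : ∀ z : ℂ, r₀ < ‖z‖ → ‖z‖ ≤ r₁ → F z = 0 → ∃ Fρ Fθ : ℝ,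
      HasDerivAt (fun t : ℝ => F (t * z)) Fρ 1 ∧
      HasDerivAt (fun t : ℝ => F (z * Complex.exp (t * Complex.I))) Fθ 0 ∧ (Fθ = 0 → 0 < Fρ))
    {z : ℂ} (hz₀ : r₀ ≤ ‖z‖) (hz₁ : ‖z‖ ≤ r₁) : 0 < F z := by
  by_contra hneg
  push Not at hneg
  set A : Set ℂ := {z | r₀ ≤ ‖z‖ ∧ ‖z‖ ≤ r₁} with hA
  have hAc : IsCompact A := by
    refine (isCompact_closedBall (0 : ℂ) r₁).of_isClosed_subset ?_ fun z hz => by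
      simpa using hz.2
    exact (isClosed_le continuous_const continuous_norm).inter
      (isClosed_le continuous_norm continuous_const)
  have hB : IsCompact (A ∩ F ⁻¹' Iic 0) :=
    hAc.of_isClosed_subset (hc.preimage_isClosed_of_isClosed hAc.isClosed isClosed_Iic)
      inter_subset_left
  obtain ⟨w, ⟨hwA, hw0⟩, hmin⟩ := hB.exists_isMinOn ⟨z, ⟨hz₀, hz₁⟩, hneg⟩
    continuous_norm.continuousOn
  have hpos : ∀ x ∈ A, ‖x‖ < ‖w‖ → 0 < F x := by
    intro x hx hxw
    by_contra hx0
    push Not at hx0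
    exact absurd (hmin ⟨hx, hx0⟩) (not_le.2 hxw)
  have hwr : r₀ < ‖w‖ := lt_of_le_of_ne hwA.1 fun he => by
    have := h₀ w he.symm
    exact absurd hw0 (not_le.2 this)
  have hw_pos : 0 < ‖w‖ := hr₀.trans hwr
  -- points slightly inside the circle through `w`
  have hev : ∀ᶠ t : ℝ in 𝓝[<] 1, r₀ / ‖w‖ < t ∧ t < 1 := by
    have h1 : r₀ / ‖w‖ < 1 := (div_lt_one hw_pos).2 hwr
    filter_upwards [Ioo_mem_nhdsLT h1] with t ht using ht
  have hin : ∀ x : ℂ, ‖x‖ = ‖w‖ → ∀ t : ℝ, r₀ / ‖w‖ < t → t < 1 →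
      (t * x : ℂ) ∈ A ∧ ‖(t * x : ℂ)‖ < ‖w‖ := by
    intro x hx t ht0 ht1
    have ht : 0 < t := lt_of_le_of_lt (by positivity) ht0
    rw [div_lt_iff₀ hw_pos] at ht0
    have hn : ‖(t * x : ℂ)‖ = t * ‖w‖ := by
      rw [norm_mul, Complex.norm_real, Real.norm_of_nonneg ht.le, hx]
    have h2 : t * ‖w‖ < ‖w‖ := by nlinarith
    refine ⟨⟨?_, ?_⟩, ?_⟩
    · rw [hn]; exact ht0.le
    · rw [hn]; exact h2.le.trans hwA.2
    · rw [hn]; exact h2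
  have hnonneg : ∀ x : ℂ, ‖x‖ = ‖w‖ → 0 ≤ F x := by
    intro x hx
    have hxA : x ∈ A := ⟨by rw [hx]; exact hwA.1, by rw [hx]; exact hwA.2⟩
    have h1 : Tendsto (fun t : ℝ => (t * x : ℂ)) (𝓝[<] 1) (𝓝[A] x) := by
      refine tendsto_nhdsWithin_iff.2 ⟨?_, ?_⟩
      · have : ContinuousAt (fun t : ℝ => (t * x : ℂ)) 1 := by fun_prop
        have h2 := this.tendsto
        simp only [Complex.ofReal_one, one_mul] at h2
        exact h2.mono_left nhdsWithin_le_nhds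
      · filter_upwards [hev] with t ht using (hin x hx t ht.1 ht.2).1
    refine ge_of_tendsto ((hc x hxA).tendsto.comp h1) ?_
    filter_upwards [hev] with t ht
    exact (hpos _ (hin x hx t ht.1 ht.2).1 (hin x hx t ht.1 ht.2).2).le
  have hFw : F w = 0 := le_antisymm hw0 (hnonneg w rfl)
  obtain ⟨Fρ, Fθ, h1, h2, h3⟩ := h w hwr hwA.2 hFw
  have hθ : Fθ = 0 := by
    refine IsLocalMin.hasDerivAt_eq_zero (Eventually.of_forall fun t => ?_) h2
    simp only [Complex.ofReal_zero, zero_mul, Complex.exp_zero, mul_one, hFw]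
    exact hnonneg _ (by rw [norm_mul, Complex.norm_exp_ofReal_mul_I, mul_one])
  have hρ := h3 hθ
  have h4 := (hasDerivAt_iff_tendsto_slope.1 h1).eventually (lt_mem_nhds hρ)
  have h5 : ∀ᶠ t : ℝ in 𝓝[<] 1, 0 < slope (fun t : ℝ => F (t * w)) 1 t :=
    h4.filter_mono (nhdsWithin_mono _ fun t ht => ne_of_lt ht)
  obtain ⟨t, ht, ht0, ht1⟩ := (h5.and hev).exists
  rw [slope_def_field] at ht
  simp only [Complex.ofReal_one, one_mul, hFw, sub_zero] at ht
  have := hpos _ (hin w rfl t ht0 ht1).1 (hin w rfl t ht0 ht1).2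
  exact absurd ht (not_lt.2 (div_nonpos_of_nonneg_of_nonpos this.le (by linarith)))

theorem hasDerivAt_radial {G : ℂ → ℂ} {z G' : ℂ} (h : HasDerivAt G G' z) :
    HasDerivAt (fun t : ℝ => G (t * z)) (z * G') 1 := by
  have h1 : HasDerivAt (fun t : ℝ => (t * z : ℂ)) z 1 := by
    simpa using (HasDerivAt.ofReal_comp (hasDerivAt_id (1 : ℝ))).mul_const z
  have h2 : HasDerivAt G G' (((1 : ℝ) : ℂ) * z) := by simpa using h
  exact (h2.comp (1 : ℝ) h1).congr_deriv (mul_comm _ _)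

theorem hasDerivAt_angular {G : ℂ → ℂ} {z G' : ℂ} (h : HasDerivAt G G' z) :
    HasDerivAt (fun t : ℝ => G (z * Complex.exp (t * Complex.I))) (Complex.I * (z * G')) 0 := by
  have h1 : HasDerivAt (fun t : ℝ => z * Complex.exp (t * Complex.I)) (z * Complex.I) 0 := by
    have := ((HasDerivAt.ofReal_comp (hasDerivAt_id (0 : ℝ))).mul_const Complex.I).cexp.const_mul z
    simpa using this
  have h2 : HasDerivAt G G' (z * Complex.exp (((0 : ℝ) : ℂ) * Complex.I)) := by simpa using h
  exact (h2.comp (0 : ℝ) h1).congr_deriv (by ring)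

theorem hasDerivAt_re {g : ℝ → ℂ} {g' : ℂ} {t : ℝ} (h : HasDerivAt g g' t) :
    HasDerivAt (fun x => (g x).re) g'.re t := by
  exact Complex.reCLM.hasFDerivAt.comp_hasDerivAt t h

theorem hasDerivAt_norm_radial {H : ℝ → ℝ} {z : ℂ} {H' : ℝ} (h : HasDerivAt H H' ‖z‖) :
    HasDerivAt (fun t : ℝ => H ‖(t * z : ℂ)‖) (‖z‖ * H') 1 := by
  have h1 : HasDerivAt (fun t : ℝ => t * ‖z‖) ‖z‖ 1 := by
    simpa using (hasDerivAt_id (1 : ℝ)).mul_const ‖z‖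
  have h2 : HasDerivAt H H' (1 * ‖z‖) := by simpa using h
  have h3 := (h2.comp (1 : ℝ) h1).congr_deriv (mul_comm _ _)
  refine h3.congr_of_eventuallyEq ?_
  filter_upwards [lt_mem_nhds (zero_lt_one (α := ℝ))] with t ht
  rw [norm_mul, Complex.norm_real, Real.norm_of_nonneg (le_of_lt ht)]
  rfl

theorem hasDerivAt_norm_angular (H : ℝ → ℝ) (z : ℂ) :
    HasDerivAt (fun t : ℝ => H ‖z * Complex.exp (t * Complex.I)‖) 0 0 := by
  have : (fun t : ℝ => H ‖z * Complex.exp (t * Complex.I)‖) = fun _ => H ‖z‖ := by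
    funext t
    rw [norm_mul, Complex.norm_exp_ofReal_mul_I, mul_one]
  rw [this]
  exact hasDerivAt_const _ _

/-- The first-order system attached to a function `f` of the class: `S = f' / F'` and
`v = f / (z F')`, where `2 F'` is the derivative of `f(z) + conj (f (conj z))`, while `a = φ ∘ ω₁`
and `b = φ ∘ ω₂` are the subordinate functions of `f` and of `conj (f (conj z))`. -/
structure ConjSystem (φ ω₁ ω₂ S v : ℂ → ℂ) : Prop where
  diff₁ : DifferentiableOn ℂ ω₁ (ball 0 1)
  diff₂ : DifferentiableOn ℂ ω₂ (ball 0 1)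
  norm₁ : ∀ z ∈ ball (0 : ℂ) 1, ‖ω₁ z‖ ≤ ‖z‖
  norm₂ : ∀ z ∈ ball (0 : ℂ) 1, ‖ω₂ z‖ ≤ ‖z‖
  diffS : DifferentiableOn ℂ S (ball 0 1)
  diffv : DifferentiableOn ℂ v (ball 0 1)
  S_zero : S 0 = 1
  v_zero : v 0 = 1
  eqS : ∀ z ∈ ball (0 : ℂ) 1, z * deriv S z = φ (ω₁ z) - (φ (ω₁ z) + φ (ω₂ z)) / 2 * S z
  eqv : ∀ z ∈ ball (0 : ℂ) 1, z * deriv v z = S z - (φ (ω₁ z) + φ (ω₂ z)) / 2 * v z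

namespace ConjSystem

variable {φ ω₁ ω₂ S v : ℂ → ℂ}

theorem mem_ball_of_norm_le {z w : ℂ} (hz : z ∈ ball (0 : ℂ) 1) (h : ‖w‖ ≤ ‖z‖) :
    w ∈ ball (0 : ℂ) 1 := by
  simp only [mem_ball, dist_zero_right] at hz ⊢
  linarith

theorem diff_comp (hφ : IsRealConvex φ) {ω : ℂ → ℂ} (h : DifferentiableOn ℂ ω (ball 0 1))
    (hn : ∀ z ∈ ball (0 : ℂ) 1, ‖ω z‖ ≤ ‖z‖) :
    DifferentiableOn ℂ (fun z => φ (ω z)) (ball 0 1) :=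
  hφ.differentiableOn.comp h fun z hz => mem_ball_of_norm_le hz (hn z hz)

theorem hasDerivAt_of_diff {g : ℂ → ℂ} (h : DifferentiableOn ℂ g (ball 0 1)) {z : ℂ}
    (hz : z ∈ ball (0 : ℂ) 1) : HasDerivAt g (deriv g z) z :=
  (h.differentiableAt (isOpen_ball.mem_nhds hz)).hasDerivAt

/-- At a contact point the system forces `(C₀ + k) |U| ≤ R₀ √(1 + |U|²)`, where the values of `φ`
on `|w| ≤ ρ` lie in the disc of centre `C₀` and radius `R₀`. -/
theorem normSq_le_of_contact {a b U : ℂ} {k C R : ℝ} (hk : 0 ≤ k) (hC : 0 ≤ C)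
    (ha : ‖a - C‖ ≤ R) (hb : ‖b - C‖ ≤ R) (h : (k + (a + b) / 2) * U = (a - b) / 2) :
    (k + C) ^ 2 * ‖U‖ ^ 2 ≤ R ^ 2 * (1 + ‖U‖ ^ 2) := by
  set e := (a + b) / 2 - C with he
  set x := (a - b) / 2 with hx
  have hR : 0 ≤ R := (norm_nonneg _).trans ha
  have hpar : ‖e‖ ^ 2 + ‖x‖ ^ 2 ≤ R ^ 2 := by
    have h1 := parallelogram_law_with_norm ℝ e x
    have e1 : e + x = a - C := by rw [he, hx]; ring
    have e2 : e - x = b - C := by rw [he, hx]; ring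
    rw [e1, e2] at h1
    nlinarith [norm_nonneg (a - C), norm_nonneg (b - C)]
  have hlow : (k + C) * ‖U‖ ≤ ‖x‖ + ‖e‖ * ‖U‖ := by
    have h2 : (((k + C : ℝ) : ℂ)) * U = x - e * U := by
      push_cast
      rw [← h, he]; ring
    have h3 := norm_sub_le x (e * U)
    rw [← h2, norm_mul, norm_mul, Complex.norm_real, Real.norm_of_nonneg (by positivity)] at h3
    exact h3
  have hcs : (‖x‖ + ‖e‖ * ‖U‖) ^ 2 ≤ (‖e‖ ^ 2 + ‖x‖ ^ 2) * (1 + ‖U‖ ^ 2) := by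
    nlinarith [sq_nonneg (‖x‖ * ‖U‖ - ‖e‖)]
  calc (k + C) ^ 2 * ‖U‖ ^ 2 = ((k + C) * ‖U‖) ^ 2 := by ring
    _ ≤ (‖x‖ + ‖e‖ * ‖U‖) ^ 2 := by gcongr
    _ ≤ _ := hcs
    _ ≤ _ := by gcongr

/-- The Carathéodory disc in terms of its centre and radius. -/
theorem _root_.norm_sub_center_le {a : ℂ} {ρ : ℝ} (h0 : 0 ≤ ρ) (h1 : ρ < 1)
    (h : ‖a - 1‖ ≤ ρ * ‖a + 1‖) :
    ‖a - (((1 + ρ ^ 2) / (1 - ρ ^ 2) : ℝ) : ℂ)‖ ≤ 2 * ρ / (1 - ρ ^ 2) := by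
  have h2 := normSq_le_of_norm_sub_one_le h
  have h3 : 0 < 1 - ρ ^ 2 := by nlinarith
  rw [← sq_le_sq₀ (norm_nonneg _) (by positivity), ← Complex.normSq_eq_norm_sq,
    Complex.normSq_apply]
  simp only [Complex.sub_re, Complex.sub_im, Complex.ofReal_re, Complex.ofReal_im, sub_zero]
  have e : ((a.re - (1 + ρ ^ 2) / (1 - ρ ^ 2)) * (a.re - (1 + ρ ^ 2) / (1 - ρ ^ 2))
      + a.im * a.im) - (2 * ρ / (1 - ρ ^ 2)) ^ 2
      = ((1 - ρ ^ 2) * (a.re ^ 2 + a.im ^ 2 + 1) - 2 * (1 + ρ ^ 2) * a.re) / (1 - ρ ^ 2) := by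
    field_simp
    ring
  have := div_nonpos_of_nonpos_of_nonneg (by linarith :
    (1 - ρ ^ 2) * (a.re ^ 2 + a.im ^ 2 + 1) - 2 * (1 + ρ ^ 2) * a.re ≤ 0) h3.le
  linarith

/-- The algebraic inequality closing the contact argument for `u = ρ + ρ³ / 3`. -/
theorem radius_ineq {ρ : ℝ} (h0 : 0 < ρ) (h1 : ρ ≤ 0.41422) :
    (2 * ρ / (1 - ρ ^ 2)) ^ 2 ≤ (ρ + ρ ^ 3 / 3) ^ 2 *
      ((3 * (1 + ρ ^ 2) / (3 + ρ ^ 2) + (1 + ρ ^ 2) / (1 - ρ ^ 2)) ^ 2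
        - (2 * ρ / (1 - ρ ^ 2)) ^ 2) := by
  have hx : ρ ^ 2 ≤ 0.17158 := by nlinarith
  have h3 : 0 < 1 - ρ ^ 2 := by linarith
  have h4 : 0 < 3 + ρ ^ 2 := by positivity
  have e : (ρ + ρ ^ 3 / 3) ^ 2 *
      ((3 * (1 + ρ ^ 2) / (3 + ρ ^ 2) + (1 + ρ ^ 2) / (1 - ρ ^ 2)) ^ 2
        - (2 * ρ / (1 - ρ ^ 2)) ^ 2) - (2 * ρ / (1 - ρ ^ 2)) ^ 2
      = ρ ^ 2 * (9 * (1 + ρ ^ 2) ^ 2 * (1 - ρ ^ 2) ^ 2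
        + 6 * (1 + ρ ^ 2) ^ 2 * (3 + ρ ^ 2) * (1 - ρ ^ 2)
        + (3 + ρ ^ 2) ^ 2 * (1 - ρ ^ 2) ^ 2 - 36) / (9 * (1 - ρ ^ 2) ^ 2) := by
    field_simp
    ring
  set x := ρ ^ 2 with hxd
  have hx0 : 0 ≤ x := by positivity
  have hp : 0 ≤ 9 * (1 + x) ^ 2 * (1 - x) ^ 2 + 6 * (1 + x) ^ 2 * (3 + x) * (1 - x)
        + (3 + x) ^ 2 * (1 - x) ^ 2 - 36 := by
    have : 9 * (1 + x) ^ 2 * (1 - x) ^ 2 + 6 * (1 + x) ^ 2 * (3 + x) * (1 - x)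
        + (3 + x) ^ 2 * (1 - x) ^ 2 - 36 = x * (12 - 32 * x - 20 * x ^ 2 + 4 * x ^ 3) := by ring
    rw [this]
    have : 0 ≤ 12 - 32 * x - 20 * x ^ 2 + 4 * x ^ 3 := by nlinarith [pow_nonneg hx0 3]
    positivity
  have : 0 ≤ x * (9 * (1 + x) ^ 2 * (1 - x) ^ 2 + 6 * (1 + x) ^ 2 * (3 + x) * (1 - x)
        + (3 + x) ^ 2 * (1 - x) ^ 2 - 36) / (9 * (1 - x) ^ 2) := by positivity
  linarith

end ConjSystem

/-! ### The estimate of `f' / F'` -/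

namespace ConjSystem

variable {φ ω₁ ω₂ S v : ℂ → ℂ}

/-- The limit of the first equation of the system at the origin is
`2 S'(0) = (a'(0) - b'(0)) / 2`, where `|a'(0)|` and `|b'(0)|` are at most `2`. -/
theorem norm_deriv_S_zero_le (hφ : IsRealConvex φ) (h : ConjSystem φ ω₁ ω₂ S v) :
    ‖deriv S 0‖ ≤ 1 := by
  have h0 : (0 : ℂ) ∈ ball (0 : ℂ) 1 := by simp
  have ha := diff_comp hφ h.diff₁ h.norm₁
  have hb := diff_comp hφ h.diff₂ h.norm₂
  have hω₁ : ω₁ 0 = 0 := by simpa using h.norm₁ 0 h0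
  have hω₂ : ω₂ 0 = 0 := by simpa using h.norm₂ 0 h0
  have hca := (ha.differentiableAt (isOpen_ball.mem_nhds h0)).continuousAt
  have hcb := (hb.differentiableAt (isOpen_ball.mem_nhds h0)).continuousAt
  have hd : ContinuousAt (dslope S 0) 0 :=
    continuousAt_dslope_same.2 (h.diffS.differentiableAt (isOpen_ball.mem_nhds h0))
  have hS' : ContinuousAt (deriv S) 0 :=
    ((h.diffS.analyticOnNhd isOpen_ball).deriv 0 h0).continuousAt
  have hlim : Tendsto (fun z => ‖deriv S z + (φ (ω₁ z) + φ (ω₂ z)) / 2 * dslope S 0 z‖)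
      (𝓝[≠] 0) (𝓝 ‖deriv S 0 + (φ (ω₁ 0) + φ (ω₂ 0)) / 2 * dslope S 0 0‖) := by
    have : ContinuousAt (fun z => ‖deriv S z + (φ (ω₁ z) + φ (ω₂ z)) / 2 * dslope S 0 z‖) 0 :=
      (hS'.add (((hca.add hcb).div_const 2).mul hd)).norm
    exact this.tendsto.mono_left nhdsWithin_le_nhds
  have hlim2 : Tendsto (fun z : ℂ => 2 / (1 - ‖z‖ ^ 2)) (𝓝[≠] 0) (𝓝 (2 / (1 - ‖(0 : ℂ)‖ ^ 2))) := by
    have : ContinuousAt (fun z : ℂ => 2 / (1 - ‖z‖ ^ 2)) 0 := by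
      apply ContinuousAt.div continuousAt_const (by fun_prop) (by simp)
    exact this.tendsto.mono_left nhdsWithin_le_nhds
  have hle := le_of_tendsto_of_tendsto hlim hlim2 (by
    have hmem : ball (0 : ℂ) 1 ∈ 𝓝[≠] (0 : ℂ) := mem_nhdsWithin_of_mem_nhds
      (isOpen_ball.mem_nhds h0)
    filter_upwards [hmem, self_mem_nhdsWithin] with z hz hz0
    have hz0' : z ≠ 0 := hz0
    have hzn : 0 < ‖z‖ := norm_pos_iff.2 hz0'
    have hz1 : ‖z‖ < 1 := by simpa using hz
    have e1 := sub_smul_dslope S 0 z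
    rw [sub_zero, smul_eq_mul, h.S_zero] at e1
    have e2 := h.eqS z hz
    have e3 : z * (deriv S z + (φ (ω₁ z) + φ (ω₂ z)) / 2 * dslope S 0 z)
        = (φ (ω₁ z) - φ (ω₂ z)) / 2 := by
      linear_combination e2 + (φ (ω₁ z) + φ (ω₂ z)) / 2 * e1
    have h1 := norm_sub_center_le (norm_nonneg z) hz1 (hφ.norm_sub_one_le hz1 (h.norm₁ z hz))
    have h2 := norm_sub_center_le (norm_nonneg z) hz1 (hφ.norm_sub_one_le hz1 (h.norm₂ z hz))
    have h3 : ‖(φ (ω₁ z) - φ (ω₂ z)) / 2‖ ≤ 2 * ‖z‖ / (1 - ‖z‖ ^ 2) := by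
      rw [norm_div, Complex.norm_ofNat, div_le_iff₀ two_pos]
      have := norm_sub_le (φ (ω₁ z) - (((1 + ‖z‖ ^ 2) / (1 - ‖z‖ ^ 2) : ℝ) : ℂ))
        (φ (ω₂ z) - (((1 + ‖z‖ ^ 2) / (1 - ‖z‖ ^ 2) : ℝ) : ℂ))
      rw [sub_sub_sub_cancel_right] at this
      linarith
    rw [← e3, norm_mul] at h3
    refine le_of_mul_le_mul_left (h3.trans_eq ?_) hzn
    ring)
  rw [dslope_same, hω₁, hω₂, hφ.map_zero, add_self_div_two, one_mul, ← two_mul, norm_mul] at hle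
  simp at hle
  linarith

set_option maxHeartbeats 400000 in
/-- The control of `S = f' / F'` by a first-contact argument: the bound is sharp to first order, and
the cubic term makes the contact inequality `radius_ineq` hold up to `√2 - 1`. -/
theorem norm_S_sub_one_le (hφ : IsRealConvex φ) (h : ConjSystem φ ω₁ ω₂ S v) {z : ℂ}
    (hz : ‖z‖ ≤ 0.41422) : ‖S z - 1‖ ≤ ‖z‖ + ‖z‖ ^ 3 / 3 := by
  rcases eq_or_ne z 0 with rfl | hz0
  · simp [h.S_zero]
  have hzn : 0 < ‖z‖ := norm_pos_iff.2 hz0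
  have h0 : (0 : ℂ) ∈ ball (0 : ℂ) 1 := by simp
  have hball : ∀ x : ℂ, ‖x‖ ≤ 0.41422 → x ∈ ball (0 : ℂ) 1 := by
    intro x hx
    simp only [mem_ball, dist_zero_right]
    linarith
  -- the factor `t > 1` makes the inequality strict near the origin
  have key : ∀ t : ℝ, 1 < t → ‖S z - 1‖ ^ 2 < t * (‖z‖ + ‖z‖ ^ 3 / 3) ^ 2 := by
    intro t ht
    have hd : ContinuousAt (dslope S 0) 0 :=
      continuousAt_dslope_same.2 (h.diffS.differentiableAt (isOpen_ball.mem_nhds h0))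
    have hev : ∀ᶠ x in 𝓝 (0 : ℂ), ‖dslope S 0 x‖ ^ 2 < t := by
      have hc : ContinuousAt (fun x => ‖dslope S 0 x‖ ^ 2) 0 := by fun_prop
      refine hc.eventually_lt_const ?_
      simp only [dslope_same]
      have := h.norm_deriv_S_zero_le hφ
      nlinarith [norm_nonneg (deriv S 0)]
    obtain ⟨ε, hε, hev⟩ := Metric.eventually_nhds_iff.1 hev
    set r₀ := min (ε / 2) ‖z‖ with hr₀
    have hr₀0 : 0 < r₀ := by positivity
    have hSd : ∀ x : ℂ, ‖x‖ ≤ 0.41422 → HasDerivAt (fun y => S y - 1) (deriv S x) x :=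
      fun x hx => (hasDerivAt_of_diff h.diffS (hball x hx)).sub_const 1
    have := pos_of_contact (F := fun x => t * (‖x‖ + ‖x‖ ^ 3 / 3) ^ 2 - ‖S x - 1‖ ^ 2)
      (r₁ := 0.41422) hr₀0 ?_ ?_ ?_ (min_le_right _ _ : r₀ ≤ ‖z‖) hz
    · simpa using this
    · have hcS : ContinuousOn S {x | r₀ ≤ ‖x‖ ∧ ‖x‖ ≤ 0.41422} :=
        h.diffS.continuousOn.mono fun x hx => hball x hx.2
      fun_prop
    · intro x hx
      have hx1 : dist x 0 < ε := by
        rw [dist_zero_right, hx]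
        exact (min_le_left _ _).trans_lt (by linarith)
      have h1 := hev hx1
      have e1 := sub_smul_dslope S 0 x
      rw [sub_zero, smul_eq_mul, h.S_zero] at e1
      have hxn : 0 < ‖x‖ := by rw [hx]; exact hr₀0
      simp only [← e1, norm_mul]
      have h2 : ‖x‖ ^ 2 * ‖dslope S 0 x‖ ^ 2 < ‖x‖ ^ 2 * t :=
        mul_lt_mul_of_pos_left h1 (by positivity)
      have h3 : ‖x‖ ^ 2 ≤ (‖x‖ + ‖x‖ ^ 3 / 3) ^ 2 := by
        have : 0 ≤ ‖x‖ ^ 3 / 3 := by positivity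
        gcongr
        linarith
      nlinarith
    · intro x hx0 hx1 hF
      have hxb := hball x hx1
      have hxn : 0 < ‖x‖ := hr₀0.trans hx0
      set ρ := ‖x‖ with hρ
      have hρ1 : ρ < 1 := by linarith
      set U := S x - 1 with hU
      set W := x * deriv S x with hW
      have hd1 := (hasDerivAt_radial (hSd x hx1)).norm_sq
      have hd2 := (hasDerivAt_angular (hSd x hx1)).norm_sq
      have hu : HasDerivAt (fun p : ℝ => t * (p + p ^ 3 / 3) ^ 2)
          (t * (2 * (ρ + ρ ^ 3 / 3) * (1 + ρ ^ 2))) ρ := by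
        have h1 : HasDerivAt (fun p : ℝ => p + p ^ 3 / 3) (1 + ρ ^ 2) ρ :=
          ((hasDerivAt_id ρ).add ((hasDerivAt_pow 3 ρ).div_const 3)).congr_deriv (by norm_num)
        refine ((h1.pow 2).const_mul t).congr_deriv ?_
        norm_num
      refine ⟨_, _, (hasDerivAt_norm_radial hu).sub hd1,
        (hasDerivAt_norm_angular (fun p => t * (p + p ^ 3 / 3) ^ 2) x).sub hd2, ?_⟩
      simp only [Complex.ofReal_one, one_mul, Complex.ofReal_zero, zero_mul, Complex.exp_zero,
        mul_one, Complex.inner]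
      rw [← hU, ← hW, ← hρ]
      intro hθ
      by_contra hneg
      push Not at hneg
      have hF' : t * (ρ + ρ ^ 3 / 3) ^ 2 = ‖U‖ ^ 2 := by linarith
      set q := W * conj U with hq
      have hqim : q.im = 0 := by
        have : (Complex.I * W * conj U).re = -q.im := by
          rw [hq, mul_assoc]
          simp [Complex.mul_re]
        linarith
      have hu0 : 0 < ρ + ρ ^ 3 / 3 := by positivity
      have hU0 : 0 < ‖U‖ ^ 2 := by rw [← hF']; positivity
      have hUne : U ≠ 0 := by
        intro h; rw [h] at hU0; simp at hU0
      have hWU : W = ((q.re / ‖U‖ ^ 2 : ℝ) : ℂ) * U := by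
        have hcU : conj U ≠ 0 := by simpa using hUne
        apply mul_left_cancel₀ hcU
        rw [mul_comm (conj U) W, ← hq, mul_left_comm, mul_comm (conj U) U, Complex.mul_conj,
          Complex.normSq_eq_norm_sq,
          ← Complex.ofReal_mul, div_mul_cancel₀ _ hU0.ne']
        exact Complex.ext (by simp) (by simp [hqim])
      set k' := q.re / ‖U‖ ^ 2 with hk'
      set k := 3 * (1 + ρ ^ 2) / (3 + ρ ^ 2) with hk
      have hk0 : 0 < k := by positivity
      have hkk : k ≤ k' := by
        rw [hk', le_div_iff₀ hU0, ← hF']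
        have : k * (t * (ρ + ρ ^ 3 / 3) ^ 2) = t * ((ρ + ρ ^ 3 / 3) * (ρ * (1 + ρ ^ 2))) := by
          rw [hk]; field_simp
        rw [this]
        nlinarith
      have he := h.eqS x hxb
      rw [← hW, hWU] at he
      have hC0 : 0 < (1 + ρ ^ 2) / (1 - ρ ^ 2) := by
        have : 0 < 1 - ρ ^ 2 := by nlinarith
        positivity
      have hle := normSq_le_of_contact (a := φ (ω₁ x)) (b := φ (ω₂ x)) (U := U) (hk0.le.trans hkk)
        hC0.le
        (norm_sub_center_le hxn.le hρ1 (hφ.norm_sub_one_le hρ1 (h.norm₁ x hxb)))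
        (norm_sub_center_le hxn.le hρ1 (hφ.norm_sub_one_le hρ1 (h.norm₂ x hxb))) (by
          rw [hU] at he ⊢
          linear_combination he)
      have hrad := radius_ineq hxn hx1
      rw [← hk] at hrad
      set C := (1 + ρ ^ 2) / (1 - ρ ^ 2)
      set R := 2 * ρ / (1 - ρ ^ 2) with hR
      have h5 : (k + C) ^ 2 ≤ (k' + C) ^ 2 := by gcongr
      have hR0 : 0 < R := by
        have : 0 < 1 - ρ ^ 2 := by nlinarith
        positivity
      have h6 : 0 < (k + C) ^ 2 - R ^ 2 := by
        by_contra hn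
        push Not at hn
        have h9 := mul_nonpos_of_nonneg_of_nonpos (sq_nonneg (ρ + ρ ^ 3 / 3)) hn
        have h10 := sq_pos_of_pos hR0
        linarith
      have h7 : (ρ + ρ ^ 3 / 3) ^ 2 < ‖U‖ ^ 2 := by
        rw [← hF']
        exact lt_mul_of_one_lt_left (by positivity) ht
      have h8 := mul_lt_mul_of_pos_right h7 h6
      have h9 := mul_le_mul_of_nonneg_right h5 (sq_nonneg ‖U‖)
      rw [mul_sub] at h8
      linarith
  have h1 : ‖S z - 1‖ ^ 2 ≤ (‖z‖ + ‖z‖ ^ 3 / 3) ^ 2 := by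
    have hlim : Tendsto (fun t : ℝ => t * (‖z‖ + ‖z‖ ^ 3 / 3) ^ 2) (𝓝[>] 1)
        (𝓝 (1 * (‖z‖ + ‖z‖ ^ 3 / 3) ^ 2)) :=
      Tendsto.mono_left (Continuous.tendsto (by fun_prop) 1) nhdsWithin_le_nhds
    rw [one_mul] at hlim
    refine ge_of_tendsto hlim ?_
    filter_upwards [self_mem_nhdsWithin] with t ht using (key t ht).le
  exact le_of_sq_le_sq h1 (by positivity)

end ConjSystem

/-! ### The majorant -/

/-- A minimum principle on `[0, b)`: a function that is nonnegative at `0` and increasing wherever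
it is negative, is nonnegative. -/
theorem nonneg_of_deriv_pos_of_neg {g g' : ℝ → ℝ} {b : ℝ} (hc : ContinuousOn g (Ico 0 b))
    (h0 : 0 ≤ g 0) (hd : ∀ t, 0 < t → t < b → HasDerivAt g (g' t) t)
    (h : ∀ t, 0 < t → t < b → g t < 0 → 0 < g' t) {x : ℝ} (hx0 : 0 ≤ x) (hxb : x < b) :
    0 ≤ g x := by
  by_contra hneg
  push Not at hneg
  have hsub : Icc 0 x ⊆ Ico 0 b := fun t ht => ⟨ht.1, ht.2.trans_lt hxb⟩
  obtain ⟨t, ht, hmin⟩ := isCompact_Icc.exists_isMinOn ⟨x, hx0, le_rfl⟩ (hc.mono hsub)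
  have htneg : g t < 0 := (hmin (show x ∈ Icc 0 x from ⟨hx0, le_rfl⟩)).trans_lt hneg
  have ht0 : 0 < t := lt_of_le_of_ne ht.1 fun he => by
    rw [← he] at htneg
    linarith
  have htb := ht.2.trans_lt hxb
  have h1 := h t ht0 htb htneg
  have h2 := (hasDerivAt_iff_tendsto_slope.1 (hd t ht0 htb)).eventually (lt_mem_nhds h1)
  have h3 : ∀ᶠ s in 𝓝[<] t, 0 < slope g t s :=
    h2.filter_mono (nhdsWithin_mono _ fun s hs => ne_of_lt hs)
  obtain ⟨s, hs, hs1⟩ := (h3.and (Ioo_mem_nhdsLT ht0)).exists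
  rw [slope_def_field] at hs
  have h4 : g t ≤ g s := hmin ⟨hs1.1.le, hs1.2.le.trans ht.2⟩
  exact absurd hs (not_lt.2 (div_nonpos_of_nonneg_of_nonpos (by linarith) (by linarith [hs1.2])))

/-- The majorant `M(ρ) = Re (1 / ψ(-ρ))`, characterised by its differential equation on the
negative radius. -/
structure IsMajorant (φ : ℂ → ℂ) (M : ℝ → ℝ) : Prop where
  map_zero : M 0 = 1
  differentiableAt : ∀ ρ, 0 ≤ ρ → ρ < 1 → DifferentiableAt ℝ M ρ
  eqn : ∀ ρ, 0 ≤ ρ → ρ < 1 → ρ * deriv M ρ = 1 - (φ (-(ρ : ℂ))).re * M ρ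

namespace IsMajorant

variable {φ : ℂ → ℂ} {M : ℝ → ℝ}

theorem hasDerivAt (h : IsMajorant φ M) {ρ : ℝ} (h0 : 0 ≤ ρ) (h1 : ρ < 1) :
    HasDerivAt M (deriv M ρ) ρ :=
  (h.differentiableAt ρ h0 h1).hasDerivAt

theorem continuousOn (h : IsMajorant φ M) : ContinuousOn M (Ico 0 1) :=
  fun ρ hρ => (h.differentiableAt ρ hρ.1 hρ.2).continuousAt.continuousWithinAt

theorem one_le (h : IsMajorant φ M) (hφ : IsRealConvex φ) {ρ : ℝ} (h0 : 0 ≤ ρ) (h1 : ρ < 1) :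
    1 ≤ M ρ := by
  refine sub_nonneg.1 (nonneg_of_deriv_pos_of_neg (g := fun t => M t - 1) (g' := deriv M)
    (h.continuousOn.sub continuousOn_const) (by simp [h.map_zero])
    (fun t ht0 ht1 => (h.hasDerivAt ht0.le ht1).sub_const 1) (fun t ht0 ht1 hneg => ?_) h0 h1)
  have e := h.eqn t ht0.le ht1
  have hc0 := hφ.re_pos _ (neg_ofReal_mem_ball ht0.le ht1)
  have hc1 := hφ.apply_neg_le_one ht0.le ht1
  refine pos_of_mul_pos_right (a := t) ?_ ht0.le
  rw [e]
  nlinarith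

theorem le_one_add (h : IsMajorant φ M) (hφ : IsRealConvex φ) {ρ : ℝ} (h0 : 0 ≤ ρ) (h1 : ρ < 1) :
    M ρ ≤ 1 + ρ := by
  refine sub_nonneg.1 (nonneg_of_deriv_pos_of_neg (g := fun t => (1 + t) - M t)
    (g' := fun t => 1 - deriv M t)
    ((continuousOn_const.add continuousOn_id).sub h.continuousOn) (by simp [h.map_zero])
    (fun t ht0 ht1 => ((hasDerivAt_id t).const_add 1).sub (h.hasDerivAt ht0.le ht1))
    (fun t ht0 ht1 hneg => ?_) h0 h1)
  have e := h.eqn t ht0.le ht1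
  have hc := hφ.le_apply_neg ht0.le ht1
  have hc0 := hφ.re_pos _ (neg_ofReal_mem_ball ht0.le ht1)
  refine pos_of_mul_pos_right (a := t) ?_ ht0.le
  rw [mul_sub, e]
  nlinarith

/-- The function `W = φ(-ρ) M(ρ)`, with its derivative. -/
theorem hasDerivAt_mul (h : IsMajorant φ M) (hφ : IsRealConvex φ) {ρ : ℝ} (h0 : 0 ≤ ρ)
    (h1 : ρ < 1) : HasDerivAt (fun t : ℝ => (φ (-(t : ℂ))).re * M t)
      (-(deriv φ (-(ρ : ℂ))).re * M ρ + (φ (-(ρ : ℂ))).re * deriv M ρ) ρ :=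
  (hφ.hasDerivAt_apply_neg h0 h1).mul (h.hasDerivAt h0 h1)

theorem continuousOn_mul (h : IsMajorant φ M) (hφ : IsRealConvex φ) :
    ContinuousOn (fun t : ℝ => (φ (-(t : ℂ))).re * M t) (Ico 0 1) :=
  fun _ hρ => (h.hasDerivAt_mul hφ hρ.1 hρ.2).continuousAt.continuousWithinAt

theorem mul_le_one (h : IsMajorant φ M) (hφ : IsRealConvex φ) {ρ : ℝ} (h0 : 0 ≤ ρ) (h1 : ρ < 1) :
    (φ (-(ρ : ℂ))).re * M ρ ≤ 1 := by
  refine sub_nonneg.1 (nonneg_of_deriv_pos_of_neg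
    (g := fun t : ℝ => 1 - (φ (-(t : ℂ))).re * M t) (continuousOn_const.sub (h.continuousOn_mul hφ))
    (by simp [h.map_zero, hφ.map_zero])
    (fun t ht0 ht1 => (h.hasDerivAt_mul hφ ht0.le ht1).const_sub 1)
    (fun t ht0 ht1 hneg => ?_) h0 h1)
  have e := h.eqn t ht0.le ht1
  have hc0 := hφ.re_pos _ (neg_ofReal_mem_ball ht0.le ht1)
  have hΓ := hφ.deriv_neg_pos ht0.le ht1
  have hM := h.one_le hφ ht0.le ht1
  have hM' : deriv M t < 0 := by
    by_contra hn
    push Not at hn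
    nlinarith
  nlinarith [mul_pos hΓ (show 0 < M t by linarith), mul_pos hc0 (neg_pos.2 hM')]

theorem le_mul (h : IsMajorant φ M) (hφ : IsRealConvex φ) {ρ : ℝ} (h0 : 0 ≤ ρ) (h1 : ρ < 1) :
    1 - ρ ≤ (φ (-(ρ : ℂ))).re * M ρ := by
  refine sub_nonneg.1 (nonneg_of_deriv_pos_of_neg
    (g := fun t : ℝ => (φ (-(t : ℂ))).re * M t - (1 - t))
    ((h.continuousOn_mul hφ).sub (continuousOn_const.sub continuousOn_id))
    (by simp [h.map_zero, hφ.map_zero])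
    (fun t ht0 ht1 => (h.hasDerivAt_mul hφ ht0.le ht1).sub ((hasDerivAt_id t).const_sub 1))
    (fun t ht0 ht1 hneg => ?_) h0 h1)
  have e := h.eqn t ht0.le ht1
  have hc0 := hφ.re_pos _ (neg_ofReal_mem_ball ht0.le ht1)
  have hc := hφ.le_apply_neg ht0.le ht1
  have hΓ := hφ.deriv_neg_pos ht0.le ht1
  have hΓ2 := hφ.deriv_neg_le ht0.le ht1
  have hM := h.one_le hφ ht0.le ht1
  set c := (φ (-(t : ℂ))).re
  set Γ := (deriv φ (-(t : ℂ))).re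
  refine pos_of_mul_pos_right (a := t * (1 + t)) ?_ (by positivity)
  have e2 : t * (1 + t) * (-Γ * M t + c * deriv M t - -1)
      = (1 + t) * (-(t * Γ * M t) + c * (1 - c * M t) + t) := by
    linear_combination (1 + t) * c * e
  rw [e2]
  -- `(1 + t) t Γ M ≤ 2 t c M / (1 - t) < 2 t`
  have h4 : (1 + t) * (Γ * M t) < 2 := by
    have h5 : (1 - t) * ((1 + t) * (Γ * M t)) ≤ 2 * (c * M t) := by nlinarith
    have h6 : 2 * (c * M t) < (1 - t) * 2 := by linarith
    exact lt_of_mul_lt_mul_left (h5.trans_lt h6) (by linarith)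
  have h7 : t * ((1 + t) * (Γ * M t)) < t * 2 := mul_lt_mul_of_pos_left h4 ht0
  have h8 : c * t < c * (1 - c * M t) := mul_lt_mul_of_pos_left (by linarith) hc0
  nlinarith

theorem deriv_nonneg (h : IsMajorant φ M) (hφ : IsRealConvex φ) {ρ : ℝ} (h0 : 0 < ρ)
    (h1 : ρ < 1) : 0 ≤ deriv M ρ := by
  have e := h.eqn ρ h0.le h1
  have := h.mul_le_one hφ h0.le h1
  exact nonneg_of_mul_nonneg_right (by rw [e]; linarith) h0

theorem monotoneOn (h : IsMajorant φ M) (hφ : IsRealConvex φ) : MonotoneOn M (Ico 0 1) := by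
  refine monotoneOn_of_deriv_nonneg (convex_Ico 0 1) h.continuousOn ?_ ?_
  · rw [interior_Ico]
    exact fun t ht => (h.differentiableAt t ht.1.le ht.2).differentiableWithinAt
  · rw [interior_Ico]
    exact fun t ht => h.deriv_nonneg hφ ht.1 ht.2

/-- The defect `1 - W`, where `W = φ(-ρ) M(ρ)`, is controlled by the growth of `M`. Where
`2 ρ M ≤ 1 - ρ²`, this makes `W` close to `1` at radii near `√2 - 1`. -/
theorem sq_le (h : IsMajorant φ M) (hφ : IsRealConvex φ) {ρ : ℝ} (h0 : 0 ≤ ρ) (h1 : ρ < 1) :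
    (1 - (φ (-(ρ : ℂ))).re * M ρ) ^ 2 * (1 - ρ ^ 2) ≤ 4 * ρ * (M ρ - 1) := by
  refine sub_nonneg.1 (nonneg_of_deriv_pos_of_neg
    (g := fun t : ℝ => 4 * t * (M t - 1) - (1 - (φ (-(t : ℂ))).re * M t) ^ 2 * (1 - t ^ 2))
    (((continuousOn_const.mul continuousOn_id).mul (h.continuousOn.sub continuousOn_const)).sub
      (((continuousOn_const.sub (h.continuousOn_mul hφ)).pow 2).mul
        (continuousOn_const.sub (continuousOn_id.pow 2))))
    (by simp [h.map_zero, hφ.map_zero])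
    (fun t ht0 ht1 => (((hasDerivAt_id t).const_mul 4).mul
      ((h.hasDerivAt ht0.le ht1).sub_const 1)).sub
      ((((h.hasDerivAt_mul hφ ht0.le ht1).const_sub 1).pow 2).mul
        (((hasDerivAt_id t).pow 2).const_sub 1)))
    (fun t ht0 ht1 hneg => ?_) h0 h1)
  have e := h.eqn t ht0.le ht1
  have hc0 := hφ.re_pos _ (neg_ofReal_mem_ball ht0.le ht1)
  have hΓ := hφ.deriv_neg_pos ht0.le ht1
  have hΓ2 := hφ.deriv_neg_le ht0.le ht1
  have hM := h.one_le hφ ht0.le ht1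
  have hW1 := h.mul_le_one hφ ht0.le ht1
  have hM'0 := h.deriv_nonneg hφ ht0 ht1
  have hneg' : 4 * t * (M t - 1) < (1 - (φ (-(t : ℂ))).re * M t) ^ 2 * (1 - t ^ 2) := by linarith
  simp only [Pi.pow_apply, id_eq, Nat.cast_ofNat, Nat.add_one_sub_one, pow_one, mul_one]
  set c := (φ (-(t : ℂ))).re
  set Γ := (deriv φ (-(t : ℂ))).re
  set x := 1 - c * M t with hx
  have hx0 : 0 ≤ x := by linarith
  have hxpos : 0 < x := by
    rcases hx0.eq_or_lt with h2 | h2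
    · rw [← h2] at hneg'
      have : 0 ≤ 4 * t * (M t - 1) := by
        have : 0 ≤ M t - 1 := by linarith
        positivity
      nlinarith
    · exact h2
  -- `(1 - t²) Γ M ≤ 2 c M ≤ 2`
  have h3 : (1 - t ^ 2) * (Γ * M t) ≤ 2 := by nlinarith
  have h4 : 0 ≤ (1 - t ^ 2) * (c * deriv M t) :=
    mul_nonneg (by nlinarith) (mul_nonneg hc0.le hM'0)
  have h5 : x * ((1 - t ^ 2) * (Γ * M t) - (1 - t ^ 2) * (c * deriv M t)) ≤ x * 2 :=
    mul_le_mul_of_nonneg_left (by linarith) hx0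
  have h6 : 0 < t * x ^ 2 := by positivity
  nlinarith

/-- The function `λ(ρ) = ∫_ρ^r W(t) dt / t`, where `W(t) = φ(-t) M(t) = 1 - t M'(t)`, in closed
form. -/
noncomputable def weight (M : ℝ → ℝ) (r ρ : ℝ) : ℝ := Real.log (r / ρ) - M r + M ρ

theorem hasDerivAt_weight (h : IsMajorant φ M) {r ρ : ℝ} (hr : 0 < r) (h0 : 0 < ρ) (h1 : ρ < 1) :
    HasDerivAt (weight M r) (-((φ (-(ρ : ℂ))).re * M ρ) / ρ) ρ := by
  have h2 : HasDerivAt (fun t => Real.log (r / t)) (-1 / ρ) ρ := by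
    have := ((hasDerivAt_const ρ r).div (hasDerivAt_id ρ) h0.ne').log (div_pos hr h0).ne'
    refine this.congr_deriv ?_
    simp only [Pi.div_apply, id_eq]
    field_simp
    ring
  refine ((h2.sub_const (M r)).add (h.hasDerivAt h0.le h1)).congr_deriv ?_
  have := h.eqn ρ h0.le h1
  field_simp
  linarith

theorem weight_self (M : ℝ → ℝ) {r : ℝ} (hr : 0 < r) : weight M r r = 0 := by
  simp [weight, div_self hr.ne']

theorem weight_le (h : IsMajorant φ M) (hφ : IsRealConvex φ) {r ρ : ℝ} (h0 : 0 < ρ) (hr : ρ ≤ r)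
    (hr1 : r < 1) : weight M r ρ ≤ Real.log (r / ρ) := by
  have := h.monotoneOn hφ (show ρ ∈ Ico (0 : ℝ) 1 from ⟨h0.le, by linarith⟩)
    (show r ∈ Ico (0 : ℝ) 1 from ⟨by linarith, hr1⟩) hr
  rw [weight]
  linarith

theorem weight_nonneg (h : IsMajorant φ M) (hφ : IsRealConvex φ) {r ρ : ℝ} (h0 : 0 < ρ)
    (hr : ρ ≤ r) (hr1 : r < 1) : 0 ≤ weight M r ρ := by
  have hanti : AntitoneOn (weight M r) (Icc ρ r) := by
    have hd : ∀ t ∈ Icc ρ r, HasDerivAt (weight M r) (-((φ (-(t : ℂ))).re * M t) / t) t :=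
      fun t ht => h.hasDerivAt_weight (h0.trans_le hr) (h0.trans_le ht.1) (by linarith [ht.2])
    refine antitoneOn_of_deriv_nonpos (convex_Icc ρ r)
      (fun t ht => (hd t ht).continuousAt.continuousWithinAt)
      (fun t ht => (hd t (interior_subset ht)).differentiableAt.differentiableWithinAt)
      fun t ht => ?_
    have ht' := interior_subset ht
    rw [(hd t ht').deriv]
    have ht0 : 0 < t := h0.trans_le ht'.1
    have h2 := h.le_mul hφ ht0.le (by linarith [ht'.2])
    exact div_nonpos_of_nonpos_of_nonneg (by linarith [ht'.2]) ht0.le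
  have := hanti (left_mem_Icc.2 hr) (right_mem_Icc.2 hr) hr
  rwa [weight_self M (h0.trans_le hr)] at this

end IsMajorant

/-! ### Inequalities at a contact point -/

/-- The inequalities satisfied at a contact point, at a radius at most `ρ`, by
* `W = φ(-|z|) M(|z|)`, `P = a / S = x (1 + i T)` and `K = 1 / (M x)`,
* `p + i δ = (1 + i T) (1 - c / a)`, where `c = φ(-|z|)`,
* `q + i g = φ'(-|z|) (|z| + ω)` and `d = |z| φ'(-|z|)`.

The unit vector in the direction of which the barrier acts is `1 - C + i σ`. -/
structure IsContact (ρ W σ C T K p δ q g d : ℝ) : Prop where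
  unit : σ ^ 2 + C ^ 2 = 2 * C
  K_pos : 0 < K
  p_lt_one : p < 1
  le_W : 1 - ρ ≤ W
  W_le : W ≤ 1
  disc : (1 + ρ) ^ 2 * (p ^ 2 + δ ^ 2) ≤ 4 * ρ * (p + T * δ)
  near : (W * K - (1 - p)) ^ 2 + (T - δ) ^ 2
    ≤ (ρ + ρ ^ 3 / 3) ^ 2 * ((1 - p) ^ 2 + (T - δ) ^ 2)
  slope : ∀ t, 0 ≤ t → (ρ + ρ ^ 3 / 3) ^ 2 ≤ t ^ 2 * (1 - (ρ + ρ ^ 3 / 3) ^ 2) →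
    2 * ρ * t < 1 - ρ ^ 2 → |T| * (1 - ρ ^ 2 - 2 * ρ * t) ≤ 2 * ρ + (1 - ρ ^ 2) * t
  q_nonneg : 0 ≤ q
  d_nonneg : 0 ≤ d
  sq_g_le : g ^ 2 ≤ 2 * d * q
  d_le : d * ((1 - ρ) * (1 + 4 * ρ + ρ ^ 2)) ≤ 2 * ρ * (1 + ρ)
  q_le : q * (1 + T ^ 2) ≤ ((1 + ρ) / (1 - ρ) + d) * (p + T * δ)
  le_q : (1 - ρ) ^ 2 * (p + T * δ) ≤ ((1 + ρ) ^ 2 + 4 * ρ) * (q * (1 + T ^ 2))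

/-- The lower bound of `K` times the radial derivative of the barrier at a contact point, where
`ℓ = λ / (2 M)`, the correction is `m`, and `A` bounds `-|z| m'`. -/
noncomputable def contactForm (ρ ℓ σ C m A T K p δ q g : ℝ) : ℝ :=
  T ^ 2 + p + K * (C - T * σ) + (T - δ) * σ
    - ℓ * (1 + 4 * ρ ^ 2 / (1 - ρ ^ 2) ^ 2) * (p + T * δ)
    + ℓ * ((1 + ρ ^ 2) / (1 - ρ) ^ 2) * σ * (δ - T * p)
    - ℓ * (ρ / (1 - ρ) ^ 2) * σ ^ 2 * (1 + T ^ 2)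
    + m / (1 + ρ) * (1 + T ^ 2) * q
    + K * q * (m * ((1 - ρ) / (1 + ρ) - 2 * ρ / (1 - ρ ^ 2) * (1 + T ^ 2 / 2)) - A)
    + m * K * T * g

/-- A weaker form of `IsRealConvex.normSq_sub_le` that depends on an upper bound `ρ` of the radius
and on `c = φ(-ρ₀)` only: the disc with diameter `[c, c + 4 ρ c / (1 - ρ)²]`. -/
theorem IsRealConvex.disc_le {φ : ℂ → ℂ} (hφ : IsRealConvex φ) {ρ₀ ρ : ℝ} (h0 : 0 < ρ₀)
    (h01 : ρ₀ ≤ ρ) (h1 : ρ < 1) {w : ℂ} (hw : ‖w‖ ≤ ρ₀) :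
    (1 - ρ) ^ 2 * (((φ w).re - (φ (-(ρ₀ : ℂ))).re) ^ 2 + (φ w).im ^ 2)
      ≤ 4 * ρ * (φ (-(ρ₀ : ℂ))).re * ((φ w).re - (φ (-(ρ₀ : ℂ))).re) := by
  have h := hφ.normSq_sub_le h0 (h01.trans_lt h1) hw
  have hΓ := hφ.deriv_neg_pos h0.le (h01.trans_lt h1)
  have hΓ2 := hφ.deriv_neg_le h0.le (h01.trans_lt h1)
  have hc0 := hφ.re_pos _ (neg_ofReal_mem_ball h0.le (h01.trans_lt h1))
  set c := (φ (-(ρ₀ : ℂ))).re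
  set Γ := (deriv φ (-(ρ₀ : ℂ))).re
  set x := (φ w).re - c
  set n := x ^ 2 + (φ w).im ^ 2
  have hn : 0 ≤ n := by positivity
  have hx : 0 ≤ x := by
    have h2 : 0 ≤ 2 * (1 + ρ₀) * (ρ₀ * Γ) * x :=
      (mul_nonneg (by linarith) hn).trans h
    exact nonneg_of_mul_nonneg_right h2 (by positivity)
  have e1 : (1 - ρ) ^ 2 * n ≤ (1 - ρ₀) ^ 2 * n :=
    mul_le_mul_of_nonneg_right (by nlinarith) hn
  have e2 : (1 - ρ₀) ^ 2 * n ≤ (1 - ρ₀) * (2 * (1 + ρ₀) * (ρ₀ * Γ) * x) := by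
    rw [pow_two, mul_assoc]
    exact mul_le_mul_of_nonneg_left h (by linarith)
  have e3 : 2 * ρ₀ * x * ((1 - ρ₀ ^ 2) * Γ) ≤ 2 * ρ₀ * x * (2 * c) :=
    mul_le_mul_of_nonneg_left hΓ2 (by positivity)
  have e4 : 4 * (c * x) * ρ₀ ≤ 4 * (c * x) * ρ := mul_le_mul_of_nonneg_left h01 (by positivity)
  nlinarith

/-- The half-plane form of the disc: with `ζ = 1 - c / a`, `(1 + ρ)² |ζ|² ≤ 4 ρ Re ζ`. -/
theorem normSq_one_sub_div_le {a : ℂ} {c ρ : ℝ} (ha : a ≠ 0)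
    (h : (1 - ρ) ^ 2 * ((a.re - c) ^ 2 + a.im ^ 2) ≤ 4 * ρ * c * (a.re - c)) :
    (1 + ρ) ^ 2 * ((1 - (c : ℂ) / a).re ^ 2 + (1 - (c : ℂ) / a).im ^ 2)
      ≤ 4 * ρ * (1 - (c : ℂ) / a).re := by
  set ζ := 1 - (c : ℂ) / a with hζ
  have hmul : a * ζ = a - c := by rw [hζ]; field_simp
  have hN : 0 < Complex.normSq a := Complex.normSq_pos.2 ha
  have e1 := congrArg Complex.re hmul
  have e2 := congrArg Complex.im hmul
  simp at e1 e2
  rw [Complex.normSq_apply] at hN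
  refine le_of_mul_le_mul_left ?_ hN
  have f1 : (a.re * a.re + a.im * a.im) * (ζ.re ^ 2 + ζ.im ^ 2)
      = (a.re - c) ^ 2 + a.im ^ 2 := by
    linear_combination (a.re * ζ.re - a.im * ζ.im + (a.re - c)) * e1
      + (a.re * ζ.im + a.im * ζ.re + a.im) * e2
  have f2 : (a.re * a.re + a.im * a.im) * ζ.re = (a.re - c) * a.re + a.im ^ 2 := by
    linear_combination a.re * e1 + a.im * e2
  nlinarith

/-- Lower bound of `Re ((1 + i σ) b H / c)` over the `b` in the disc with diameter `[c, c + D c]`; it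
is used for `H = c / a`. The norm `|(1 + i σ) H|` is bounded by the inequality of the means. -/
theorem re_mul_div_ge {b H : ℂ} {c σ D : ℝ} (hc : 0 < c) (hD : 0 < D)
    (h : (b.re - c) ^ 2 + b.im ^ 2 ≤ D * c * (b.re - c)) :
    H.re - σ * H.im + D / 2 * (H.re - σ * H.im - (1 + σ ^ 2 + H.re ^ 2 + H.im ^ 2) / 2)
      ≤ (b * H).re / c - σ * ((b * H).im / c) := by
  obtain ⟨β, hβ⟩ : ∃ β : ℝ, β = (b.re - c) / c := ⟨_, rfl⟩
  obtain ⟨γ, hγ⟩ : ∃ γ : ℝ, γ = b.im / c := ⟨_, rfl⟩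
  have hb1 : b.re = c * (1 + β) := by rw [hβ]; field_simp; ring
  have hb2 : b.im = c * γ := by rw [hγ]; field_simp
  have h2 : β ^ 2 + γ ^ 2 ≤ D * β := by
    rw [hb1, hb2] at h
    have : c ^ 2 * (β ^ 2 + γ ^ 2) ≤ c ^ 2 * (D * β) := by nlinarith
    exact le_of_mul_le_mul_left this (by positivity)
  have e1 : (b * H).re / c = (1 + β) * H.re - γ * H.im := by
    rw [Complex.mul_re, hb1, hb2]; field_simp
  have e2 : (b * H).im / c = (1 + β) * H.im + γ * H.re := by
    rw [Complex.mul_im, hb1, hb2]; field_simp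
  rw [e1, e2]
  set x := H.re
  set y := H.im
  -- `(β, γ) = D / 2 (1 + η)` with `|η| ≤ 1`
  obtain ⟨s, hs⟩ : ∃ s : ℝ, s = 2 * β / D - 1 := ⟨_, rfl⟩
  obtain ⟨t, ht⟩ : ∃ t : ℝ, t = 2 * γ / D := ⟨_, rfl⟩
  have hβ' : β = D / 2 * (1 + s) := by rw [hs]; field_simp; ring
  have hγ' : γ = D / 2 * t := by rw [ht]; field_simp
  have hst : s ^ 2 + t ^ 2 ≤ 1 := by
    rw [hβ', hγ'] at h2
    have : D ^ 2 * (s ^ 2 + t ^ 2) ≤ D ^ 2 * 1 := by nlinarith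
    exact le_of_mul_le_mul_left this (by positivity)
  rw [hβ', hγ']
  have key : 0 ≤ (s - t * σ + x) ^ 2 + (y - (t + s * σ)) ^ 2 := by positivity
  have k2 : (s ^ 2 + t ^ 2) * (1 + σ ^ 2) ≤ 1 * (1 + σ ^ 2) :=
    mul_le_mul_of_nonneg_right hst (by positivity)
  have k3 : 0 ≤ (1 + σ ^ 2 + x ^ 2 + y ^ 2) / 2 + (s * (x - σ * y) - t * (y + σ * x)) := by
    nlinarith
  have k4 := mul_nonneg hD.le k3
  nlinarith

/-- The Schwarz–Pick bounds for `ω`: the half-plane variable `Z = |z| + Re ω` controls the defect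
`z ω' - ω` and the imaginary part. -/
theorem schwarz_pick_bounds {ω : ℂ → ℂ} (hd : DifferentiableOn ℂ ω (ball 0 1))
    (hn : ∀ z ∈ ball (0 : ℂ) 1, ‖ω z‖ ≤ ‖z‖) {z : ℂ} (hz : z ∈ ball (0 : ℂ) 1) (hz0 : z ≠ 0) :
    0 ≤ ‖z‖ + (ω z).re ∧ (ω z).im ^ 2 ≤ 2 * ‖z‖ * (‖z‖ + (ω z).re) ∧
      (1 - ‖z‖ ^ 2) * ‖z * deriv ω z - ω z‖ ≤ 2 * ‖z‖ * (‖z‖ + (ω z).re) := by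
  have h0 : (0 : ℂ) ∈ ball (0 : ℂ) 1 := by simp
  have hω0 : ω 0 = 0 := by simpa using hn 0 h0
  have hz1 : ‖z‖ < 1 := by simpa using hz
  have hzn : 0 < ‖z‖ := norm_pos_iff.2 hz0
  have hnz := hn z hz
  have hre := Complex.abs_re_le_norm (ω z)
  have hre' := (abs_le.1 hre).1
  have hsq : (ω z).re ^ 2 + (ω z).im ^ 2 = ‖ω z‖ ^ 2 := by
    rw [← Complex.normSq_eq_norm_sq, Complex.normSq_apply]; ring
  have hZ : 0 ≤ ‖z‖ + (ω z).re := by linarith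
  refine ⟨hZ, ?_, ?_⟩
  · nlinarith [norm_nonneg (ω z), (abs_le.1 hre).2]
  · have hdd : DifferentiableOn ℂ (dslope ω 0) (ball 0 1) :=
      (Complex.differentiableOn_dslope (isOpen_ball.mem_nhds h0)).2 hd
    have hmul : ∀ x, x * dslope ω 0 x = ω x := by
      intro x
      have := sub_smul_dslope ω 0 x
      rwa [sub_zero, hω0, sub_zero, smul_eq_mul] at this
    have hle : ∀ x ∈ ball (0 : ℂ) 1, ‖dslope ω 0 x‖ ≤ 1 := by
      have hne : ∀ x ∈ ball (0 : ℂ) 1, x ≠ 0 → ‖dslope ω 0 x‖ ≤ 1 := by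
        intro x hx hx0
        have h1 := hn x hx
        rw [← hmul x, norm_mul] at h1
        have h2 : 0 < ‖x‖ := norm_pos_iff.2 hx0
        nlinarith
      intro x hx
      by_cases hx0 : x = 0
      · have hc : ContinuousAt (fun x => ‖dslope ω 0 x‖) 0 :=
          ((hdd.differentiableAt (isOpen_ball.mem_nhds h0)).continuousAt).norm
        rw [hx0]
        refine le_of_tendsto (hc.tendsto.mono_left (nhdsWithin_le_nhds (s := {0}ᶜ))) ?_
        filter_upwards [mem_nhdsWithin_of_mem_nhds (isOpen_ball.mem_nhds h0),
          self_mem_nhdsWithin] with y hy hy0 using hne y hy hy0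
      · exact hne x hx hx0
    have hder : HasDerivAt ω (dslope ω 0 z + z * deriv (dslope ω 0) z) z := by
      have h3 := (hasDerivAt_id z).mul
        (hdd.differentiableAt (isOpen_ball.mem_nhds hz)).hasDerivAt
      have h4 : (id * dslope ω 0 : ℂ → ℂ) = ω := funext hmul
      rw [h4] at h3
      refine h3.congr_deriv ?_
      simp
    have e : z * deriv ω z - ω z = z ^ 2 * deriv (dslope ω 0) z := by
      rw [hder.deriv, ← hmul z]; ring
    have hsp := schwarz_pick_deriv hdd hle hz1
    rw [e, norm_mul, norm_pow]
    have h5 : ‖ω z‖ = ‖z‖ * ‖dslope ω 0 z‖ := by rw [← hmul z, norm_mul]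
    have h6 := mul_le_mul_of_nonneg_left hsp (sq_nonneg ‖z‖)
    have h7 : ‖z‖ ^ 2 * (1 - ‖dslope ω 0 z‖ ^ 2) = (‖z‖ - ‖ω z‖) * (‖z‖ + ‖ω z‖) := by
      rw [h5]; ring
    rw [h7] at h6
    have h8 : (‖z‖ - ‖ω z‖) * (‖z‖ + ‖ω z‖) ≤ (‖z‖ + (ω z).re) * (2 * ‖z‖) :=
      mul_le_mul (by linarith) (by linarith) (by positivity) hZ
    nlinarith

/-! ### The radial derivative of the barrier at a contact point -/

/-- The exact value of `K` times the radial derivative of the barrier, given the contact equations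
`hF` (value) and `hθ` (angular derivative). All quantities are real and imaginary parts:
`P = x (1 + i T)`, `s = P (Hr + i Hi) / c`, `B = b / a`, `y` the rotated quotient, `Ω = z ω'`. -/
theorem contact_identity {c W M x T K σ C lam mu ε Hr Hi Br Bi yr yi sr si Z Ωr Ωi Er Ei Vr Vi : ℝ}
    (hM : M ≠ 0) (hW : W = c * M) (hK : K * M * x = 1)
    (hsr : c * sr = x * (Hr - T * Hi)) (hsi : c * si = x * (Hi + T * Hr))
    (hEr : Er = x * (((1 + Br) / 2 - sr) - T * (Bi / 2 - si)))
    (hEi : Ei = x * ((Bi / 2 - si) + T * ((1 + Br) / 2 - sr)))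
    (hVr : Vr = (1 - C) - x * (yr - T * yi)) (hVi : Vi = σ - x * (yi + T * yr))
    (hF : M - lam - yr + lam * (sr - σ * si) + mu * Z + ε = 0)
    (hθ : Vi - lam * (Ei + σ * Er) - mu * Ωi = 0) (Γ : ℝ) :
    K * (1 - Vr - W * (sr - σ * si) + lam * (Er - σ * Ei) + Γ + mu * Ωr)
      = T ^ 2 + (1 - (Hr - T * Hi)) + K * (C - T * σ) + (Hi + T * Hr) * σ
        + lam / (2 * M) * ((1 + T ^ 2) * (Br - σ * Bi - 1))
        + (1 + T ^ 2) / M * (mu * Z) + K * mu * (Ωr + T * Ωi) + K * Γ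
        + (1 + T ^ 2) / M * ε := by
  have hVr' : Vr = 1 - C + T * σ - T * Vi - x * (1 + T ^ 2) * yr := by
    rw [hVr, hVi]; ring
  have hy : yr = M - lam + lam * (sr - σ * si) + mu * Z + ε := by linarith
  have hVi' : Vi = lam * (Ei + σ * Er) + mu * Ωi := by linarith
  have e1 : K * W * sr = Hr - T * Hi := by
    rw [hW]
    linear_combination K * M * hsr + (Hr - T * Hi) * hK
  have e2 : K * W * si = Hi + T * Hr := by
    rw [hW]
    linear_combination K * M * hsi + (Hi + T * Hr) * hK
  have e3 : Er - σ * Ei + T * (Ei + σ * Er)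
      = x * (1 + T ^ 2) * (((1 + Br) / 2 - sr) - σ * (Bi / 2 - si)) := by
    rw [hEr, hEi]; ring
  have hKx : K * x = 1 / M := by
    field_simp
    linarith
  have e4 : K * x * M = 1 := by linarith
  have e5 : lam / (2 * M) * ((1 + T ^ 2) * (Br - σ * Bi - 1))
      = K * x * lam * (1 + T ^ 2) * (Br - σ * Bi - 1) / 2 := by
    rw [hKx]; field_simp
  have e6 : (1 + T ^ 2) / M * (mu * Z) = K * x * (1 + T ^ 2) * (mu * Z) := by
    rw [hKx]; field_simp
  have e7 : (1 + T ^ 2) / M * ε = K * x * (1 + T ^ 2) * ε := by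
    rw [hKx]; field_simp
  rw [e5, e6, e7, hVr', hy]
  rw [hVi']
  linear_combination -e1 + σ * e2 + K * lam * e3 + (1 + T ^ 2) * e4

/-- The bounds of `s = 1 / S` that follow from `|S - 1| ≤ u`; the last one says that the tangent of
its argument is at most `u / √(1 - u²)`. -/
theorem inv_bounds {S s : ℂ} {u : ℝ} (hu : u < 1) (hS : ‖S - 1‖ ≤ u) (hs : s = S⁻¹) :
    (1 - s.re) ^ 2 + s.im ^ 2 ≤ u ^ 2 * (s.re ^ 2 + s.im ^ 2) ∧ 0 < s.re ∧
      (1 - u ^ 2) * s.im ^ 2 ≤ u ^ 2 * s.re ^ 2 := by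
  have hu0 : 0 ≤ u := (norm_nonneg _).trans hS
  have hu2 : 0 < 1 - u ^ 2 := by nlinarith
  have hS0 : S ≠ 0 := by
    rintro rfl
    rw [zero_sub, norm_neg, norm_one] at hS
    linarith
  have hs1 : ‖1 - s‖ ≤ u * ‖s‖ := by
    have : 1 - s = s * (S - 1) := by
      rw [hs]; field_simp
    rw [this, norm_mul, mul_comm]
    gcongr
  have h2 : ‖1 - s‖ ^ 2 ≤ (u * ‖s‖) ^ 2 := by gcongr
  rw [mul_pow, ← Complex.normSq_eq_norm_sq, ← Complex.normSq_eq_norm_sq, Complex.normSq_apply,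
    Complex.normSq_apply] at h2
  simp only [Complex.sub_re, Complex.one_re, Complex.sub_im, Complex.one_im, zero_sub] at h2
  have h3 : (1 - s.re) ^ 2 + s.im ^ 2 ≤ u ^ 2 * (s.re ^ 2 + s.im ^ 2) := by linarith
  have h4 : 0 ≤ (1 - u ^ 2) * (s.re ^ 2 + s.im ^ 2) := by positivity
  exact ⟨h3, by linarith, by linarith [sq_nonneg (s.re - 1)]⟩

theorem abs_im_le_of_norm_sub_one_le {a : ℂ} {ρ : ℝ} (h0 : 0 ≤ ρ) (h1 : ρ < 1)
    (h : ‖a - 1‖ ≤ ρ * ‖a + 1‖) (ha : 0 < a.re) : (1 - ρ ^ 2) * |a.im| ≤ 2 * ρ * a.re := by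
  have h2 := normSq_le_of_norm_sub_one_le h
  have h3 : 0 < 1 - ρ ^ 2 := by nlinarith
  have h4 : ((1 - ρ ^ 2) * |a.im|) ^ 2 ≤ (2 * ρ * a.re) ^ 2 := by
    rw [mul_pow, sq_abs]
    have h5 := mul_le_mul_of_nonneg_left h2 h3.le
    nlinarith [sq_nonneg ((1 + ρ ^ 2) * a.re - (1 - ρ ^ 2))]
  exact le_of_sq_le_sq h4 (by positivity)

/-- The tangent addition bounds for the argument of the product `a s`. -/
theorem arg_mul_bounds {ar ai sr si ρ u t : ℝ} (h0 : 0 ≤ ρ) (h1 : ρ < 1) (hu2 : 0 < 1 - u ^ 2)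
    (har : 0 < ar) (hsr : 0 < sr) (ha : (1 - ρ ^ 2) * |ai| ≤ 2 * ρ * ar)
    (hs : (1 - u ^ 2) * si ^ 2 ≤ u ^ 2 * sr ^ 2) (ht0 : 0 ≤ t) (ht : u ^ 2 ≤ t ^ 2 * (1 - u ^ 2)) :
    (1 - ρ ^ 2) * |ar * si + ai * sr| ≤ (2 * ρ + (1 - ρ ^ 2) * t) * (ar * sr) ∧
      (1 - ρ ^ 2 - 2 * ρ * t) * (ar * sr) ≤ (1 - ρ ^ 2) * (ar * sr - ai * si) := by
  have h3 : 0 < 1 - ρ ^ 2 := by nlinarith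
  have h4 : |si| ≤ t * sr := by
    have : si ^ 2 ≤ (t * sr) ^ 2 := by
      have h5 : (1 - u ^ 2) * si ^ 2 ≤ (1 - u ^ 2) * (t * sr) ^ 2 := by
        nlinarith [mul_le_mul_of_nonneg_right ht (sq_nonneg sr)]
      exact le_of_mul_le_mul_left h5 hu2
    exact abs_le_of_sq_le_sq this (by positivity)
  have h5 : |ar * si + ai * sr| ≤ ar * |si| + |ai| * sr := by
    refine (abs_add_le _ _).trans_eq ?_
    rw [abs_mul, abs_mul, abs_of_pos har, abs_of_pos hsr]
  have h6 : ai * si ≤ |ai| * |si| := by rw [← abs_mul]; exact le_abs_self _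
  have h7 : ar * |si| ≤ ar * (t * sr) := by gcongr
  have h8 : ((1 - ρ ^ 2) * |ai|) * sr ≤ (2 * ρ * ar) * sr := by gcongr
  have h9 : ((1 - ρ ^ 2) * |ai|) * |si| ≤ (2 * ρ * ar) * (t * sr) := by gcongr
  have h10 := mul_le_mul_of_nonneg_left h5 h3.le
  have h11 := mul_le_mul_of_nonneg_left h6 h3.le
  have h12 := mul_le_mul_of_nonneg_left h7 h3.le
  constructor <;> linarith

/-- The part of the barrier inequality carried by the weight. -/
theorem weight_part_ge {b H B ζ : ℂ} {c σ T ρ : ℝ} (hc : 0 < c) (h0 : 0 < ρ) (h1 : ρ < 1)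
    (hB : (b * H).re / c = B.re ∧ (b * H).im / c = B.im) (hζ : ζ = 1 - H)
    (hb : (1 - ρ) ^ 2 * ((b.re - c) ^ 2 + b.im ^ 2) ≤ 4 * ρ * c * (b.re - c))
    (hd : (1 + ρ) ^ 2 * (ζ.re ^ 2 + ζ.im ^ 2) ≤ 4 * ρ * ζ.re) :
    -((1 + 4 * ρ ^ 2 / (1 - ρ ^ 2) ^ 2) * ((1 + T ^ 2) * ζ.re))
      + (1 + ρ ^ 2) / (1 - ρ) ^ 2 * σ * ((1 + T ^ 2) * ζ.im) - ρ / (1 - ρ) ^ 2 * σ ^ 2 * (1 + T ^ 2)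
      ≤ (1 + T ^ 2) * (B.re - σ * B.im - 1) := by
  have h2 : 0 < 1 - ρ := by linarith
  obtain ⟨e, he⟩ : ∃ e : ℝ, e = ρ / (1 - ρ) ^ 2 := ⟨_, rfl⟩
  have he' : e * (1 - ρ) ^ 2 = ρ := by rw [he]; field_simp
  have he0 : 0 < e := by rw [he]; positivity
  have hD := re_mul_div_ge (b := b) (H := H) (c := c) (σ := σ) (D := 4 * e) hc (by positivity) (by
    have h3 : 0 < (1 - ρ) ^ 2 := by positivity
    refine le_of_mul_le_mul_left (hb.trans_eq ?_) h3
    linear_combination (-4 * c * (b.re - c)) * he')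
  rw [hB.1, hB.2] at hD
  have hr : H.re = 1 - ζ.re := by rw [hζ]; simp
  have hi : H.im = -ζ.im := by rw [hζ]; simp
  rw [hr, hi] at hD
  have e1 : (1 + ρ ^ 2) / (1 - ρ) ^ 2 = 1 + 2 * e := by
    rw [he]; field_simp; ring
  have e2 : 4 * ρ ^ 2 / (1 - ρ ^ 2) ^ 2 * ζ.re = e * (4 * ρ * ζ.re / (1 + ρ) ^ 2) := by
    rw [he, show 1 - ρ ^ 2 = (1 - ρ) * (1 + ρ) by ring]
    field_simp
  have e3 : ζ.re ^ 2 + ζ.im ^ 2 ≤ 4 * ρ * ζ.re / (1 + ρ) ^ 2 := by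
    rw [le_div_iff₀ (by positivity)]
    linarith
  have e4 := mul_le_mul_of_nonneg_left e3 he0.le
  rw [e1, ← he]
  have key : -((1 + 4 * ρ ^ 2 / (1 - ρ ^ 2) ^ 2) * ζ.re) + (1 + 2 * e) * σ * ζ.im - e * σ ^ 2
      ≤ B.re - σ * B.im - 1 := by
    rw [add_mul, e2]
    linarith
  have := mul_le_mul_of_nonneg_left key (show 0 ≤ 1 + T ^ 2 by positivity)
  linarith

/-- The part of the barrier inequality carried by the correction `m φ'(-|z|) (|z| + Re ω)`. -/
theorem correction_part_ge {Ω ω : ℂ} {ρ₀ ρ Γ Γ' m m' A T : ℝ} (h0 : 0 < ρ₀) (h01 : ρ₀ ≤ ρ)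
    (h1 : ρ < 1) (hΓ : 0 < Γ) (hm : 0 ≤ m) (hZ : 0 ≤ ρ₀ + ω.re)
    (hΩ : (1 - ρ₀ ^ 2) * ‖Ω - ω‖ ≤ 2 * ρ₀ * (ρ₀ + ω.re)) (hA : -A ≤ ρ₀ * m')
    (hΓ' : -(2 * ρ₀) * Γ ≤ (1 + ρ₀) * (ρ₀ * Γ')) :
    Γ * (ρ₀ + ω.re) * (m * ((1 - ρ) / (1 + ρ) - 2 * ρ / (1 - ρ ^ 2) * (1 + T ^ 2 / 2)) - A)
        + m * T * (Γ * ω.im)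
      ≤ m * Γ * (Ω.re + T * Ω.im)
        + ((ρ₀ * m' * Γ + m * (ρ₀ * Γ')) * (ρ₀ + ω.re) + m * Γ * ρ₀) := by
  set Z := ρ₀ + ω.re with hZd
  have hρ0 : 0 < ρ := h0.trans_le h01
  have h2 : 0 < 1 - ρ ^ 2 := by nlinarith
  have h3 : ‖Ω - ω‖ ≤ 2 * ρ / (1 - ρ ^ 2) * Z := by
    have h4 : (1 - ρ ^ 2) * ‖Ω - ω‖ ≤ (1 - ρ₀ ^ 2) * ‖Ω - ω‖ :=
      mul_le_mul_of_nonneg_right (by nlinarith) (norm_nonneg _)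
    have h5 : 2 * ρ₀ * Z ≤ 2 * ρ * Z := by gcongr
    rw [div_mul_eq_mul_div, le_div_iff₀ h2]
    linarith
  have h4 : -((1 + T ^ 2 / 2) * ‖Ω - ω‖) ≤ (Ω.re - ω.re) + T * (Ω.im - ω.im) := by
    have h5 : ((Ω.re - ω.re) + T * (Ω.im - ω.im)) ^ 2 ≤ ((1 + T ^ 2 / 2) * ‖Ω - ω‖) ^ 2 := by
      rw [mul_pow, ← Complex.normSq_eq_norm_sq, Complex.normSq_apply, Complex.sub_re,
        Complex.sub_im]
      nlinarith [sq_nonneg (T * (Ω.re - ω.re) - (Ω.im - ω.im)),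
        mul_nonneg (sq_nonneg (T ^ 2)) (add_nonneg (sq_nonneg (Ω.re - ω.re))
          (sq_nonneg (Ω.im - ω.im)))]
    exact (abs_le.1 (abs_le_of_sq_le_sq h5 (by positivity))).1
  have h5 : (1 + T ^ 2 / 2) * ‖Ω - ω‖ ≤ (1 + T ^ 2 / 2) * (2 * ρ / (1 - ρ ^ 2) * Z) := by gcongr
  have h6 : m * Γ * (-((1 + T ^ 2 / 2) * (2 * ρ / (1 - ρ ^ 2) * Z)))
      ≤ m * Γ * ((Ω.re - ω.re) + T * (Ω.im - ω.im)) :=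
    mul_le_mul_of_nonneg_left (by linarith) (by positivity)
  have h7 : -A * (Γ * Z) ≤ ρ₀ * m' * (Γ * Z) := mul_le_mul_of_nonneg_right hA (by positivity)
  have h8 : -(2 * ρ / (1 + ρ)) * Γ ≤ ρ₀ * Γ' := by
    rw [neg_mul, div_mul_eq_mul_div, ← neg_div, div_le_iff₀ (by positivity)]
    have h9 : (1 + ρ₀) * (-(2 * ρ * Γ)) ≤ (1 + ρ₀) * (ρ₀ * Γ' * (1 + ρ)) := by
      have h10 := mul_le_mul_of_nonneg_right hΓ' (show 0 ≤ 1 + ρ by linarith)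
      nlinarith
    exact le_of_mul_le_mul_left h9 (by linarith)
  have h9 : m * Z * (-(2 * ρ / (1 + ρ)) * Γ) ≤ m * Z * (ρ₀ * Γ') :=
    mul_le_mul_of_nonneg_left h8 (by positivity)
  have h10 : (1 - ρ) / (1 + ρ) = 1 - 2 * ρ / (1 + ρ) := by field_simp; ring
  rw [h10]
  rw [show ω.re = Z - ρ₀ by rw [hZd]; ring] at h6
  linarith

/-- The two-sided comparison of `q = φ'(-|z|) (|z| + Re ω)` with `Re ζ`, and the bound of
`d = |z| φ'(-|z|)`, in terms of an upper bound `ρ` of `|z|`. -/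
theorem comparison_bounds {ρ₀ ρ Γ c k q ζ : ℝ} (h0 : 0 < ρ₀) (h01 : ρ₀ ≤ ρ) (h1 : ρ < 1)
    (hΓ : 0 < Γ) (hc : 0 < c) (hk : k * (1 - ρ₀) = 1 + ρ₀) (hq : 0 ≤ q) (hζ : 0 ≤ ζ)
    (hcl : 1 - ρ₀ ≤ (1 + ρ₀) * c) (h2 : (1 - ρ₀ ^ 2) * Γ ≤ 2 * c)
    (h3 : (1 - ρ₀) * (ρ₀ * Γ) ≤ (1 + ρ₀) * (1 - c))
    (hlo : q ≤ (2 * (ρ₀ * Γ) + c * k) * ζ) (hhi : c ^ 2 * ζ ≤ (2 * (ρ₀ * Γ) + c * k) * q) :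
    (ρ₀ * Γ) * ((1 - ρ) * (1 + 4 * ρ + ρ ^ 2)) ≤ 2 * ρ * (1 + ρ) ∧
      q ≤ ((1 + ρ) / (1 - ρ) + ρ₀ * Γ) * ζ ∧ (1 - ρ) ^ 2 * ζ ≤ ((1 + ρ) ^ 2 + 4 * ρ) * q := by
  obtain ⟨d, hd⟩ : ∃ d : ℝ, d = ρ₀ * Γ := ⟨_, rfl⟩
  rw [← hd] at h3 hlo hhi ⊢
  have hd0 : 0 < d := by rw [hd]; positivity
  have hρ0 : 0 < ρ := h0.trans_le h01
  have hρ1 : 0 < 1 - ρ := by linarith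
  have hk0 : 0 < k := by
    by_contra hn
    push Not at hn
    nlinarith
  have hk1 : k ≤ (1 + ρ) / (1 - ρ) := by
    rw [le_div_iff₀ hρ1]
    nlinarith
  have d1 : (1 - ρ ^ 2) * d ≤ 2 * ρ * c := by
    have e1 : (1 - ρ ^ 2) * d ≤ (1 - ρ₀ ^ 2) * d := mul_le_mul_of_nonneg_right (by nlinarith) hd0.le
    have e2 : (1 - ρ₀ ^ 2) * d ≤ 2 * ρ₀ * c := by
      rw [hd]
      nlinarith
    have e3 : ρ₀ * c ≤ ρ * c := by gcongr
    linarith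
  have hc1 : c ≤ 1 := by
    have : 0 ≤ (1 - ρ₀) * d := mul_nonneg (by linarith) hd0.le
    nlinarith
  have d2 : (1 - ρ) * d ≤ (1 + ρ) * (1 - c) := by nlinarith
  refine ⟨?_, ?_, ?_⟩
  · -- eliminate `c` between the two upper bounds of `d`
    have e1 := mul_le_mul_of_nonneg_left d1 (show 0 ≤ 1 + ρ by linarith)
    have e2 := mul_le_mul_of_nonneg_left d2 (show 0 ≤ 2 * ρ by linarith)
    linarith
  · have e1 : 2 * d + c * k ≤ (1 + ρ) / (1 - ρ) + d := by
      have e2 : (1 - ρ₀) * d ≤ (1 - ρ₀) * (k * (1 - c)) := by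
        rw [show (1 - ρ₀) * (k * (1 - c)) = (1 + ρ₀) * (1 - c) by rw [← hk]; ring]
        exact h3
      have e3 := le_of_mul_le_mul_left e2 (by linarith)
      linarith
    exact hlo.trans (mul_le_mul_of_nonneg_right e1 hζ)
  · have e1 : (1 - ρ) ^ 2 * (1 + ρ) * (2 * d + c * k)
        ≤ (1 - ρ) * (((1 + ρ) ^ 2 + 4 * ρ) * c) := by
      have e2 : (1 - ρ) * (c * k) ≤ c * (1 + ρ) := by
        rw [le_div_iff₀ hρ1] at hk1
        nlinarith
      have e3 := mul_le_mul_of_nonneg_left d1 (show 0 ≤ 2 * (1 - ρ) by linarith)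
      have e4 := mul_le_mul_of_nonneg_left e2 (show 0 ≤ (1 - ρ) * (1 + ρ) by positivity)
      linarith
    have e5 : (1 - ρ) * c * ((1 + ρ) * c * ζ) ≤ (1 - ρ) * c * ((((1 + ρ) ^ 2 + 4 * ρ)
        / (1 - ρ)) * q) := by
      have e6 := mul_le_mul_of_nonneg_left hhi (show 0 ≤ (1 - ρ) ^ 2 * (1 + ρ) by positivity)
      have e7 := mul_le_mul_of_nonneg_right e1 hq
      have e8 : (1 - ρ) * c * ((((1 + ρ) ^ 2 + 4 * ρ) / (1 - ρ)) * q)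
          = c * (((1 + ρ) ^ 2 + 4 * ρ) * q) := by field_simp
      rw [e8]
      have e9 : (1 - ρ) * ((1 - ρ) * c * ((1 + ρ) * c * ζ))
          ≤ (1 - ρ) * (c * (((1 + ρ) ^ 2 + 4 * ρ) * q)) := by linarith
      exact le_of_mul_le_mul_left e9 hρ1
    have e6 := le_of_mul_le_mul_left e5 (by positivity)
    have hcl' : 1 - ρ ≤ (1 + ρ) * c := by nlinarith
    have e7 := mul_le_mul_of_nonneg_right hcl' hζ
    rw [div_mul_eq_mul_div, le_div_iff₀ hρ1] at e6
    nlinarith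

set_option maxHeartbeats 600000 in
/-- At a contact point of the barrier the numerical data satisfy `IsContact`, and `K` times the
radial derivative of the barrier exceeds `contactForm`. Here `y`, `s`, `E` and `V` are the values of
`e v / S`, `1 / S`, `z (1 / S)'` and `z (e v / S)'`; the hypotheses `hF` and `hθ` say that the barrier
and its angular derivative vanish. -/
theorem ConjSystem.exists_contact {φ ω₁ ω₂ S v : ℂ → ℂ} {M : ℝ → ℝ} (hφ : IsRealConvex φ)
    (h : ConjSystem φ ω₁ ω₂ S v) (hM : IsMajorant φ M) {z : ℂ} {ρ₀ ρ : ℝ} (hz : ‖z‖ = ρ₀)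
    (h0 : 0 < ρ₀) (h01 : ρ₀ ≤ ρ) (h1 : ρ ≤ 0.41422) {y s E V : ℂ} {lam m m' A ε C σ Γ' : ℝ}
    (hs : s = (S z)⁻¹) (hE : E = s * ((φ (ω₁ z) + φ (ω₂ z)) / 2 - φ (ω₁ z) * s))
    (hV : V = (1 - C : ℝ) + σ * Complex.I - φ (ω₁ z) * s * y)
    (hunit : σ ^ 2 + C ^ 2 = 2 * C) (hlam : 0 ≤ lam) (hm : 0 ≤ m) (hε : 0 < ε)
    (hA : -A ≤ ρ₀ * m')
    (hΓ' : -(2 * ρ₀) * (deriv φ (-(ρ₀ : ℂ))).re ≤ (1 + ρ₀) * (ρ₀ * Γ'))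
    (hF : M ρ₀ - lam - y.re + lam * ((1 + σ * Complex.I) * s).re
      + m * (deriv φ (-(ρ₀ : ℂ))).re * (ρ₀ + (ω₁ z).re) + ε = 0)
    (hθ : V.im - lam * ((1 + σ * Complex.I) * E).im
      - m * (deriv φ (-(ρ₀ : ℂ))).re * (z * deriv ω₁ z).im = 0) :
    ∃ T K p δ q g d, IsContact ρ ((φ (-(ρ₀ : ℂ))).re * M ρ₀) σ C T K p δ q g d ∧
      contactForm ρ (lam / (2 * M ρ₀)) σ C m A T K p δ q g <
        K * (1 - V.re - (φ (-(ρ₀ : ℂ))).re * M ρ₀ * ((1 + σ * Complex.I) * s).re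
          + lam * ((1 + σ * Complex.I) * E).re
          + ((ρ₀ * m' * (deriv φ (-(ρ₀ : ℂ))).re + m * (ρ₀ * Γ')) * (ρ₀ + (ω₁ z).re)
            + m * (deriv φ (-(ρ₀ : ℂ))).re * ρ₀)
          + m * (deriv φ (-(ρ₀ : ℂ))).re * (z * deriv ω₁ z).re) := by
  have hρ0 : 0 < ρ := h0.trans_le h01
  have hρ1 : ρ < 1 := by linarith
  have h11 : ρ₀ < 1 := by linarith
  have hzb : z ∈ ball (0 : ℂ) 1 := by simpa [hz] using h11
  have hz0 : z ≠ 0 := by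
    rintro rfl
    rw [norm_zero] at hz
    linarith
  have hw₁ : ‖ω₁ z‖ ≤ ρ₀ := (h.norm₁ z hzb).trans_eq hz
  have hw₂ : ‖ω₂ z‖ ≤ ρ₀ := (h.norm₂ z hzb).trans_eq hz
  have ha0 : φ (ω₁ z) ≠ 0 := hφ.ne_zero (mem_ball_of_norm_le hzb (h.norm₁ z hzb))
  have hare := hφ.re_pos _ (mem_ball_of_norm_le hzb (h.norm₁ z hzb))
  have hda := hφ.disc_le h0 h01 hρ1 hw₁
  have hdb := hφ.disc_le h0 h01 hρ1 hw₂
  have hac := hφ.norm_sub_one_le hρ1 (hw₁.trans h01)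
  have hSu : ‖S z - 1‖ ≤ ρ + ρ ^ 3 / 3 := by
    refine (h.norm_S_sub_one_le hφ (by rw [hz]; linarith)).trans ?_
    rw [hz]
    gcongr
  have hc0 := hφ.re_pos _ (neg_ofReal_mem_ball h0.le h11)
  have hcle := hφ.le_apply_neg h0.le h11
  have hΓ0 := hφ.deriv_neg_pos h0.le h11
  have hΓ2 := hφ.deriv_neg_le h0.le h11
  have hΓ3 := hφ.mul_deriv_neg_le h0.le h11
  have hM1 := hM.one_le hφ h0.le h11
  have hM2 := hM.le_one_add hφ h0.le h11
  have hW1 := hM.mul_le_one hφ h0.le h11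
  have hW2 := hM.le_mul hφ h0.le h11
  obtain ⟨k₀, hk₀⟩ : ∃ k : ℝ, k * (1 - ρ₀) = 1 + ρ₀ :=
    ⟨(1 + ρ₀) / (1 - ρ₀), div_mul_cancel₀ _ (by linarith)⟩
  have hlo := hφ.le_re_one_sub_div h0 h11 hw₁ hk₀
  have hhi := hφ.re_one_sub_div_le h0 h11 hw₁ hk₀
  have hζ := normSq_one_sub_div_le ha0 hda
  obtain ⟨hZ0, hωi, hωd⟩ := schwarz_pick_bounds h.diff₁ h.norm₁ hzb hz0
  rw [hz] at hZ0 hωi hωd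
  set a := φ (ω₁ z) with ha
  set b := φ (ω₂ z) with hb
  set c := (φ (-(ρ₀ : ℂ))).re with hc
  set Γ := (deriv φ (-(ρ₀ : ℂ))).re with hΓ
  set ζ := 1 - (c : ℂ) / a with hζd
  set Z := ρ₀ + (ω₁ z).re with hZ
  set u := ρ + ρ ^ 3 / 3 with hu
  have hu0 : 0 < u := by positivity
  have hu1 : u ≤ 0.438 := by
    have : ρ ^ 3 ≤ 0.41422 ^ 3 := by gcongr
    rw [hu]; linarith
  obtain ⟨hs2, hsre, hsim⟩ := inv_bounds (by linarith) hSu hs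
  have hu2 : 0 < 1 - u ^ 2 := by nlinarith only [hu0, hu1]
  have haim := abs_im_le_of_norm_sub_one_le hρ0.le hρ1 hac hare
  have hslope := fun t => arg_mul_bounds (t := t) hρ0.le hρ1 hu2 hare hsre haim hsim
  have h3 : 0 < 1 - ρ ^ 2 := by nlinarith only [hρ0, hρ1]
  -- `P = a / S = x (1 + i T)`, where `x > 0` because the arguments of `a` and `s` are small
  obtain ⟨x, hx⟩ : ∃ x : ℝ, x = a.re * s.re - a.im * s.im := ⟨_, rfl⟩
  have hx0 : 0 < x := by
    have h4 := (hslope (1 / 2) (by norm_num) (by nlinarith only [hu0, hu1])).2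
    rw [← hx] at h4
    have h5 : 0 < 1 - ρ ^ 2 - 2 * ρ * (1 / 2) := by nlinarith only [hρ0, h1]
    have h6 : 0 < (1 - ρ ^ 2 - 2 * ρ * (1 / 2)) * (a.re * s.re) := by positivity
    exact pos_of_mul_pos_right (h6.trans_le h4) h3.le
  obtain ⟨T, hT⟩ : ∃ T : ℝ, T = (a.re * s.im + a.im * s.re) / x := ⟨_, rfl⟩
  have hTx : x * T = a.re * s.im + a.im * s.re := by rw [hT]; field_simp
  obtain ⟨H, hH⟩ : ∃ H : ℂ, H = c / a := ⟨_, rfl⟩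
  have haH : a * H = c := by rw [hH]; field_simp
  have hζH : ζ = 1 - H := by rw [hζd, hH]
  have hζr : ζ.re = 1 - H.re := by rw [hζH]; simp
  have hζi : ζ.im = -H.im := by rw [hζH]; simp
  -- `s = P / a`
  have hsH : (c : ℂ) * s = (x * (1 + T * Complex.I)) * H := by
    have : (x * (1 + T * Complex.I) : ℂ) = a * s := by
      apply Complex.ext
      · simp [hx]
      · simp [hTx]
    rw [this]
    linear_combination -s * haH
  have hsr := congrArg Complex.re hsH
  have hsi := congrArg Complex.im hsH
  simp at hsr hsi
  have hPs : a * s = x * (1 + T * Complex.I) := by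
    apply Complex.ext
    · simp [hx]
    · simp [hTx]
  obtain ⟨B, hB⟩ : ∃ B : ℂ, B = b / a := ⟨_, rfl⟩
  have hEB : E = x * (1 + T * Complex.I) * ((1 + B) / 2 - s) := by
    rw [hE, ← hPs, hB]
    field_simp
  have hEr := congrArg Complex.re hEB
  have hEi := congrArg Complex.im hEB
  have hVr := congrArg Complex.re hV
  have hVi := congrArg Complex.im hV
  rw [hPs] at hVr hVi
  simp at hEr hEi hVr hVi
  have hN : 0 < 1 + T ^ 2 := by positivity
  obtain ⟨K, hK⟩ : ∃ K : ℝ, K = 1 / (M ρ₀ * x) := ⟨_, rfl⟩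
  have hM0 : 0 < M ρ₀ := by linarith
  have hK0 : 0 < K := by rw [hK]; positivity
  have hKMx : K * M ρ₀ * x = 1 := by rw [hK]; field_simp
  obtain ⟨p, hp⟩ : ∃ p : ℝ, p = 1 - (H.re - T * H.im) := ⟨_, rfl⟩
  obtain ⟨δ, hδ⟩ : ∃ δ : ℝ, δ = T - (H.im + T * H.re) := ⟨_, rfl⟩
  have hQ : p + T * δ = (1 + T ^ 2) * ζ.re := by rw [hp, hδ, hζr]; ring
  have hQ' : δ - T * p = (1 + T ^ 2) * ζ.im := by rw [hp, hδ, hζi]; ring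
  have hn : p ^ 2 + δ ^ 2 = (1 + T ^ 2) * (ζ.re ^ 2 + ζ.im ^ 2) := by
    rw [hp, hδ, hζr, hζi]; ring
  -- `W K s = (1 + i T) c / a`
  have w1 : c * M ρ₀ * K * s.re = 1 - p := by
    rw [hp]
    linear_combination K * M ρ₀ * hsr + (H.re - T * H.im) * hKMx
  have w2 : c * M ρ₀ * K * s.im = T - δ := by
    rw [hδ]
    linear_combination K * M ρ₀ * hsi + (H.im + T * H.re) * hKMx
  have hW0 : 0 < c * M ρ₀ := by positivity
  have hζ0 : 0 ≤ ζ.re := by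
    have h4 : 0 ≤ 4 * ρ * ζ.re := le_trans (by positivity) hζ
    exact nonneg_of_mul_nonneg_right h4 (by positivity)
  have hq0 : 0 ≤ Γ * Z := by positivity
  obtain ⟨cd, clo, chi⟩ := comparison_bounds h0 h01 hρ1 hΓ0 hc0 hk₀ hq0 hζ0 hcle hΓ2 hΓ3 hlo hhi
  refine ⟨T, K, p, δ, Γ * Z, Γ * (ω₁ z).im, ρ₀ * Γ, ?_, ?_⟩
  · refine ⟨hunit, hK0, ?_, by linarith, hW1, ?_, ?_, ?_, hq0, by positivity, ?_, cd, ?_, ?_⟩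
    · have : 0 < c * M ρ₀ * K * s.re := by positivity
      linarith
    · rw [hQ, hn]
      have := mul_le_mul_of_nonneg_left hζ hN.le
      linarith
    · rw [← w1, ← w2, ← hu]
      have := mul_le_mul_of_nonneg_left hs2 (sq_nonneg (c * M ρ₀ * K))
      linarith
    · intro t ht0 ht ht1
      obtain ⟨b1, b2⟩ := hslope t ht0 ht
      rw [← hTx, abs_mul, abs_of_pos hx0] at b1
      rw [← hx] at b2
      have h4 : 0 < a.re * s.re := by positivity
      have h5 : |T| * ((1 - ρ ^ 2 - 2 * ρ * t) * (a.re * s.re)) ≤ |T| * ((1 - ρ ^ 2) * x) := by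
        gcongr
      refine le_of_mul_le_mul_right (a := a.re * s.re) ?_ h4
      linarith
    · have := mul_le_mul_of_nonneg_left hωi (sq_nonneg Γ)
      linarith
    · rw [hQ]
      have := mul_le_mul_of_nonneg_left clo hN.le
      linarith
    · rw [hQ]
      have := mul_le_mul_of_nonneg_left chi hN.le
      linarith
  · have hbH : b * H = c * B := by rw [hH, hB]; field_simp
    have hBc : (b * H).re / c = B.re ∧ (b * H).im / c = B.im := by
      rw [hbH, Complex.re_ofReal_mul, Complex.im_ofReal_mul]
      constructor <;> field_simp
    have hw := weight_part_ge (T := T) (σ := σ) hc0 hρ0 hρ1 hBc hζH hdb hζ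
    have hcor := correction_part_ge (T := T) h0 h01 hρ1 hΓ0 hm hZ0 (by rw [hZ] at hωd; exact hωd)
      hA hΓ'
    simp only [Complex.mul_re, Complex.mul_im, Complex.add_re, Complex.add_im, Complex.one_re,
      Complex.one_im, Complex.ofReal_re, Complex.ofReal_im, Complex.I_re, Complex.I_im, mul_zero,
      mul_one, sub_zero, add_zero, zero_add, one_mul] at hF hθ ⊢
    have hid := contact_identity (c := c) (W := c * M ρ₀) (M := M ρ₀) (x := x) (T := T) (K := K)
      (σ := σ) (C := C) (lam := lam) (mu := m * Γ) (ε := ε) (Hr := H.re) (Hi := H.im)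
      (Br := B.re) (Bi := B.im) (yr := y.re) (yi := y.im) (sr := s.re) (si := s.im) (Z := Z)
      (Ωr := (z * deriv ω₁ z).re) (Ωi := (z * deriv ω₁ z).im) (Er := E.re) (Ei := E.im)
      (Vr := V.re) (Vi := V.im) hM0.ne' rfl hKMx (by linarith) (by linarith) (by linarith)
      (by linarith) (by linarith) (by linarith) (by linarith) (by
        simp only [Complex.mul_im] at hθ ⊢
        linarith)
      ((ρ₀ * m' * Γ + m * (ρ₀ * Γ')) * Z + m * Γ * ρ₀)
    simp only [Complex.mul_re, Complex.mul_im] at hid hcor ⊢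
    rw [hid, contactForm]
    have hℓ : 0 ≤ lam / (2 * M ρ₀) := by positivity
    have f1 := mul_le_mul_of_nonneg_left hw hℓ
    rw [← hQ, ← hQ'] at f1
    have f2 := mul_le_mul_of_nonneg_left hcor hK0.le
    have f3 : m / (1 + ρ) * (1 + T ^ 2) * (Γ * Z) ≤ (1 + T ^ 2) / M ρ₀ * (m * Γ * Z) := by
      have g1 : m / (1 + ρ) ≤ m / M ρ₀ := by
        gcongr
        linarith
      have g2 : (1 + T ^ 2) / M ρ₀ * (m * Γ * Z) = m / M ρ₀ * ((1 + T ^ 2) * (Γ * Z)) := by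
        field_simp
      rw [g2, mul_assoc]
      gcongr
    have f4 : 0 < (1 + T ^ 2) / M ρ₀ * ε := by positivity
    have f5 : (T - δ) * σ = (H.im + T * H.re) * σ := by rw [hδ]; ring
    rw [f5, ← hp]
    linarith

/-! ### The barrier -/

namespace ConjSystem

variable {φ ω₁ ω₂ S v : ℂ → ℂ} {M : ℝ → ℝ}

theorem S_ne_zero (hφ : IsRealConvex φ) (h : ConjSystem φ ω₁ ω₂ S v) {z : ℂ}
    (hz : ‖z‖ ≤ 0.41422) : S z ≠ 0 := by
  intro hS
  have h1 := h.norm_S_sub_one_le hφ hz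
  rw [hS, zero_sub, norm_neg, norm_one] at h1
  have : ‖z‖ ^ 3 ≤ 0.41422 ^ 3 := by gcongr
  linarith

theorem hasDerivAt_inv_S (hφ : IsRealConvex φ) (h : ConjSystem φ ω₁ ω₂ S v) {z : ℂ}
    (hz : ‖z‖ ≤ 0.41422) : ∃ s', HasDerivAt (fun x => (S x)⁻¹) s' z ∧
      z * s' = (S z)⁻¹ * ((φ (ω₁ z) + φ (ω₂ z)) / 2 - φ (ω₁ z) * (S z)⁻¹) := by
  have hzb : z ∈ ball (0 : ℂ) 1 := by
    simp only [mem_ball, dist_zero_right]; linarith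
  have hS := h.S_ne_zero hφ hz
  refine ⟨_, (hasDerivAt_of_diff h.diffS hzb).inv hS, ?_⟩
  rw [← mul_div_assoc, mul_neg, h.eqS z hzb]
  field_simp
  ring

theorem hasDerivAt_quot (hφ : IsRealConvex φ) (h : ConjSystem φ ω₁ ω₂ S v) {z : ℂ}
    (hz : ‖z‖ ≤ 0.41422) : ∃ y', HasDerivAt (fun x => v x / S x) y' z ∧
      z * y' = 1 - φ (ω₁ z) * (S z)⁻¹ * (v z / S z) := by
  have hzb : z ∈ ball (0 : ℂ) 1 := by
    simp only [mem_ball, dist_zero_right]; linarith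
  have hS := h.S_ne_zero hφ hz
  refine ⟨_, (hasDerivAt_of_diff h.diffv hzb).div (hasDerivAt_of_diff h.diffS hzb) hS, ?_⟩
  rw [← mul_div_assoc, mul_sub, ← mul_assoc, h.eqv z hzb, mul_left_comm, h.eqS z hzb]
  field_simp
  ring

/-- The barrier: it compares `v / S` with the majorant `M` in the direction of the unit number `e`.
Since `|z| (M - λ)' = 1` and `|z| λ' = -φ(-|z|) M`, the terms with the weight `λ` remove from the
radial derivative what is of first order in `1 - 1 / S`. The correction `m` is needed near
the centre, where `λ` is large. -/
noncomputable def barrier (φ ω₁ S v : ℂ → ℂ) (M : ℝ → ℝ) (r : ℝ) (e : ℂ) (ε m : ℝ) (z : ℂ) : ℝ :=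
  (M ‖z‖ - IsMajorant.weight M r ‖z‖ + ε) - (e * (v z / S z)).re
    + IsMajorant.weight M r ‖z‖ * ((1 + e.im * Complex.I) * (S z)⁻¹).re
    + m * (deriv φ (-(‖z‖ : ℂ))).re * (‖z‖ + (ω₁ z).re)

set_option maxHeartbeats 400000 in
/-- Positivity of the barrier propagates outwards through an annulus on which `contactForm` is
nonnegative. -/
theorem barrier_pos (hφ : IsRealConvex φ) (h : ConjSystem φ ω₁ ω₂ S v) (hM : IsMajorant φ M)
    {r ρa ρb A ε : ℝ} {e : ℂ} {m m' R : ℝ → ℝ} (he : ‖e‖ = 1) (hr1 : r ≤ 0.41422)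
    (hMr : M r * (2 * r) ≤ 1 - r ^ 2) (ha : 0 < ρa) (hbr : ρb ≤ r) (hε : 0 < ε)
    (hm : ∀ ρ, ρa ≤ ρ → ρ ≤ ρb → 0 ≤ m ρ ∧ HasDerivAt m (m' ρ) ρ ∧ -A ≤ ρ * m' ρ)
    (hR : ∀ ρ, ρa < ρ → ρ ≤ ρb → ρ ≤ R ρ ∧ R ρ ≤ 0.41422)
    (hpos : ∀ z : ℂ, ‖z‖ = ρa → 0 < barrier φ ω₁ S v M r e ε (m ρa) z)
    (hform : ∀ ρ, ρa < ρ → ρ ≤ ρb → ∀ ℓ W σ C T K p δ q g d, 0 ≤ ℓ →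
      ℓ ≤ Real.log (r / ρ) / 2 → (1 - W) ^ 2 * (1 - ρ ^ 2) ≤ 2 * (1 - 2 * ρ - ρ ^ 2) →
      IsContact (R ρ) W σ C T K p δ q g d →
      0 ≤ contactForm (R ρ) ℓ σ C (m ρ) A T K p δ q g)
    {z : ℂ} (hz0 : ρa ≤ ‖z‖) (hz1 : ‖z‖ ≤ ρb) :
    0 < barrier φ ω₁ S v M r e ε (m ‖z‖) z := by
  have hr0 : 0 < r := by linarith
  have hlt : ∀ x : ℂ, ‖x‖ ≤ ρb → x ∈ ball (0 : ℂ) 1 := by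
    intro x hx
    simp only [mem_ball, dist_zero_right]
    linarith
  refine pos_of_contact (F := fun x => barrier φ ω₁ S v M r e ε (m ‖x‖) x) ha ?_ ?_ ?_ hz0 hz1
  · intro x hx
    have hxb := hlt x hx.2
    have hx0 : 0 < ‖x‖ := ha.trans_le hx.1
    have hx1 : ‖x‖ < 1 := by simpa using hxb
    have hx2 : ‖x‖ ≤ 0.41422 := by linarith [hx.2]
    have hn : ContinuousAt (fun y : ℂ => ‖y‖) x := by fun_prop
    have c1 : ContinuousAt (fun y : ℂ => M ‖y‖) x :=
      ContinuousAt.comp (g := M) (hM.hasDerivAt hx0.le hx1).continuousAt hn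
    have c2 : ContinuousAt (fun y : ℂ => IsMajorant.weight M r ‖y‖) x :=
      ContinuousAt.comp (g := IsMajorant.weight M r)
        (hM.hasDerivAt_weight hr0 hx0 hx1).continuousAt hn
    obtain ⟨y', hy', -⟩ := h.hasDerivAt_quot hφ hx2
    obtain ⟨s', hs', -⟩ := h.hasDerivAt_inv_S hφ hx2
    obtain ⟨Γ', hΓ', -⟩ := hφ.hasDerivAt_deriv_neg hx0.le hx1
    have c3 : ContinuousAt (fun y : ℂ => (deriv φ (-(‖y‖ : ℂ))).re) x :=
      ContinuousAt.comp (g := fun t : ℝ => (deriv φ (-(t : ℂ))).re) hΓ'.continuousAt hn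
    have c4 : ContinuousAt (fun y : ℂ => m ‖y‖) x :=
      ContinuousAt.comp (g := m) (hm ‖x‖ hx.1 hx.2).2.1.continuousAt hn
    have c5 := (hasDerivAt_of_diff h.diff₁ hxb).continuousAt
    have c6 := hy'.continuousAt
    have c7 := hs'.continuousAt
    refine ContinuousAt.continuousWithinAt ?_
    have hre : ∀ {g : ℂ → ℂ}, ContinuousAt g x → ContinuousAt (fun y => (g y).re) x :=
      fun hg => Complex.continuous_re.continuousAt.comp hg
    exact ((((c1.sub c2).add continuousAt_const).sub (hre (continuousAt_const.mul c6))).add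
      (c2.mul (hre (continuousAt_const.mul c7)))).add ((c4.mul c3).mul (hn.add (hre c5)))
  · intro x hx
    have := hpos x hx
    rwa [← hx] at this
  · intro x hxa hxb' hF
    have hxb := hlt x hxb'
    have hx0 : 0 < ‖x‖ := ha.trans hxa
    have hx1 : ‖x‖ < 1 := by simpa using hxb
    have hx2 : ‖x‖ ≤ 0.41422 := by linarith
    obtain ⟨hm0, hm', hmA⟩ := hm ‖x‖ hxa.le hxb'
    obtain ⟨y', hy', ey⟩ := h.hasDerivAt_quot hφ hx2
    obtain ⟨s', hs', es⟩ := h.hasDerivAt_inv_S hφ hx2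
    obtain ⟨Γ', hΓ', eΓ⟩ := hφ.hasDerivAt_deriv_neg hx0.le hx1
    have hω := hasDerivAt_of_diff h.diff₁ hxb
    have hw := hM.hasDerivAt_weight hr0 hx0 hx1
    have hM' := hM.hasDerivAt hx0.le hx1
    have eM := hM.eqn ‖x‖ hx0.le hx1
    have hey := hy'.const_mul e
    have hes := hs'.const_mul (1 + e.im * Complex.I)
    have hrad := ((((hasDerivAt_norm_radial ((hM'.sub hw).add_const ε)).sub
      (hasDerivAt_re (hasDerivAt_radial hey))).add
      ((hasDerivAt_norm_radial hw).mul (hasDerivAt_re (hasDerivAt_radial hes)))).add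
      ((hasDerivAt_norm_radial (hm'.mul hΓ')).mul
        ((hasDerivAt_norm_radial (hasDerivAt_id ‖x‖)).add (hasDerivAt_re (hasDerivAt_radial hω)))))
    have hang := ((((hasDerivAt_norm_angular
        (fun t => M t - IsMajorant.weight M r t + ε) x).sub
      (hasDerivAt_re (hasDerivAt_angular hey))).add
      ((hasDerivAt_norm_angular (IsMajorant.weight M r) x).mul
        (hasDerivAt_re (hasDerivAt_angular hes)))).add
      ((hasDerivAt_norm_angular (fun t => m t * (deriv φ (-(t : ℂ))).re) x).mul
        ((hasDerivAt_norm_angular id x).add (hasDerivAt_re (hasDerivAt_angular hω)))))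
    refine ⟨_, _, hrad, hang, ?_⟩
    intro hθ
    simp only [Complex.ofReal_zero, Complex.ofReal_one, one_mul, zero_mul, Complex.exp_zero,
      mul_one, id_eq, zero_add, zero_sub, Pi.mul_apply, Pi.add_apply] at hθ ⊢
    have hIre : ∀ q : ℂ, (Complex.I * q).re = -q.im := fun q => by simp [Complex.mul_re]
    rw [hIre, hIre, hIre] at hθ
    have e1 : x * (e * y') = e * (x * y') := by ring
    have e2 : x * ((1 + e.im * Complex.I) * s') = (1 + e.im * Complex.I) * (x * s') := by ring
    rw [e1, e2] at hθ ⊢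
    have hunit : e.im ^ 2 + (1 - e.re) ^ 2 = 2 * (1 - e.re) := by
      have h1 : e.re ^ 2 + e.im ^ 2 = 1 := by
        rw [← one_pow (M := ℝ) 2, ← he, ← Complex.normSq_eq_norm_sq, Complex.normSq_apply]; ring
      linarith
    obtain ⟨hR1, hR2⟩ := hR ‖x‖ hxa hxb'
    have hV : e * (x * y') = (1 - (1 - e.re) : ℝ) + e.im * Complex.I
        - φ (ω₁ x) * (S x)⁻¹ * (e * (v x / S x)) := by
      rw [ey, sub_sub_cancel, Complex.re_add_im]
      ring
    have hlam := hM.weight_nonneg hφ hx0 (hxb'.trans hbr) (by linarith)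
    obtain ⟨T, K, p, δ, q, g, d, hcon, hlt'⟩ := h.exists_contact hφ hM rfl hx0 hR1 hR2 rfl es hV
      hunit hlam hm0 hε hmA eΓ (by
        have := hF
        unfold barrier at this
        linarith) (by linarith)
    have hM1 := hM.one_le hφ hx0.le hx1
    have hℓ : IsMajorant.weight M r ‖x‖ / (2 * M ‖x‖) ≤ Real.log (r / ‖x‖) / 2 := by
      have h1 := hM.weight_le hφ hx0 (hxb'.trans hbr) (by linarith)
      rw [div_le_iff₀ (by positivity)]
      nlinarith
    have hcap : (1 - (φ (-(‖x‖ : ℂ))).re * M ‖x‖) ^ 2 * (1 - ‖x‖ ^ 2)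
        ≤ 2 * (1 - 2 * ‖x‖ - ‖x‖ ^ 2) := by
      have h1 := hM.sq_le hφ hx0.le hx1
      have h2 := hM.monotoneOn hφ (show ‖x‖ ∈ Ico (0 : ℝ) 1 from ⟨hx0.le, hx1⟩)
        (show r ∈ Ico (0 : ℝ) 1 from ⟨hr0.le, by linarith⟩) (hxb'.trans hbr)
      have h3 : 2 * ‖x‖ * M ‖x‖ ≤ 1 - ‖x‖ ^ 2 := by
        have h4 : M ‖x‖ * ‖x‖ ≤ M r * r := mul_le_mul h2 (hxb'.trans hbr) hx0.le (by linarith)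
        have h5 := hxb'.trans hbr
        -- the bound at `r` is stronger than the one at `|x|`
        nlinarith
      linarith
    have hge := hform ‖x‖ hxa hxb' _ _ _ _ T K p δ q g d (by positivity) hℓ hcap hcon
    have hpos' := hge.trans_lt hlt'
    have hfin := pos_of_mul_pos_right hpos' hcon.K_pos.le
    refine hfin.trans_eq ?_
    have e3 : ‖x‖ * (deriv M ‖x‖ - -((φ (-(‖x‖ : ℂ))).re * M ‖x‖) / ‖x‖) = 1 := by
      rw [mul_sub, eM]
      field_simp
      ring
    have e4 : ‖x‖ * (-((φ (-(‖x‖ : ℂ))).re * M ‖x‖) / ‖x‖) = -((φ (-(‖x‖ : ℂ))).re * M ‖x‖) := by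
      field_simp
    rw [e3, e4]
    ring

end ConjSystem

/-! ### Reduction to quadratic forms -/

/-- A binary quadratic form with nonpositive discriminant is nonnegative. -/
theorem form_nonneg {a b c : ℝ} (ha : 0 < a) (h : b ^ 2 ≤ 4 * a * c) (x y : ℝ) :
    0 ≤ a * x ^ 2 - b * (x * y) + c * y ^ 2 := by
  have h1 : 0 ≤ 4 * a * (a * x ^ 2 - b * (x * y) + c * y ^ 2) := by
    have := mul_nonneg (sub_nonneg.2 h) (sq_nonneg y)
    nlinarith [sq_nonneg (2 * a * x - b * y)]
  exact nonneg_of_mul_nonneg_right h1 (by linarith)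

/-- An affine function that is nonnegative at both ends of an interval is nonnegative on it. -/
theorem affine_nonneg {α β x y t : ℝ} (hx : 0 ≤ α + β * x) (hy : 0 ≤ α + β * y) (h1 : x ≤ t)
    (h2 : t ≤ y) : 0 ≤ α + β * t := by
  rcases le_total 0 β with h | h
  · nlinarith
  · nlinarith

/-- Bounds of `C = 1 - cos χ` in terms of `σ = ± sin χ`. -/
theorem unit_bounds {σ C : ℝ} (h : σ ^ 2 + C ^ 2 = 2 * C) :
    σ ^ 2 / 2 ≤ C ∧ σ ^ 2 / 2 + σ ^ 4 / 8 ≤ C ∧ σ ^ 2 ≤ 1 := by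
  have h1 : σ ^ 2 / 2 ≤ C := by nlinarith [sq_nonneg C]
  have h2 : (σ ^ 2 / 2) ^ 2 ≤ C ^ 2 := by
    have : 0 ≤ σ ^ 2 / 2 := by positivity
    gcongr
  refine ⟨h1, by nlinarith, by nlinarith [sq_nonneg (C - 1)]⟩

/-- The part of `contactForm` without the correction, with a general multiplier `k` of
`C - T σ`. -/
noncomputable def coreForm (ρ ℓ σ C T k p δ : ℝ) : ℝ :=
  T ^ 2 + p + k * (C - T * σ) + (T - δ) * σ
    - ℓ * (1 + 4 * ρ ^ 2 / (1 - ρ ^ 2) ^ 2) * (p + T * δ)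
    + ℓ * ((1 + ρ ^ 2) / (1 - ρ) ^ 2) * σ * (δ - T * p)
    - ℓ * (ρ / (1 - ρ) ^ 2) * σ ^ 2 * (1 + T ^ 2)

/-- Minimisation of `coreForm` over `(p, δ)` in the disc. The parameter `κ` keeps a part of
`Q = p + T δ`, and `c₀` bounds `1 / (4 s ϖ)` for `s = 1 - l₁ - κ`, `ϖ = (1 + ρ)² / (4 ρ)`. -/
theorem core_reduce {ρ T σ p δ l₁ l₂ l₃ κ c₀ e : ℝ} (hρ : 0 < ρ) (hs : 0 < 1 - l₁ - κ)
    (hc₀ : ρ ≤ c₀ * ((1 - l₁ - κ) * (1 + ρ) ^ 2))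
    (hd : (1 + ρ) ^ 2 * (p ^ 2 + δ ^ 2) ≤ 4 * ρ * (p + T * δ)) :
    T ^ 2 + T * σ - l₃ * σ ^ 2 * (1 + T ^ 2) - c₀ * (T + σ * (1 - l₂)) ^ 2
        - c₀ * (l₂ * σ * T - e) ^ 2
      ≤ T ^ 2 + p + (T - δ) * σ - l₁ * (p + T * δ) + l₂ * σ * (δ - T * p)
        - l₃ * σ ^ 2 * (1 + T ^ 2) - κ * (p + T * δ) + e * p := by
  obtain ⟨g, hg⟩ : ∃ g : ℝ, g = (1 - l₁ - κ) * (1 + ρ) ^ 2 / (4 * ρ) := ⟨_, rfl⟩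
  have hg0 : 0 < g := by rw [hg]; positivity
  have h1 : g * (p ^ 2 + δ ^ 2) ≤ (1 - l₁ - κ) * (p + T * δ) := by
    rw [hg, div_mul_eq_mul_div, div_le_iff₀ (by positivity), mul_assoc]
    have := mul_le_mul_of_nonneg_left hd hs.le
    linarith
  have h2 : 1 ≤ 4 * c₀ * g := by
    rw [hg]
    have : 4 * c₀ * ((1 - l₁ - κ) * (1 + ρ) ^ 2 / (4 * ρ))
        = c₀ * ((1 - l₁ - κ) * (1 + ρ) ^ 2) / ρ := by field_simp
    rw [this, le_div_iff₀ hρ]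
    linarith
  have hsq : ∀ x y : ℝ, 0 ≤ g * x ^ 2 - x * y + c₀ * y ^ 2 := by
    intro x y
    have h3 : 0 ≤ 4 * g * (g * x ^ 2 - x * y + c₀ * y ^ 2) := by
      have := mul_nonneg (sub_nonneg.2 h2) (sq_nonneg y)
      nlinarith [sq_nonneg (2 * g * x - y)]
    exact nonneg_of_mul_nonneg_right h3 (by linarith)
  have h3 := hsq δ (T + σ * (1 - l₂))
  have h4 := hsq p (l₂ * σ * T - e)
  linarith

/-- Conditions for the nonnegativity of the reduced form with constant multiplier `k`, when the
mixed quartic term is bounded by means of `|T| ≤ Tm`. -/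
def FormSlope {F : Type*} [Field F] [LinearOrder F]
    (ρ k κ ν ℓ Tm : F) : Prop :=
  let s := 1 - ℓ * (1 + 4 * ρ ^ 2 / (1 - ρ ^ 2) ^ 2) - κ
  let c₀ := ρ / (s * (1 + ρ) ^ 2)
  let l₂ := ℓ * ((1 + ρ ^ 2) / (1 - ρ) ^ 2)
  let l₃ := ℓ * (ρ / (1 - ρ) ^ 2)
  0 < s ∧ 0 < 1 - ν - c₀ ∧ (k - 1 + 2 * c₀ * (1 - l₂)) ^ 2 ≤
    4 * (1 - ν - c₀) * (k / 2 - l₃ - c₀ * (1 - l₂) ^ 2 - (l₃ + c₀ * l₂ ^ 2) * Tm ^ 2)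

/-- Conditions for the nonnegativity of the reduced form with constant multiplier `k`, when the
mixed quartic term is bounded by convexity in `σ² ∈ [0, 1]`. -/
def FormUnit {F : Type*} [Field F] [LinearOrder F]
    (ρ k κ ν ℓ : F) : Prop :=
  let s := 1 - ℓ * (1 + 4 * ρ ^ 2 / (1 - ρ ^ 2) ^ 2) - κ
  let c₀ := ρ / (s * (1 + ρ) ^ 2)
  let l₂ := ℓ * ((1 + ρ ^ 2) / (1 - ρ) ^ 2)
  let l₃ := ℓ * (ρ / (1 - ρ) ^ 2)
  let b := k - 1 + 2 * c₀ * (1 - l₂)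
  let c := k / 2 - l₃ - c₀ * (1 - l₂) ^ 2
  let e := l₃ + c₀ * l₂ ^ 2
  0 < s ∧ 0 < 1 - ν - c₀ ∧ b ^ 2 ≤ 4 * (1 - ν - c₀) * c ∧
    0 < 1 - ν - c₀ - e ∧ b ^ 2 ≤ 4 * (1 - ν - c₀ - e) * (c + k / 8)

/-- Conditions for the nonnegativity of the reduced form with multiplier `k (1 - p)`; `θ` is the
parameter of Young's inequality. -/
def FormTilt {F : Type*} [Field F] [LinearOrder F]
    (ρ k κ ν ℓ θ : F) : Prop :=
  let s := 1 - ℓ * (1 + 4 * ρ ^ 2 / (1 - ρ ^ 2) ^ 2) - κ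
  let c₀ := ρ / (s * (1 + ρ) ^ 2)
  let l₂ := ℓ * ((1 + ρ ^ 2) / (1 - ρ) ^ 2)
  let l₃ := ℓ * (ρ / (1 - ρ) ^ 2)
  let b := k - 1 + 2 * c₀ * (1 - l₂)
  let c := k / 2 - l₃ - c₀ * (1 - l₂) ^ 2
  let e := l₃ + (1 + 1 / θ) * (c₀ * (l₂ - k) ^ 2)
  0 < s ∧ 0 < 1 - ν - c₀ ∧ b ^ 2 ≤ 4 * (1 - ν - c₀) * c ∧ 2 * (c₀ * (1 + θ) * k) ≤ 1 ∧
    0 < 1 - ν - c₀ - e ∧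
    b ^ 2 ≤ 4 * (1 - ν - c₀ - e) * (c + k / 4 * (1 / 2 - c₀ * (1 + θ) * k))

theorem c₀_spec {ρ s : ℝ} (hρ : 0 < ρ) (hs : 0 < s) :
    ρ ≤ ρ / (s * (1 + ρ) ^ 2) * (s * (1 + ρ) ^ 2) := by
  rw [div_mul_cancel₀]
  positivity

theorem core_nonneg_of_formSlope {ρ ℓ σ C T k p δ κ ν Tm : ℝ} (hρ : 0 < ρ) (hρ1 : ρ < 1)
    (hk : 0 ≤ k) (hℓ : 0 ≤ ℓ) (hC : σ ^ 2 + C ^ 2 = 2 * C)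
    (hd : (1 + ρ) ^ 2 * (p ^ 2 + δ ^ 2) ≤ 4 * ρ * (p + T * δ)) (hT : |T| ≤ Tm)
    (h : FormSlope ρ k κ ν ℓ Tm) :
    0 ≤ coreForm ρ ℓ σ C T k p δ - κ * (p + T * δ) - ν * T ^ 2 := by
  obtain ⟨hs, ha, hb⟩ := h
  have hr := core_reduce (e := 0) (l₂ := ℓ * ((1 + ρ ^ 2) / (1 - ρ) ^ 2))
    (l₃ := ℓ * (ρ / (1 - ρ) ^ 2)) (σ := σ) hρ hs (c₀_spec hρ hs) hd
  rw [coreForm]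
  have hc₀ : 0 ≤ ρ / ((1 - ℓ * (1 + 4 * ρ ^ 2 / (1 - ρ ^ 2) ^ 2) - κ) * (1 + ρ) ^ 2) := by
    positivity
  have hl₃ : 0 ≤ ℓ * (ρ / (1 - ρ) ^ 2) := by
    have : 0 < 1 - ρ := by linarith
    positivity
  generalize ρ / ((1 - ℓ * (1 + 4 * ρ ^ 2 / (1 - ρ ^ 2) ^ 2) - κ) * (1 + ρ) ^ 2) = c₀ at *
  generalize ℓ * ((1 + ρ ^ 2) / (1 - ρ) ^ 2) = l₂ at *
  generalize ℓ * (ρ / (1 - ρ) ^ 2) = l₃ at *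
  have hf := form_nonneg ha hb T σ
  have h1 := mul_le_mul_of_nonneg_left (unit_bounds hC).1 hk
  have hT2 : T ^ 2 ≤ Tm ^ 2 := by
    rw [← sq_abs]
    gcongr
  have h2 : (l₃ + c₀ * l₂ ^ 2) * σ ^ 2 * T ^ 2 ≤ (l₃ + c₀ * l₂ ^ 2) * σ ^ 2 * Tm ^ 2 := by
    gcongr
  linarith

theorem core_nonneg_of_formUnit {ρ ℓ σ C T k p δ κ ν : ℝ} (hρ : 0 < ρ) (hk : 0 ≤ k)
    (hC : σ ^ 2 + C ^ 2 = 2 * C)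
    (hd : (1 + ρ) ^ 2 * (p ^ 2 + δ ^ 2) ≤ 4 * ρ * (p + T * δ)) (h : FormUnit ρ k κ ν ℓ) :
    0 ≤ coreForm ρ ℓ σ C T k p δ - κ * (p + T * δ) - ν * T ^ 2 := by
  obtain ⟨hs, ha, hb, ha', hb'⟩ := h
  have hr := core_reduce (e := 0) (l₂ := ℓ * ((1 + ρ ^ 2) / (1 - ρ) ^ 2))
    (l₃ := ℓ * (ρ / (1 - ρ) ^ 2)) (σ := σ) hρ hs (c₀_spec hρ hs) hd
  rw [coreForm]
  generalize ρ / ((1 - ℓ * (1 + 4 * ρ ^ 2 / (1 - ρ ^ 2) ^ 2) - κ) * (1 + ρ) ^ 2) = c₀ at *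
  generalize ℓ * ((1 + ρ ^ 2) / (1 - ρ) ^ 2) = l₂ at *
  generalize ℓ * (ρ / (1 - ρ) ^ 2) = l₃ at *
  obtain ⟨-, h1, h2⟩ := unit_bounds hC
  have h3 := mul_le_mul_of_nonneg_left h1 hk
  have hf0 := form_nonneg ha hb T σ
  have hf1 := form_nonneg ha' hb' T σ
  have hf := affine_nonneg (t := σ ^ 2) (x := 0) (y := 1)
    (α := (1 - ν - c₀) * T ^ 2 - (k - 1 + 2 * c₀ * (1 - l₂)) * (T * σ)
      + (k / 2 - l₃ - c₀ * (1 - l₂) ^ 2) * σ ^ 2)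
    (β := k / 8 * σ ^ 2 - (l₃ + c₀ * l₂ ^ 2) * T ^ 2) (by linarith) (by linarith)
    (sq_nonneg σ) h2
  linarith

theorem core_nonneg_of_formTilt {ρ ℓ σ C T k p δ κ ν θ : ℝ} (hρ : 0 < ρ) (hk : 0 ≤ k)
    (hθ : 0 < θ) (hC : σ ^ 2 + C ^ 2 = 2 * C)
    (hd : (1 + ρ) ^ 2 * (p ^ 2 + δ ^ 2) ≤ 4 * ρ * (p + T * δ)) (h : FormTilt ρ k κ ν ℓ θ) :
    0 ≤ coreForm ρ ℓ σ C T (k * (1 - p)) p δ - κ * (p + T * δ) - ν * T ^ 2 := by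
  obtain ⟨hs, ha, hb, hθ1, ha', hb'⟩ := h
  have hr := core_reduce (e := -k * (C - T * σ)) (l₂ := ℓ * ((1 + ρ ^ 2) / (1 - ρ) ^ 2))
    (l₃ := ℓ * (ρ / (1 - ρ) ^ 2)) (σ := σ) hρ hs (c₀_spec hρ hs) hd
  rw [coreForm]
  have hc₀ : 0 ≤ ρ / ((1 - ℓ * (1 + 4 * ρ ^ 2 / (1 - ρ ^ 2) ^ 2) - κ) * (1 + ρ) ^ 2) := by
    positivity
  generalize ρ / ((1 - ℓ * (1 + 4 * ρ ^ 2 / (1 - ρ ^ 2) ^ 2) - κ) * (1 + ρ) ^ 2) = c₀ at *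
  generalize ℓ * ((1 + ρ ^ 2) / (1 - ρ) ^ 2) = l₂ at *
  generalize ℓ * (ρ / (1 - ρ) ^ 2) = l₃ at *
  obtain ⟨h1, -, h2⟩ := unit_bounds hC
  have hf0 := form_nonneg ha hb T σ
  have hf1 := form_nonneg ha' hb' T σ
  have hf := affine_nonneg (t := σ ^ 2) (x := 0) (y := 1)
    (α := (1 - ν - c₀) * T ^ 2 - (k - 1 + 2 * c₀ * (1 - l₂)) * (T * σ)
      + (k / 2 - l₃ - c₀ * (1 - l₂) ^ 2) * σ ^ 2)
    (β := k / 4 * (1 / 2 - c₀ * (1 + θ) * k) * σ ^ 2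
      - (l₃ + (1 + 1 / θ) * (c₀ * (l₂ - k) ^ 2)) * T ^ 2) (by linarith) (by linarith)
    (sq_nonneg σ) h2
  -- Young's inequality for `(l₂ σ T - e)² = ((l₂ - k) σ T + k C)²`
  have hy : (l₂ * σ * T - -k * (C - T * σ)) ^ 2
      ≤ (1 + θ) * (k * C) ^ 2 + (1 + 1 / θ) * ((l₂ - k) * (σ * T)) ^ 2 := by
    have e1 : (1 + θ) * (k * C) ^ 2 + (1 + 1 / θ) * ((l₂ - k) * (σ * T)) ^ 2
        - (l₂ * σ * T - -k * (C - T * σ)) ^ 2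
        = (θ * (k * C) - (l₂ - k) * (σ * T)) ^ 2 / θ := by
      field_simp
      ring
    have e2 : 0 ≤ (θ * (k * C) - (l₂ - k) * (σ * T)) ^ 2 / θ := by positivity
    linarith
  have hy' := mul_le_mul_of_nonneg_left hy hc₀
  -- `C = σ² / 2 + C² / 2` and `C ≥ σ² / 2`
  have hC2 : (σ ^ 2 / 2) ^ 2 ≤ C ^ 2 := by gcongr
  have h4 : k * (1 / 2 - c₀ * (1 + θ) * k) * (σ ^ 2 / 2) ^ 2
      ≤ k * (1 / 2 - c₀ * (1 + θ) * k) * C ^ 2 :=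
    mul_le_mul_of_nonneg_left hC2 (mul_nonneg hk (by linarith))
  have h5 : k * C = k * (σ ^ 2 / 2) + k * (C ^ 2 / 2) := by
    linear_combination (-k / 2) * hC
  linarith

/-! ### Bounds of the slope and of the multiplier -/

/-- The bound `ρ + ρ³ / 3` of `|S - 1|`. -/
def distBound {F : Type*} [Field F] (ρ : F) : F := ρ + ρ ^ 3 / 3

/-- The bound of the slope `T` at a contact point at a radius at most `ρ`, by the addition formula
for the tangent. The factor `1 + 3 / 5 u²` replaces `1 / √(1 - u²)`, to stay rational. -/
def slopeBound {F : Type*} [Field F] (ρ : F) : F :=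
  let t := distBound ρ * (1 + 3 / 5 * distBound ρ ^ 2)
  (2 * ρ + (1 - ρ ^ 2) * t) / (1 - ρ ^ 2 - 2 * ρ * t)

/-- The upper bound of the multiplier `K`. -/
def multUpper {F : Type*} [Field F] (ρ : F) : F := (1 + distBound ρ) / (1 - ρ)

/-- A constant lower bound of the multiplier `K`; the subtracted term bounds `p`. -/
def multLower {F : Type*} [Field F] (ρ : F) : F :=
  (1 - distBound ρ) * (1 - (1 + slopeBound ρ ^ 2 / 2) * (4 * ρ / (1 + ρ) ^ 2))

namespace IsContact

variable {ρ W σ C T K p δ q g d : ℝ}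

theorem abs_T_le (h : IsContact ρ W σ C T K p δ q g d) (h0 : 0 < ρ) (h1 : ρ ≤ 0.41422) :
    |T| ≤ slopeBound ρ := by
  have hu0 : 0 < distBound ρ := by rw [distBound]; positivity
  have hu1 : distBound ρ ≤ 0.438 := by
    have : ρ ^ 3 ≤ 0.41422 ^ 3 := by gcongr
    rw [distBound]
    linarith
  have hsl := h.slope (distBound ρ * (1 + 3 / 5 * distBound ρ ^ 2)) (by positivity)
  rw [slopeBound]
  change distBound ρ ^ 2 ≤ _ * (1 - distBound ρ ^ 2) → _ at hsl
  generalize distBound ρ = u at *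
  have hu2 : u ^ 2 ≤ 0.192 := by nlinarith
  have ht : u * (1 + 3 / 5 * u ^ 2) ≤ 0.5 := by nlinarith
  have hd : 0 < 1 - ρ ^ 2 - 2 * ρ * (u * (1 + 3 / 5 * u ^ 2)) := by
    have := mul_le_mul_of_nonneg_left ht (by positivity : 0 ≤ 2 * ρ)
    nlinarith
  rw [le_div_iff₀ hd]
  refine hsl ?_ (by linarith)
  have e : (u * (1 + 3 / 5 * u ^ 2)) ^ 2 * (1 - u ^ 2) - u ^ 2
      = u ^ 2 * (u ^ 2 * (1 / 5 - 21 / 25 * u ^ 2 - 9 / 25 * (u ^ 2) ^ 2)) := by ring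
  have : 0 ≤ 1 / 5 - 21 / 25 * u ^ 2 - 9 / 25 * (u ^ 2) ^ 2 := by nlinarith [sq_nonneg u]
  have : 0 ≤ u ^ 2 * (u ^ 2 * (1 / 5 - 21 / 25 * u ^ 2 - 9 / 25 * (u ^ 2) ^ 2)) := by positivity
  linarith

theorem le_K (h : IsContact ρ W σ C T K p δ q g d) (h0 : 0 < ρ) (hu : distBound ρ < 1) :
    (1 - distBound ρ) * (1 - p) ≤ K := by
  have hu0 : 0 < distBound ρ := by rw [distBound]; positivity
  have hn := h.near
  change _ ≤ distBound ρ ^ 2 * _ at hn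
  have hp := h.p_lt_one
  have hWK : W * K ≤ K := mul_le_of_le_one_left h.K_pos.le h.W_le
  generalize distBound ρ = u at *
  have h2 : (W * K - (1 - p)) ^ 2 ≤ (u * (1 - p)) ^ 2 := by
    have : 0 ≤ (1 - u ^ 2) * (T - δ) ^ 2 := mul_nonneg (by nlinarith) (sq_nonneg _)
    linarith
  have h3 := abs_le_of_sq_le_sq h2 (mul_nonneg hu0.le (by linarith))
  linarith [neg_le_of_abs_le h3]

/-- An upper bound of the multiplier with a free term `η T²`: the condition `near` bounds `K` in terms
of `p` and `T - δ`, and a quadratic form in `(δ, T)` remains. -/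
theorem K_le (h : IsContact ρ W σ C T K p δ q g d) (h0 : 0 < ρ) (hu : distBound ρ < 1)
    {w η : ℝ} (hw : 0 < w) (hwW : w ≤ W) (hη : 0 ≤ η)
    (hd : (2 * ((1 - distBound ρ ^ 2) / (2 * distBound ρ * w)) + (1 + distBound ρ) / w) ^ 2 ≤
      4 * ((1 - distBound ρ ^ 2) / (2 * distBound ρ * w) + η) *
        ((1 - distBound ρ ^ 2) / (2 * distBound ρ * w)
          + (1 + distBound ρ) / w * ((1 + ρ) ^ 2 / (4 * ρ)))) :
    K ≤ (1 + distBound ρ) / w + η * T ^ 2 := by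
  have hu0 : 0 < distBound ρ := by rw [distBound]; positivity
  have hn := h.near
  change _ ≤ distBound ρ ^ 2 * _ at hn
  have hp := h.p_lt_one
  have hK := h.K_pos
  have hdisc := h.disc
  generalize distBound ρ = u at *
  obtain ⟨β, hβ⟩ : ∃ β, β = (1 - u ^ 2) / (2 * u * w) := ⟨_, rfl⟩
  obtain ⟨k, hk⟩ : ∃ k, k = (1 + u) / w := ⟨_, rfl⟩
  rw [← hβ, ← hk] at hd
  rw [← hk]
  have hβ0 : 0 < β := by
    rw [hβ]
    have : 0 < 1 - u ^ 2 := by nlinarith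
    positivity
  have hk0 : 0 < k := by rw [hk]; positivity
  have hβ' : β * (2 * u * w) = 1 - u ^ 2 := by rw [hβ]; field_simp
  have hk' : k * w = 1 + u := by rw [hk]; field_simp
  have hWK : w * K ≤ W * K := mul_le_mul_of_nonneg_right hwW hK.le
  have hX : 0 < 1 - p := by linarith
  -- the square root in the bound for `K` is removed by the inequality of the means
  have h1 : 2 * u * (1 - p) * (w * K) ≤ 2 * u * (1 - p) ^ 2 + 2 * u ^ 2 * (1 - p) ^ 2
      - (1 - u ^ 2) * (T - δ) ^ 2 := by
    have e1 : 2 * u * (1 - p) * (w * K) ≤ 2 * u * (1 - p) * (W * K) :=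
      mul_le_mul_of_nonneg_left hWK (by positivity)
    nlinarith only [e1, hn, sq_nonneg (W * K - (1 - p) - u * (1 - p))]
  have h2 : (1 - p) * K ≤ k * (1 - p) ^ 2 - β * (T - δ) ^ 2 := by
    refine le_of_mul_le_mul_left ?_ (by positivity : 0 < 2 * u * w)
    have e2 : 2 * u * w * (k * (1 - p) ^ 2 - β * (T - δ) ^ 2)
        = 2 * u * (k * w) * (1 - p) ^ 2 - β * (2 * u * w) * (T - δ) ^ 2 := by ring
    rw [e2, hk', hβ']
    linarith
  refine le_of_mul_le_mul_left ?_ hX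
  refine h2.trans ?_
  have h3 : 0 ≤ η * T ^ 2 := by positivity
  have h4 : 0 ≤ β * (T - δ) ^ 2 := by positivity
  rcases le_total 0 p with h5 | h5
  · have h6 : 0 ≤ k * (p * (1 - p)) := by positivity
    have h7 := mul_nonneg hX.le h3
    linarith
  · have hf := form_nonneg (a := β + k * ((1 + ρ) ^ 2 / (4 * ρ))) (b := 2 * β + k)
      (c := β + η) (by positivity) (by linarith) δ T
    have h8 : (1 + ρ) ^ 2 / (4 * ρ) * (p ^ 2 + δ ^ 2) ≤ p + T * δ := by
      rw [div_mul_eq_mul_div, div_le_iff₀ (by positivity)]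
      linarith
    have h9 : 1 ≤ (1 + ρ) ^ 2 / (4 * ρ) := by
      rw [le_div_iff₀ (by positivity)]
      nlinarith [sq_nonneg (1 - ρ)]
    have h10 : p ^ 2 ≤ (1 + ρ) ^ 2 / (4 * ρ) * p ^ 2 := le_mul_of_one_le_left (sq_nonneg p) h9
    have h11 : k * (p ^ 2 - p + (1 + ρ) ^ 2 / (4 * ρ) * δ ^ 2) ≤ k * (T * δ) :=
      mul_le_mul_of_nonneg_left (by linarith) hk0.le
    have h12 : η * T ^ 2 ≤ (1 - p) * (η * T ^ 2) := le_mul_of_one_le_left h3 (by linarith)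
    linarith

theorem K_le_multUpper (h : IsContact ρ W σ C T K p δ q g d) (h0 : 0 < ρ) (h1 : ρ ≤ 1 / 3) :
    K ≤ multUpper ρ := by
  have hu0 : 0 < distBound ρ := by rw [distBound]; positivity
  have hu1 : distBound ρ ≤ 28 / 81 := by
    have : ρ ^ 3 ≤ (1 / 3) ^ 3 := by gcongr
    rw [distBound]
    linarith
  have h13 : 4 / 3 ≤ (1 + ρ) ^ 2 / (4 * ρ) := by
    rw [le_div_iff₀ (by positivity)]
    nlinarith
  have := h.K_le h0 (by linarith) (w := 1 - ρ) (η := 0) (by linarith) h.le_W le_rfl ?_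
  · rw [multUpper]
    linarith
  generalize distBound ρ = u at *
  generalize (1 + ρ) ^ 2 / (4 * ρ) = ϖ at *
  have hw : 0 < 1 - ρ := by linarith
  generalize 1 - ρ = w at *
  have e : 4 * ((1 - u ^ 2) / (2 * u * w) + 0) *
        ((1 - u ^ 2) / (2 * u * w) + (1 + u) / w * ϖ)
      - (2 * ((1 - u ^ 2) / (2 * u * w)) + (1 + u) / w) ^ 2
      = (1 + u) ^ 2 / (u * w ^ 2) * (2 * (1 - u) * (ϖ - 1) - u) := by
    field_simp
    ring
  have : 0 ≤ (1 + u) ^ 2 / (u * w ^ 2) * (2 * (1 - u) * (ϖ - 1) - u) := by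
    refine mul_nonneg (by positivity) ?_
    nlinarith
  linarith

/-- On the disc `p` is at most `(1 + T² / 2) · 4 ρ / (1 + ρ)²`. -/
theorem multLower_le (h : IsContact ρ W σ C T K p δ q g d) (h0 : 0 < ρ) (h1 : ρ ≤ 0.41422)
    (hu : distBound ρ < 1) :
    multLower ρ ≤ (1 - distBound ρ) * (1 - p) := by
  have hT := h.abs_T_le h0 h1
  have hd := h.disc
  rw [multLower]
  refine mul_le_mul_of_nonneg_left ?_ (by linarith)
  have hT2 : T ^ 2 ≤ slopeBound ρ ^ 2 := by
    rw [← sq_abs]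
    gcongr
  obtain ⟨w, hw⟩ : ∃ w, w = 4 * ρ / (1 + ρ) ^ 2 := ⟨_, rfl⟩
  rw [← hw]
  have hw0 : 0 < w := by rw [hw]; positivity
  have hd' : p ^ 2 + δ ^ 2 ≤ w * (p + T * δ) := by
    rw [hw, div_mul_eq_mul_div, le_div_iff₀ (by positivity)]
    linarith
  have h3 : (1 + T ^ 2 / 2) * w ≤ (1 + slopeBound ρ ^ 2 / 2) * w := by gcongr
  suffices p ≤ (1 + T ^ 2 / 2) * w by linarith
  by_contra! hp
  have h4 : p * p - w * p ≤ w ^ 2 * T ^ 2 / 4 := by nlinarith [sq_nonneg (δ - w * T / 2)]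
  have h5 : (1 + T ^ 2 / 2) * w * (T ^ 2 / 2 * w) ≤ p * (p - w) :=
    mul_le_mul hp.le (by linarith) (by positivity) (by nlinarith [sq_nonneg T])
  have h6 : w ≤ (1 + T ^ 2 / 2) * w := le_mul_of_one_le_left hw0.le (by nlinarith [sq_nonneg T])
  have h7 : w * (w * T ^ 2) ≤ (1 + T ^ 2 / 2) * w * (T ^ 2 * w) := by
    have : 0 ≤ T ^ 2 * w := by positivity
    nlinarith
  rcases eq_or_ne T 0 with rfl | hT0
  · nlinarith
  · have : 0 < w ^ 2 * T ^ 2 := by positivity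
    nlinarith

end IsContact

/-! ### The contribution of the correction -/

/-- The coefficient of `q` in the lower bound of `contactForm` is nonnegative, for the value `f` of
the multiplier and the value `N` of `1 + T²`. -/
def GrowthBound {F : Type*} [Field F] [LinearOrder F] (ρ κ ν mb ma A f N : F) : Prop :=
  let k := multUpper ρ
  let dm := 2 * ρ * (1 + ρ) / ((1 - ρ) * (1 + 4 * ρ + ρ ^ 2))
  let y := ma * k * (2 * ρ / (1 - ρ ^ 2))
  0 ≤ N * (mb / (1 + ρ) + min κ 0 * (((1 + ρ) ^ 2 + 4 * ρ) / (1 - ρ) ^ 2) - y / 2)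
    + max κ 0 / ((1 + ρ) / (1 - ρ) + dm) - y / 2 - (ma * k) ^ 2 * dm / (2 * ν)
    + f * (mb * ((1 - ρ) / (1 + ρ)) - A)

/-- `GrowthBound` for all values of the slope and of the multiplier. -/
def GrowthBounds {F : Type*} [Field F] [LinearOrder F] (ρ κ ν mb ma A f : F) : Prop :=
  GrowthBound ρ κ ν mb ma A f 1 ∧ GrowthBound ρ κ ν mb ma A f (1 + slopeBound ρ ^ 2) ∧
  GrowthBound ρ κ ν mb ma A (multUpper ρ) 1 ∧
  GrowthBound ρ κ ν mb ma A (multUpper ρ) (1 + slopeBound ρ ^ 2)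

namespace IsContact

variable {ρ W σ C T K p δ q g d : ℝ}

theorem Q_nonneg (h : IsContact ρ W σ C T K p δ q g d) (h0 : 0 < ρ) : 0 ≤ p + T * δ := by
  have h1 : 0 ≤ (1 + ρ) ^ 2 * (p ^ 2 + δ ^ 2) := by positivity
  have h2 := h1.trans h.disc
  exact nonneg_of_mul_nonneg_right h2 (by positivity)

/-- `contactForm` at one value `k` of the multiplier, with the corrections estimated. -/
theorem growth_nonneg (h : IsContact ρ W σ C T K p δ q g d) (h0 : 0 < ρ) (h1 : ρ ≤ 0.41422)
    {κ ν m mb ma A f k : ℝ} (hν : 0 < ν) (hmb : 0 ≤ mb) (hm : mb ≤ m) (hma : m ≤ ma)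
    (hf : f ≤ k) (hk : k ≤ multUpper ρ) (hk0 : 0 ≤ k)
    (hG : GrowthBounds ρ κ ν mb ma A f) :
    0 ≤ κ * (p + T * δ) + ν * T ^ 2 + m / (1 + ρ) * (1 + T ^ 2) * q
      + k * q * (m * ((1 - ρ) / (1 + ρ)) - A)
      - multUpper ρ * (m * (2 * ρ / (1 - ρ ^ 2)) * (1 + T ^ 2 / 2) * q)
      - multUpper ρ * (m * |T * g|) := by
  have hQ := h.Q_nonneg h0
  have hT := h.abs_T_le h0 h1
  have hq := h.q_nonneg
  have hq1 := h.q_le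
  have hq2 := h.le_q
  have hρ1 : 0 < 1 - ρ := by linarith
  have hρ2 : 0 < 1 - ρ ^ 2 := by nlinarith
  have hd : d ≤ 2 * ρ * (1 + ρ) / ((1 - ρ) * (1 + 4 * ρ + ρ ^ 2)) := by
    rw [le_div_iff₀ (by positivity)]
    exact h.d_le
  have hd0 := h.d_nonneg
  have hg := h.sq_g_le
  have hT2 : T ^ 2 ≤ slopeBound ρ ^ 2 := by
    rw [← sq_abs]
    gcongr
  have hK0 := hk0.trans hk
  obtain ⟨hG1, hG2, hG3, hG4⟩ := hG
  simp only [GrowthBound] at hG1 hG2 hG3 hG4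
  have hkρ : 0 < 2 * ρ / (1 - ρ ^ 2) := by positivity
  have hx : 0 < (1 + ρ) / (1 - ρ) := by positivity
  have hδ0 : 0 < (1 - ρ) / (1 + ρ) := by positivity
  have hb : (p + T * δ) ≤ ((1 + ρ) ^ 2 + 4 * ρ) / (1 - ρ) ^ 2 * (q * (1 + T ^ 2)) := by
    rw [div_mul_eq_mul_div, le_div_iff₀ (by positivity)]
    linarith
  obtain ⟨N, hN⟩ : ∃ N, N = 1 + T ^ 2 := ⟨_, rfl⟩
  obtain ⟨N', hN'⟩ : ∃ N, N = 1 + slopeBound ρ ^ 2 := ⟨_, rfl⟩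
  have hNN : N ≤ N' := by linarith
  have hN1 : 1 ≤ N := by rw [hN]; nlinarith [sq_nonneg T]
  rw [← hN'] at hG2 hG4
  have eN : 1 + T ^ 2 / 2 = (1 + N) / 2 := by rw [hN]; ring
  rw [eN]
  rw [← hN] at hb hq1 ⊢
  have hm0 := hmb.trans hm
  -- the linear part of the correction
  have hY : multUpper ρ * (m * |T * g|)
      ≤ ν * T ^ 2 + (ma * multUpper ρ) ^ 2
        * (2 * ρ * (1 + ρ) / ((1 - ρ) * (1 + 4 * ρ + ρ ^ 2))) / (2 * ν) * q := by
    obtain ⟨e, he⟩ : ∃ e, e = ma * multUpper ρ := ⟨_, rfl⟩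
    have e1 : multUpper ρ * (m * |T * g|) ≤ e * |T * g| := by
      rw [he, ← mul_assoc, mul_comm (multUpper ρ)]
      gcongr
    rw [abs_mul] at e1
    have e2 : e * (|T| * |g|) ≤ ν * T ^ 2 + e ^ 2 * g ^ 2 / (4 * ν) := by
      have : ν * T ^ 2 + e ^ 2 * g ^ 2 / (4 * ν) - e * (|T| * |g|)
          = (2 * ν * |T| - e * |g|) ^ 2 / (4 * ν) := by
        rw [← sq_abs T, ← sq_abs g]
        field_simp
        ring
      have h2 : 0 ≤ (2 * ν * |T| - e * |g|) ^ 2 / (4 * ν) := by positivity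
      linarith
    have e3 : g ^ 2 ≤ 2 * (2 * ρ * (1 + ρ) / ((1 - ρ) * (1 + 4 * ρ + ρ ^ 2))) * q :=
      hg.trans (by gcongr)
    have e4 : e ^ 2 * g ^ 2 / (4 * ν)
        ≤ e ^ 2 * (2 * (2 * ρ * (1 + ρ) / ((1 - ρ) * (1 + 4 * ρ + ρ ^ 2))) * q) / (4 * ν) := by
      gcongr
    rw [abs_mul, ← he]
    refine e1.trans (e2.trans ?_)
    refine add_le_add le_rfl (e4.trans (le_of_eq ?_))
    field_simp
    norm_num
  have hκ1 : max κ 0 / ((1 + ρ) / (1 - ρ)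
      + 2 * ρ * (1 + ρ) / ((1 - ρ) * (1 + 4 * ρ + ρ ^ 2))) * q ≤ max κ 0 * (p + T * δ) := by
    rw [div_mul_eq_mul_div, div_le_iff₀ (by positivity), mul_assoc]
    refine mul_le_mul_of_nonneg_left ?_ (le_max_right _ _)
    have h2 : q ≤ q * N := le_mul_of_one_le_right hq hN1
    have h3 : d * (p + T * δ)
      ≤ 2 * ρ * (1 + ρ) / ((1 - ρ) * (1 + 4 * ρ + ρ ^ 2)) * (p + T * δ) := by gcongr
    linarith
  have hκ2 : min κ 0 * (((1 + ρ) ^ 2 + 4 * ρ) / (1 - ρ) ^ 2) * N * q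
      ≤ min κ 0 * (p + T * δ) := by
    have := mul_le_mul_of_nonpos_left hb (min_le_right κ 0)
    linarith
  have hκ : κ * (p + T * δ) = max κ 0 * (p + T * δ) + min κ 0 * (p + T * δ) := by
    rw [← add_mul, max_add_min, add_zero]
  have hm1 : mb / (1 + ρ) * N * q ≤ m / (1 + ρ) * N * q := by gcongr
  have hm2 : multUpper ρ * (m * (2 * ρ / (1 - ρ ^ 2)) * ((1 + N) / 2) * q)
      ≤ multUpper ρ * (ma * (2 * ρ / (1 - ρ ^ 2)) * ((1 + N) / 2) * q) := by gcongr
  have hm3 : k * q * (mb * ((1 - ρ) / (1 + ρ)) - A) ≤ k * q * (m * ((1 - ρ) / (1 + ρ)) - A) := by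
    gcongr
  generalize multUpper ρ = k' at *
  generalize 2 * ρ * (1 + ρ) / ((1 - ρ) * (1 + 4 * ρ + ρ ^ 2)) = dm at *
  generalize ((1 + ρ) ^ 2 + 4 * ρ) / (1 - ρ) ^ 2 = β at *
  generalize max κ 0 / ((1 + ρ) / (1 - ρ) + dm) = a at *
  generalize (1 - ρ) / (1 + ρ) = δ0 at *
  generalize 2 * ρ / (1 - ρ ^ 2) = r at *
  generalize min κ 0 = κ' at *
  generalize (ma * k') ^ 2 * dm / (2 * ν) = b at *
  generalize mb / (1 + ρ) = μ at *
  have hf1 := affine_nonneg (x := 1) (y := N') (t := N)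
    (α := a - ma * k' * r / 2 - b + f * (mb * δ0 - A)) (β := μ + κ' * β - ma * k' * r / 2)
    (by linarith) (by linarith) hN1 hNN
  have hf2 := affine_nonneg (x := 1) (y := N') (t := N)
    (α := a - ma * k' * r / 2 - b + k' * (mb * δ0 - A)) (β := μ + κ' * β - ma * k' * r / 2)
    (by linarith) (by linarith) hN1 hNN
  have hf3 := affine_nonneg (x := f) (y := k') (t := k)
    (α := a - ma * k' * r / 2 - b + (μ + κ' * β - ma * k' * r / 2) * N) (β := mb * δ0 - A)
    (by linarith) (by linarith) hf hk
  have hf4 := mul_nonneg hf3 hq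
  linarith

/-- `contactForm` is nonnegative if this holds at the upper and at one lower bound of the
multiplier. -/
theorem contactForm_nonneg (h : IsContact ρ W σ C T K p δ q g d) (h0 : 0 < ρ)
    (h1 : ρ ≤ 0.41422) {ℓ m mb ma A κ₁ ν₁ κ₂ ν₂ f k : ℝ} (hν₁ : 0 < ν₁) (hν₂ : 0 < ν₂)
    (hmb : 0 ≤ mb) (hm : mb ≤ m) (hma : m ≤ ma)
    (hf : f ≤ k) (hk : k ≤ K) (hk0 : 0 ≤ k) (hK : K ≤ multUpper ρ)
    (hG₁ : GrowthBounds ρ κ₁ ν₁ mb ma A (multUpper ρ)) (hG₂ : GrowthBounds ρ κ₂ ν₂ mb ma A f)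
    (hc₁ : 0 ≤ coreForm ρ ℓ σ C T (multUpper ρ) p δ - κ₁ * (p + T * δ) - ν₁ * T ^ 2)
    (hc₂ : 0 ≤ coreForm ρ ℓ σ C T k p δ - κ₂ * (p + T * δ) - ν₂ * T ^ 2) :
    0 ≤ contactForm ρ ℓ σ C m A T K p δ q g := by
  have g1 := h.growth_nonneg h0 h1 hν₁ hmb hm hma le_rfl le_rfl (hk0.trans (hk.trans hK)) hG₁
  have g2 := h.growth_nonneg h0 h1 hν₂ hmb hm hma hf (hk.trans hK) hk0 hG₂
  have hm0 := hmb.trans hm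
  have hq := h.q_nonneg
  have hK0 := h.K_pos
  have hρ2 : 0 < 1 - ρ ^ 2 := by nlinarith
  have e1 : K * (m * (2 * ρ / (1 - ρ ^ 2)) * (1 + T ^ 2 / 2) * q)
      ≤ multUpper ρ * (m * (2 * ρ / (1 - ρ ^ 2)) * (1 + T ^ 2 / 2) * q) := by gcongr
  have e2 : K * (m * |T * g|) ≤ multUpper ρ * (m * |T * g|) := by gcongr
  have e3 : -(K * (m * |T * g|)) ≤ m * K * T * g := by
    have : 0 ≤ m * K * (|T * g| + T * g) :=
      mul_nonneg (by positivity) (by linarith [neg_abs_le (T * g)])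
    linarith
  rw [coreForm] at hc₁ hc₂
  rw [contactForm]
  generalize 4 * ρ ^ 2 / (1 - ρ ^ 2) ^ 2 = a₁ at *
  generalize (1 + ρ ^ 2) / (1 - ρ) ^ 2 = a₂ at *
  generalize ρ / (1 - ρ) ^ 2 = a₃ at *
  generalize 2 * ρ / (1 - ρ ^ 2) = r at *
  generalize (1 - ρ) / (1 + ρ) = δ0 at *
  generalize m / (1 + ρ) = μ at *
  generalize multUpper ρ = k' at *
  have hf := affine_nonneg (x := k) (y := k') (t := K)
    (α := T ^ 2 + p + (T - δ) * σ - ℓ * (1 + a₁) * (p + T * δ) + ℓ * a₂ * σ * (δ - T * p)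
      - ℓ * a₃ * σ ^ 2 * (1 + T ^ 2) + μ * (1 + T ^ 2) * q
      - k' * (m * r * (1 + T ^ 2 / 2) * q) - k' * (m * |T * g|))
    (β := C - T * σ + q * (m * δ0 - A)) (by linarith) (by linarith) hk hK
  linarith

end IsContact

/-! ### Annuli between `1 / 100` and `1 / 3` -/

/-- The inequalities that make `contactForm` nonnegative on the annulus `ρa < |z| ≤ ρb`, for a
correction that increases from `mb` to `ma` inwards and for `0 ≤ ℓ ≤ L`. The parameters `κ₁, ν₁`
belong to the upper bound of the multiplier, `κ₂, ν₂, θ` to the lower one. -/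
def RowBound {F : Type*} [Field F] [LinearOrder F]
    (ρb ρa mb ma L κ₁ ν₁ κ₂ ν₂ θ : F) : Prop :=
  (0 < ρa ∧ ρa < ρb ∧ ρb ≤ 1 / 3 ∧ 0 ≤ mb ∧ mb ≤ ma ∧ 0 < ν₁ ∧ 0 < ν₂) ∧
  GrowthBounds ρb κ₁ ν₁ mb ma ((ma - mb) / (ρb - ρa) * ρb) (multUpper ρb) ∧
  ((FormSlope ρb (multUpper ρb) κ₁ ν₁ 0 (slopeBound ρb) ∧
      FormSlope ρb (multUpper ρb) κ₁ ν₁ L (slopeBound ρb)) ∨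
    (FormUnit ρb (multUpper ρb) κ₁ ν₁ 0 ∧ FormUnit ρb (multUpper ρb) κ₁ ν₁ L)) ∧
  ((0 ≤ multLower ρb ∧
      GrowthBounds ρb κ₂ ν₂ mb ma ((ma - mb) / (ρb - ρa) * ρb) (multLower ρb) ∧
      FormSlope ρb (multLower ρb) κ₂ ν₂ 0 (slopeBound ρb) ∧
      FormSlope ρb (multLower ρb) κ₂ ν₂ L (slopeBound ρb)) ∨
    (0 < θ ∧ GrowthBounds ρb κ₂ ν₂ mb ma ((ma - mb) / (ρb - ρa) * ρb) 0 ∧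
      FormTilt ρb (1 - distBound ρb) κ₂ ν₂ 0 θ ∧ FormTilt ρb (1 - distBound ρb) κ₂ ν₂ L θ))

section Decidable

variable {F : Type*} [Field F] [LinearOrder F]

instance (ρ k κ ν ℓ Tm : F) : Decidable (FormSlope ρ k κ ν ℓ Tm) :=
  inferInstanceAs (Decidable (_ ∧ _))

instance (ρ k κ ν ℓ : F) : Decidable (FormUnit ρ k κ ν ℓ) :=
  inferInstanceAs (Decidable (_ ∧ _))

instance (ρ k κ ν ℓ θ : F) : Decidable (FormTilt ρ k κ ν ℓ θ) :=
  inferInstanceAs (Decidable (_ ∧ _))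

instance (ρ κ ν mb ma A f N : F) : Decidable (GrowthBound ρ κ ν mb ma A f N) :=
  inferInstanceAs (Decidable (_ ≤ _))

instance (ρ κ ν mb ma A f : F) : Decidable (GrowthBounds ρ κ ν mb ma A f) :=
  inferInstanceAs (Decidable (_ ∧ _))

instance (ρb ρa mb ma L κ₁ ν₁ κ₂ ν₂ θ : F) :
    Decidable (RowBound ρb ρa mb ma L κ₁ ν₁ κ₂ ν₂ θ) :=
  inferInstanceAs (Decidable (_ ∧ _))

end Decidable

section Cast

theorem distBound_cast (ρ : ℚ) : ((distBound ρ : ℚ) : ℝ) = distBound (ρ : ℝ) := by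
  simp [distBound]

theorem slopeBound_cast (ρ : ℚ) : ((slopeBound ρ : ℚ) : ℝ) = slopeBound (ρ : ℝ) := by
  simp [slopeBound, distBound]

theorem multUpper_cast (ρ : ℚ) : ((multUpper ρ : ℚ) : ℝ) = multUpper (ρ : ℝ) := by
  simp [multUpper, distBound]

theorem multLower_cast (ρ : ℚ) : ((multLower ρ : ℚ) : ℝ) = multLower (ρ : ℝ) := by
  simp [multLower, slopeBound_cast, distBound]

theorem formSlope_cast {ρ k κ ν ℓ Tm : ℚ} (h : FormSlope ρ k κ ν ℓ Tm) :
    FormSlope (ρ : ℝ) k κ ν ℓ Tm := by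
  simp only [FormSlope] at h ⊢
  exact_mod_cast h

theorem formUnit_cast {ρ k κ ν ℓ : ℚ} (h : FormUnit ρ k κ ν ℓ) :
    FormUnit (ρ : ℝ) k κ ν ℓ := by
  simp only [FormUnit] at h ⊢
  exact_mod_cast h

theorem formTilt_cast {ρ k κ ν ℓ θ : ℚ} (h : FormTilt ρ k κ ν ℓ θ) :
    FormTilt (ρ : ℝ) k κ ν ℓ θ := by
  simp only [FormTilt, ← Rat.cast_lt (K := ℝ), ← Rat.cast_le (K := ℝ)] at h ⊢
  push_cast at h
  exact h

theorem growthBound_cast {ρ κ ν mb ma A f N : ℚ} (h : GrowthBound ρ κ ν mb ma A f N) :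
    GrowthBound (ρ : ℝ) κ ν mb ma A f N := by
  simp only [GrowthBound, ← multUpper_cast] at h ⊢
  exact_mod_cast h

theorem growthBounds_cast {ρ κ ν mb ma A f : ℚ} (h : GrowthBounds ρ κ ν mb ma A f) :
    GrowthBounds (ρ : ℝ) κ ν mb ma A f := by
  obtain ⟨h1, h2, h3, h4⟩ := h
  refine ⟨?_, ?_, ?_, ?_⟩
  · exact_mod_cast growthBound_cast h1
  · have := growthBound_cast h2
    push_cast [slopeBound_cast] at this
    exact this
  · have := growthBound_cast h3
    push_cast [multUpper_cast] at this
    exact this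
  · have := growthBound_cast h4
    push_cast [slopeBound_cast, multUpper_cast] at this
    exact this

theorem rowBound_cast {ρb ρa mb ma L κ₁ ν₁ κ₂ ν₂ θ : ℚ}
    (h : RowBound ρb ρa mb ma L κ₁ ν₁ κ₂ ν₂ θ) :
    RowBound (ρb : ℝ) ρa mb ma L κ₁ ν₁ κ₂ ν₂ θ := by
  obtain ⟨h1, h2, h3, h4⟩ := h
  simp only [← Rat.cast_lt (K := ℝ), ← Rat.cast_le (K := ℝ)] at h1
  push_cast at h1
  refine ⟨h1, ?_, h3.imp (fun h => ⟨?_, ?_⟩) (fun h => ⟨?_, ?_⟩),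
    h4.imp (fun h => ⟨?_, ?_, ?_, ?_⟩) (fun h => ⟨by exact_mod_cast h.1, ?_, ?_, ?_⟩)⟩
  · simpa [multUpper_cast] using growthBounds_cast h2
  · simpa [multUpper_cast, slopeBound_cast] using formSlope_cast h.1
  · simpa [multUpper_cast, slopeBound_cast] using formSlope_cast h.2
  · simpa [multUpper_cast] using formUnit_cast h.1
  · simpa [multUpper_cast] using formUnit_cast h.2
  · rw [← multLower_cast]
    exact_mod_cast h.1
  · simpa [multLower_cast] using growthBounds_cast h.2.1
  · simpa [multLower_cast, slopeBound_cast] using formSlope_cast h.2.2.1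
  · simpa [multLower_cast, slopeBound_cast] using formSlope_cast h.2.2.2
  · simpa using growthBounds_cast h.2.1
  · simpa [distBound_cast] using formTilt_cast h.2.2.1
  · simpa [distBound_cast] using formTilt_cast h.2.2.2

end Cast

/-- The form is affine in `ℓ`. -/
theorem coreForm_nonneg_of_ends {ρ ℓ L σ C T k p δ κ ν : ℝ} (h0 : 0 ≤ ℓ) (hL : ℓ ≤ L)
    (h1 : 0 ≤ coreForm ρ 0 σ C T k p δ - κ * (p + T * δ) - ν * T ^ 2)
    (h2 : 0 ≤ coreForm ρ L σ C T k p δ - κ * (p + T * δ) - ν * T ^ 2) :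
    0 ≤ coreForm ρ ℓ σ C T k p δ - κ * (p + T * δ) - ν * T ^ 2 := by
  rw [coreForm] at *
  have := affine_nonneg (x := 0) (y := L) (t := ℓ)
    (α := T ^ 2 + p + k * (C - T * σ) + (T - δ) * σ - κ * (p + T * δ) - ν * T ^ 2)
    (β := -((1 + 4 * ρ ^ 2 / (1 - ρ ^ 2) ^ 2) * (p + T * δ))
      + ((1 + ρ ^ 2) / (1 - ρ) ^ 2) * σ * (δ - T * p)
      - (ρ / (1 - ρ) ^ 2) * σ ^ 2 * (1 + T ^ 2)) (by linarith) (by linarith) h0 hL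
  linarith

/-- The multiplier `K` lies between `multLower` or `(1 - u) (1 - p)` and `multUpper`, and
`contactForm` is affine in it. -/
theorem RowBound.contactForm_nonneg {ρb ρa mb ma L κ₁ ν₁ κ₂ ν₂ θ : ℝ}
    (hrow : RowBound ρb ρa mb ma L κ₁ ν₁ κ₂ ν₂ θ) {ℓ m W σ C T K p δ q g d : ℝ} (hℓ : 0 ≤ ℓ)
    (hL : ℓ ≤ L) (hmb : mb ≤ m) (hma : m ≤ ma) (h : IsContact ρb W σ C T K p δ q g d) :
    0 ≤ contactForm ρb ℓ σ C m ((ma - mb) / (ρb - ρa) * ρb) T K p δ q g := by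
  obtain ⟨⟨hρ0, hρ1, hρ2, hm0, -, hν₁, hν₂⟩, hG₁, hF₁, hF₂⟩ := hrow
  have h0 : 0 < ρb := hρ0.trans hρ1
  have h1 : ρb ≤ 0.41422 := by linarith
  have hu : distBound ρb < 1 := by
    have : ρb ^ 3 ≤ (1 / 3) ^ 3 := by gcongr
    rw [distBound]
    linarith
  have hT := h.abs_T_le h0 h1
  have hK := h.K_le_multUpper h0 hρ2
  have hk := h.K_pos.le.trans hK
  have hX : 0 ≤ (1 - distBound ρb) * (1 - p) :=
    mul_nonneg (by linarith) (by linarith [h.p_lt_one])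
  have hc₁ : 0 ≤ coreForm ρb ℓ σ C T (multUpper ρb) p δ - κ₁ * (p + T * δ) - ν₁ * T ^ 2 := by
    rcases hF₁ with ⟨f0, f1⟩ | ⟨f0, f1⟩
    · exact coreForm_nonneg_of_ends hℓ hL
        (core_nonneg_of_formSlope h0 (by linarith) hk le_rfl h.unit h.disc hT f0)
        (core_nonneg_of_formSlope h0 (by linarith) hk (hℓ.trans hL) h.unit h.disc hT f1)
    · exact coreForm_nonneg_of_ends hℓ hL
        (core_nonneg_of_formUnit h0 hk h.unit h.disc f0)
        (core_nonneg_of_formUnit h0 hk h.unit h.disc f1)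
  rcases hF₂ with ⟨hk0, hG₂, f0, f1⟩ | ⟨hθ, hG₂, f0, f1⟩
  · refine h.contactForm_nonneg h0 h1 hν₁ hν₂ hm0 hmb hma le_rfl
      ((h.multLower_le h0 h1 hu).trans (h.le_K h0 hu)) hk0 hK hG₁ hG₂ hc₁ ?_
    exact coreForm_nonneg_of_ends hℓ hL
        (core_nonneg_of_formSlope h0 (by linarith) hk0 le_rfl h.unit h.disc hT f0)
        (core_nonneg_of_formSlope h0 (by linarith) hk0 (hℓ.trans hL) h.unit h.disc hT f1)
  · refine h.contactForm_nonneg h0 h1 hν₁ hν₂ hm0 hmb hma hX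
      (h.le_K h0 hu) hX hK hG₁ hG₂ hc₁ ?_
    exact coreForm_nonneg_of_ends hℓ hL
        (core_nonneg_of_formTilt h0 (by linarith) hθ h.unit h.disc f0)
        (core_nonneg_of_formTilt h0 (by linarith) hθ h.unit h.disc f1)

/-- The inner end `ρ` of an annulus, the correction `m` there, a bound `L` of the weight, and the
parameters of `RowBound`. -/
structure Row where
  ρ : ℚ
  m : ℚ
  L : ℚ
  κ₁ : ℚ
  ν₁ : ℚ
  κ₂ : ℚ
  ν₂ : ℚ
  θ : ℚ

/-- A list of annuli, from the radius `ρ` inwards to the radius `1 / 100`, on each of which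
`RowBound` holds. -/
def RowChain : ℚ → ℚ → ℚ → List Row → Prop
  | ρ, m, _, [] => ρ = 1 / 100 ∧ 9 / 10 ≤ m
  | ρ, m, L, s :: l =>
    (RowBound ρ s.ρ m s.m s.L s.κ₁ s.ν₁ s.κ₂ s.ν₂ s.θ ∧ L + (ρ / s.ρ - s.ρ / ρ) / 4 ≤ s.L) ∧
      RowChain s.ρ s.m s.L l

instance RowChain.decidable : ∀ ρ m L l, Decidable (RowChain ρ m L l)
  | _, _, _, [] => inferInstanceAs (Decidable (_ ∧ _))
  | _, _, _, s :: l =>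
    have := RowChain.decidable s.ρ s.m s.L l
    inferInstanceAs (Decidable (_ ∧ _))

/-- The annuli between the radii `1 / 100` and `1 / 3`; the correction grows from `0` inwards. -/
def rowTable : List Row := [
  ⟨1587/5000, 1/625, 673/5000, 493/2500, 1/100, 1817/5000, 1/100, 2/5⟩,
  ⟨1511/5000, 37/10000, 199/1250, 2287/10000, 1/100, 3661/10000, 1/50, 2/5⟩,
  ⟨1439/5000, 61/10000, 1837/10000, 481/2000, 1/100, 3679/10000, 1/50, 2/5⟩,
  ⟨137/500, 11/1250, 2083/10000, 481/2000, 1/50, 1817/5000, 1/20, 2/5⟩,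
  ⟨2609/10000, 117/10000, 2329/10000, 2449/10000, 1/50, 3453/10000, 1/10, 2/5⟩,
  ⟨621/2500, 149/10000, 103/400, 309/1250, 1/50, 3247/10000, 1/5, 2/5⟩,
  ⟨473/2000, 183/10000, 2821/10000, 2477/10000, 1/50, 611/2000, 1/5, 2/5⟩,
  ⟨563/2500, 11/500, 1533/5000, 93/400, 1/20, 23/80, 1/5, 2/5⟩,
  ⟨134/625, 261/10000, 207/625, 601/2500, 1/20, 1351/5000, 3/10, 2/5⟩,
  ⟨2041/10000, 307/10000, 3559/10000, 1259/5000, 1/20, 317/1250, 3/10, 2/5⟩,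
  ⟨1943/10000, 179/5000, 1903/5000, 162/625, 1/20, 539/2000, 1/20, 1/5⟩,
  ⟨37/200, 207/5000, 1013/2500, 2633/10000, 1/20, 133/500, 1/20, 1/5⟩,
  ⟨1761/10000, 237/5000, 4299/10000, 1261/5000, 1/10, 1249/5000, 1/10, 1/5⟩,
  ⟨1677/10000, 67/1250, 284/625, 63/250, 1/10, 1171/5000, 1/10, 1/5⟩,
  ⟨1597/10000, 3/50, 4789/10000, 1247/5000, 1/10, 2187/10000, 1/10, 1/5⟩,
  ⟨19/125, 669/10000, 5037/10000, 1223/5000, 1/10, 203/1000, 1/5, 1/5⟩,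
  ⟨1447/10000, 37/500, 1321/2500, 1191/5000, 1/10, 3/16, 1/5, 1/5⟩,
  ⟨689/5000, 407/5000, 5529/10000, 2303/10000, 1/10, 861/5000, 1/5, 1/5⟩,
  ⟨82/625, 223/2500, 231/400, 138/625, 1/10, 1567/10000, 3/10, 1/5⟩,
  ⟨1249/10000, 973/10000, 3011/5000, 2099/10000, 1/10, 1411/10000, 3/10, 1/5⟩,
  ⟨1189/10000, 1057/10000, 6269/10000, 1979/10000, 1/10, 627/5000, 3/10, 1/5⟩,
  ⟨283/2500, 1149/10000, 1303/2000, 847/5000, 1/5, 19/125, 1/10, 0⟩,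
  ⟨539/5000, 78/625, 169/250, 391/2500, 1/5, 757/5000, 1/10, 0⟩,
  ⟨513/5000, 677/5000, 438/625, 1421/10000, 1/5, 1409/10000, 1/10, 0⟩,
  ⟨977/10000, 1463/10000, 7253/10000, 1273/10000, 1/5, 127/1000, 1/10, 0⟩,
  ⟨93/1000, 789/5000, 3/4, 223/2000, 1/5, 921/10000, 1/5, 0⟩,
  ⟨177/2000, 1699/10000, 7749/10000, 947/10000, 1/5, 759/10000, 1/5, 0⟩,
  ⟨421/5000, 73/400, 7999/10000, 193/2500, 1/5, 117/2000, 1/5, 0⟩,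
  ⟨801/10000, 1957/10000, 8249/10000, 37/625, 1/5, 101/2500, 1/5, 0⟩,
  ⟨381/5000, 1047/5000, 8499/10000, 81/2000, 1/5, 217/10000, 1/5, 0⟩,
  ⟨29/400, 559/2500, 2187/2500, 43/2000, 1/5, 13/5000, 1/5, 0⟩,
  ⟨69/1000, 2377/10000, 2249/2500, 1/500, 1/5, -169/10000, 1/5, 0⟩,
  ⟨657/10000, 629/2500, 4621/5000, -177/10000, 1/5, -73/2000, 1/5, 0⟩,
  ⟨1/16, 166/625, 2373/2500, -383/10000, 1/5, -569/10000, 1/5, 0⟩,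
  ⟨119/2000, 1397/5000, 9739/10000, -587/10000, 1/5, -193/2500, 1/5, 0⟩,
  ⟨283/5000, 2933/10000, 9989/10000, -799/10000, 1/5, -491/5000, 1/5, 0⟩,
  ⟨539/10000, 307/1000, 5117/5000, -63/625, 1/5, -593/5000, 1/5, 0⟩,
  ⟨513/10000, 401/1250, 5241/5000, -153/1250, 1/5, -1399/10000, 1/5, 0⟩,
  ⟨61/1250, 837/2500, 2683/2500, -361/2500, 1/5, -807/5000, 1/5, 0⟩,
  ⟨29/625, 218/625, 2197/2000, -349/2000, 3/10, -367/2000, 1/5, 0⟩,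
  ⟨441/10000, 907/2500, 281/250, -197/1000, 3/10, -1029/5000, 1/5, 0⟩,
  ⟨419/10000, 471/1250, 1437/1250, -1099/5000, 3/10, -571/2500, 1/5, 0⟩,
  ⟨399/10000, 3903/10000, 11741/10000, -151/625, 3/10, -2499/10000, 1/5, 0⟩,
  ⟨19/500, 4039/10000, 5993/5000, -2637/10000, 3/10, -7/25, 3/10, 0⟩,
  ⟨361/10000, 2091/5000, 12243/10000, -2873/10000, 3/10, -3029/10000, 3/10, 0⟩,
  ⟨343/10000, 2163/5000, 12499/10000, -777/2500, 3/10, -3257/10000, 3/10, 0⟩,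
  ⟨163/5000, 559/1250, 6377/5000, -1671/5000, 3/10, -697/2000, 3/10, 0⟩,
  ⟨31/1000, 231/500, 6503/5000, -143/400, 3/10, -3711/10000, 3/10, 0⟩,
  ⟨59/2000, 4769/10000, 2651/2000, -3807/10000, 3/10, -246/625, 3/10, 0⟩,
  ⟨2809/100000, 123/250, 27/20, -1009/2500, 3/10, -2079/5000, 3/10, 0⟩,
  ⟨107/4000, 203/400, 2749/2000, -853/2000, 3/10, -2191/5000, 3/10, 0⟩,
  ⟨2547/100000, 1047/2000, 13991/10000, -4497/10000, 3/10, -288/625, 3/10, 0⟩,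
  ⟨97/4000, 5401/10000, 14237/10000, -473/1000, 3/10, -967/2000, 3/10, 0⟩,
  ⟨2309/100000, 1393/2500, 14483/10000, -4963/10000, 3/10, -2531/5000, 3/10, 0⟩,
  ⟨2199/100000, 5749/10000, 1841/1250, -1299/2500, 3/10, -529/1000, 3/10, 0⟩,
  ⟨1047/50000, 5933/10000, 14973/10000, -5429/10000, 3/10, -2759/5000, 3/10, 0⟩,
  ⟨997/50000, 49/80, 7609/5000, -5663/10000, 3/10, -5747/10000, 3/10, 0⟩,
  ⟨1899/100000, 253/400, 15463/10000, -5897/10000, 3/10, -5977/10000, 3/10, 0⟩,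
  ⟨113/6250, 817/1250, 15709/10000, -6133/10000, 3/10, -388/625, 3/10, 0⟩,
  ⟨1721/100000, 3379/5000, 3989/2500, -637/1000, 3/10, -6441/10000, 3/10, 0⟩,
  ⟨1639/100000, 6989/10000, 16201/10000, -3303/5000, 3/10, -417/625, 3/10, 0⟩,
  ⟨39/2500, 1447/2000, 16449/10000, -1369/2000, 3/10, -6907/10000, 3/10, 0⟩,
  ⟨297/20000, 3747/5000, 2087/1250, -7083/10000, 3/10, -3571/5000, 3/10, 0⟩,
  ⟨707/50000, 7767/10000, 8471/5000, -183/250, 3/10, -461/625, 3/10, 0⟩,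
  ⟨673/50000, 4029/5000, 17189/10000, -7559/10000, 3/10, -7611/10000, 3/10, 0⟩,
  ⟨1281/100000, 523/625, 17437/10000, -7799/10000, 3/10, -981/1250, 3/10, 0⟩,
  ⟨61/5000, 8693/10000, 8841/5000, -2009/2500, 3/10, -4041/5000, 3/10, 0⟩,
  ⟨1161/100000, 2261/2500, 1793/1000, -2069/2500, 3/10, -104/125, 3/10, 0⟩,
  ⟨221/20000, 4709/5000, 9089/5000, -8517/10000, 3/10, -8557/10000, 3/10, 0⟩,
  ⟨263/25000, 1227/1250, 2303/1250, -2189/2500, 3/10, -8793/10000, 3/10, 0⟩,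
  ⟨1001/100000, 1277/1250, 18673/10000, -4499/5000, 3/10, -9033/10000, 3/10, 0⟩,
  ⟨1/100, 409/400, 18679/10000, -2247/2500, 3/10, -9019/10000, 3/10, 0⟩]

/-- Finitely many inequalities between rational numbers, evaluated by the kernel. -/
theorem rowChain_rowTable : RowChain (1 / 3) 0 (11 / 100) rowTable := by
  decide +kernel

/-! ### Annuli between `1 / 3` and `√2 - 1`, and propagation along annuli -/

/-- Conditions for the nonnegativity of the reduced form with multiplier `k + η T²`; `Tm` bounds
`|T|`, and `t₀` is the slope at which the cubic term `T³ σ` is linearised. -/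
def FormCubic {F : Type*} [Field F] [LinearOrder F] (ρ k η ℓ Tm t₀ : F) : Prop :=
  let s := 1 - ℓ * (1 + 4 * ρ ^ 2 / (1 - ρ ^ 2) ^ 2)
  let c₀ := ρ / (s * (1 + ρ) ^ 2)
  let l₂ := ℓ * ((1 + ρ ^ 2) / (1 - ρ) ^ 2)
  let l₃ := ℓ * (ρ / (1 - ρ) ^ 2)
  let a := 1 - c₀ - η * Tm
  let b := k - 1 + 2 * c₀ * (1 - l₂) - 2 * η * Tm * t₀
  let c := k / 2 - l₃ - c₀ * (1 - l₂) ^ 2 - η * Tm * t₀ ^ 2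
  let a' := a - (l₃ + c₀ * l₂ ^ 2) - 2 * t₀ * η + η / 2
  0 < s ∧ 0 < a ∧ b ^ 2 ≤ 4 * a * c ∧
    0 < a' ∧ (b - η * t₀ ^ 2) ^ 2 ≤ 4 * a' * (c + k / 8)

theorem core_nonneg_of_formCubic {ρ ℓ σ C T k p δ η Tm t₀ : ℝ} (hρ : 0 < ρ) (hk : 0 ≤ k)
    (hη : 0 ≤ η) (hC : σ ^ 2 + C ^ 2 = 2 * C) (hT : |T| ≤ Tm)
    (hd : (1 + ρ) ^ 2 * (p ^ 2 + δ ^ 2) ≤ 4 * ρ * (p + T * δ)) (h : FormCubic ρ k η ℓ Tm t₀) :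
    0 ≤ coreForm ρ ℓ σ C T (k + η * T ^ 2) p δ := by
  obtain ⟨hs, ha, hb, ha', hb'⟩ := h
  have hs' : 0 < 1 - ℓ * (1 + 4 * ρ ^ 2 / (1 - ρ ^ 2) ^ 2) - 0 := by rwa [sub_zero]
  have hr := core_reduce (e := 0) (κ := 0) (l₂ := ℓ * ((1 + ρ ^ 2) / (1 - ρ) ^ 2))
    (l₃ := ℓ * (ρ / (1 - ρ) ^ 2)) (σ := σ) hρ hs' (c₀_spec hρ hs') hd
  rw [sub_zero] at hr
  rw [coreForm]
  generalize ρ / ((1 - ℓ * (1 + 4 * ρ ^ 2 / (1 - ρ ^ 2) ^ 2)) * (1 + ρ) ^ 2) = c₀ at *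
  generalize ℓ * ((1 + ρ ^ 2) / (1 - ρ) ^ 2) = l₂ at *
  generalize ℓ * (ρ / (1 - ρ) ^ 2) = l₃ at *
  obtain ⟨h0, h1, h2⟩ := unit_bounds hC
  have h3 := mul_le_mul_of_nonneg_left h1 hk
  have h4 : η * T ^ 2 * (σ ^ 2 / 2) ≤ η * T ^ 2 * C := by gcongr
  have h5 : |T * σ| ≤ Tm := by
    rw [abs_mul]
    have : |σ| ≤ 1 := (sq_le_one_iff_abs_le_one σ).1 h2
    exact (mul_le_of_le_one_right (abs_nonneg T) this).trans hT
  have h6 : η * (T * σ * (T - t₀ * σ) ^ 2) ≤ η * (Tm * (T - t₀ * σ) ^ 2) := by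
    have := (le_abs_self _).trans h5
    gcongr
  have hf0 := form_nonneg ha hb T σ
  have hf1 := form_nonneg ha' hb' T σ
  have hf := affine_nonneg (t := σ ^ 2) (x := 0) (y := 1)
    (α := (1 - c₀ - η * Tm) * T ^ 2
      - (k - 1 + 2 * c₀ * (1 - l₂) - 2 * η * Tm * t₀) * (T * σ)
      + (k / 2 - l₃ - c₀ * (1 - l₂) ^ 2 - η * Tm * t₀ ^ 2) * σ ^ 2)
    (β := k / 8 * σ ^ 2 + η * t₀ ^ 2 * (T * σ)
      - ((l₃ + c₀ * l₂ ^ 2) + 2 * t₀ * η - η / 2) * T ^ 2) (by linarith) (by linarith)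
    (sq_nonneg σ) h2
  linarith

/-- The inequalities that make `contactForm` without correction nonnegative on the annulus
`ρa < |z| ≤ ρb`, where `1 - W ≤ v`. The weight is bounded by `log x ≤ (x - 1 / x) / 2`. -/
def OuterRowBound {F : Type*} [Field F] [LinearOrder F] (ρb ρa v η : F) : Prop :=
  let L := (41422 / 100000 / ρa - ρa / (41422 / 100000)) / 4
  let u := distBound ρb
  let k := (1 + u) / (1 - v)
  let β := (1 - u ^ 2) / (2 * u * (1 - v))
  (0 < ρa ∧ ρa < ρb ∧ ρb ≤ 41422 / 100000 ∧ 0 ≤ v ∧ v < 1 ∧ 0 ≤ η ∧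
    (ρb ≤ v ∨ 2 * (1 - 2 * ρa - ρa ^ 2) ≤ v ^ 2 * (1 - ρa ^ 2)) ∧
    (2 * β + k) ^ 2 ≤ 4 * (β + η) * (β + k * ((1 + ρb) ^ 2 / (4 * ρb)))) ∧
  FormCubic ρb k η 0 (slopeBound ρb) (11 / 10) ∧ FormCubic ρb k η L (slopeBound ρb) (11 / 10) ∧
  FormTilt ρb (1 - u) 0 0 0 (4 / 5) ∧ FormTilt ρb (1 - u) 0 0 L (4 / 5)

section Decidable

variable {F : Type*} [Field F] [LinearOrder F]

instance (ρ k η ℓ Tm t₀ : F) : Decidable (FormCubic ρ k η ℓ Tm t₀) :=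
  inferInstanceAs (Decidable (_ ∧ _))

instance (ρb ρa v η : F) : Decidable (OuterRowBound ρb ρa v η) :=
  inferInstanceAs (Decidable (_ ∧ _))

end Decidable

theorem formCubic_cast {ρ k η ℓ Tm t₀ : ℚ} (h : FormCubic ρ k η ℓ Tm t₀) :
    FormCubic (ρ : ℝ) k η ℓ Tm t₀ := by
  simp only [FormCubic, ← Rat.cast_lt (K := ℝ), ← Rat.cast_le (K := ℝ)] at h ⊢
  push_cast at h
  exact h

theorem outerRowBound_cast {ρb ρa v η : ℚ} (h : OuterRowBound ρb ρa v η) :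
    OuterRowBound (ρb : ℝ) ρa v η := by
  obtain ⟨h1, h2, h3, h4, h5⟩ := h
  simp only [← Rat.cast_lt (K := ℝ), ← Rat.cast_le (K := ℝ)] at h1
  push_cast [distBound_cast] at h1
  refine ⟨h1, ?_, ?_, ?_, ?_⟩
  · simpa [distBound_cast, slopeBound_cast] using formCubic_cast h2
  · simpa [distBound_cast, slopeBound_cast] using formCubic_cast h3
  · simpa [distBound_cast] using formTilt_cast h4
  · simpa [distBound_cast] using formTilt_cast h5

theorem OuterRowBound.contactForm_nonneg {ρb ρa v η : ℝ} (hrow : OuterRowBound ρb ρa v η)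
    {ρ ℓ W σ C T K p δ q g d : ℝ} (hρ : ρa ≤ ρ) (hρ1 : ρ < 1) (hℓ : 0 ≤ ℓ)
    (hL : ℓ ≤ (41422 / 100000 / ρa - ρa / (41422 / 100000)) / 4)
    (hW : (1 - W) ^ 2 * (1 - ρ ^ 2) ≤ 2 * (1 - 2 * ρ - ρ ^ 2))
    (h : IsContact ρb W σ C T K p δ q g d) :
    0 ≤ contactForm ρb ℓ σ C 0 0 T K p δ q g := by
  obtain ⟨⟨hρ0, hρab, hρ2, hv0, hv1, hη, hv, hd⟩, f0, f1, f2, f3⟩ := hrow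
  have h0 : 0 < ρb := hρ0.trans hρab
  have h1 : ρb ≤ 0.41422 := hρ2.trans (by norm_num)
  have hu0 : 0 < distBound ρb := by rw [distBound]; positivity
  have hu : distBound ρb < 1 := by
    have : ρb ^ 3 ≤ 0.41422 ^ 3 := by gcongr
    rw [distBound]
    linarith
  have hT := h.abs_T_le h0 h1
  have hvW : 1 - v ≤ W := by
    rcases hv with hv | hv
    · linarith [h.le_W]
    · have hρ3 : 0 < 1 - ρ ^ 2 := by nlinarith
      have h2 : (1 - W) ^ 2 * (1 - ρ ^ 2) * (1 - ρa ^ 2) ≤ v ^ 2 * (1 - ρa ^ 2) * (1 - ρ ^ 2) := by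
        have e1 := mul_le_mul_of_nonneg_right hW (by nlinarith : 0 ≤ 1 - ρa ^ 2)
        have e2 := mul_le_mul_of_nonneg_right hv hρ3.le
        have e3 : (1 - 2 * ρ - ρ ^ 2) * (1 - ρa ^ 2) ≤ (1 - 2 * ρa - ρa ^ 2) * (1 - ρ ^ 2) := by
          have e4 : 0 ≤ ρ * ρa := mul_nonneg (by linarith) hρ0.le
          linarith [mul_nonneg (sub_nonneg.2 hρ) e4]
        linarith
      have h3 : (1 - W) ^ 2 ≤ v ^ 2 := by
        have hρ4 : 0 < (1 - ρ ^ 2) * (1 - ρa ^ 2) := mul_pos hρ3 (by nlinarith)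
        refine le_of_mul_le_mul_right ?_ hρ4
        linarith
      linarith [abs_le_of_sq_le_sq' h3 hv0]
  have hK := h.K_le h0 hu (by linarith) hvW hη hd
  have hk : 0 ≤ (1 + distBound ρb) / (1 - v) := by
    have : 0 < 1 - v := by linarith
    positivity
  have hc₁ := coreForm_nonneg_of_ends (ρ := ρb) (σ := σ) (C := C) (T := T) (p := p) (δ := δ)
    (κ := 0) (ν := 0) hℓ hL
    (by simpa using core_nonneg_of_formCubic h0 hk hη h.unit hT h.disc f0)
    (by simpa using core_nonneg_of_formCubic h0 hk hη h.unit hT h.disc f1)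
  have hc₂ := coreForm_nonneg_of_ends (ρ := ρb) (σ := σ) (C := C) (T := T) (p := p) (δ := δ)
    (κ := 0) (ν := 0) hℓ hL
    (core_nonneg_of_formTilt h0 (by linarith) (by norm_num) h.unit h.disc f2)
    (core_nonneg_of_formTilt h0 (by linarith) (by norm_num) h.unit h.disc f3)
  rw [coreForm] at hc₁ hc₂
  rw [contactForm]
  have := affine_nonneg (x := (1 - distBound ρb) * (1 - p))
    (y := (1 + distBound ρb) / (1 - v) + η * T ^ 2) (t := K)
    (α := T ^ 2 + p + (T - δ) * σ - ℓ * (1 + 4 * ρb ^ 2 / (1 - ρb ^ 2) ^ 2) * (p + T * δ)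
      + ℓ * ((1 + ρb ^ 2) / (1 - ρb) ^ 2) * σ * (δ - T * p)
      - ℓ * (ρb / (1 - ρb) ^ 2) * σ ^ 2 * (1 + T ^ 2))
    (β := C - T * σ) (by linarith) (by linarith) (h.le_K h0 hu) hK
  simp only [zero_div, zero_mul, mul_zero, sub_zero, add_zero]
  linarith

/-- A list of annuli `(ρ, v, η)`, outwards from the radius `ρa` beyond `√2 - 1`, on each of which
`OuterRowBound` holds. -/
def OuterRowChain : ℚ → List (ℚ × ℚ × ℚ) → Prop
  | ρa, [] => 41422 / 100000 ≤ ρa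
  | ρa, s :: l => OuterRowBound s.1 ρa s.2.1 s.2.2 ∧ OuterRowChain s.1 l

instance OuterRowChain.decidable : ∀ ρa l, Decidable (OuterRowChain ρa l)
  | _, [] => inferInstanceAs (Decidable (_ ≤ _))
  | _, s :: l =>
    have := OuterRowChain.decidable s.1 l
    inferInstanceAs (Decidable (_ ∧ _))

/-- The annuli between the radii `1 / 3` and `√2 - 1`. The bound `v` of `1 - W` is the radius itself
up to `0.393`; beyond, `IsMajorant.sq_le` gives a better one. -/
def outerRowTable : List (ℚ × ℚ × ℚ) := [
  (36 / 100, 36 / 100, 14 / 1000),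
  (37 / 100, 37 / 100, 41 / 1000),
  (38 / 100, 38 / 100, 67 / 1000),
  (385 / 1000, 385 / 1000, 80 / 1000),
  (39 / 100, 39 / 100, 93 / 1000),
  (393 / 1000, 393 / 1000, 101 / 1000),
  (395 / 1000, 3754 / 10000, 103 / 1000),
  (40 / 100, 3577 / 10000, 111 / 1000),
  (41 / 100, 3087 / 10000, 124 / 1000),
  (41422 / 100000, 1692 / 10000, 110 / 1000)]

/-- Finitely many inequalities between rational numbers, evaluated by the kernel. -/
theorem outerRowChain_outerRowTable : OuterRowChain (1 / 3) outerRowTable := by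
  decide +kernel

theorem log_le_sub_inv_div_two {x : ℝ} (h : 1 ≤ x) : Real.log x ≤ (x - 1 / x) / 2 := by
  have h0 : 0 < x := by linarith
  have := Real.self_le_sinh_iff.2 (Real.log_nonneg h)
  rwa [Real.sinh_log h0, ← one_div] at this

variable {φ ω₁ ω₂ S v : ℂ → ℂ} {M : ℝ → ℝ}

/-- Positivity of the barrier without correction, from the radius `1 / 3` outwards. -/
theorem ConjSystem.barrier_pos_outer (hφ : IsRealConvex φ) (h : ConjSystem φ ω₁ ω₂ S v)
    (hM : IsMajorant φ M) {r ε : ℝ} {e : ℂ} (he : ‖e‖ = 1) (hr1 : r ≤ 0.41422)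
    (hMr : M r * (2 * r) ≤ 1 - r ^ 2) (hε : 0 < ε) :
    ∀ (l : List (ℚ × ℚ × ℚ)) (ρa : ℚ), OuterRowChain ρa l → (0 : ℝ) < ρa →
      (∀ z : ℂ, ‖z‖ = ρa → 0 < barrier φ ω₁ S v M r e ε 0 z) →
      ∀ z : ℂ, ρa ≤ ‖z‖ → ‖z‖ ≤ r → 0 < barrier φ ω₁ S v M r e ε 0 z := by
  intro l
  induction l with
  | nil =>
    intro ρa hc h0 hpos z hz0 hz1
    have hc' : 41422 / 100000 ≤ ρa := hc
    have : ((41422 / 100000 : ℚ) : ℝ) ≤ ρa := by exact_mod_cast hc'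
    push_cast at this
    exact hpos z (le_antisymm (by linarith) hz0)
  | cons s l ih =>
    intro ρa hc h0 hpos z hz0 hz1
    have hrow := outerRowBound_cast hc.1
    have key : ∀ z : ℂ, ρa ≤ ‖z‖ → ‖z‖ ≤ min (s.1 : ℝ) r →
        0 < barrier φ ω₁ S v M r e ε 0 z := by
      intro z hz0 hz1
      refine h.barrier_pos hφ hM (m := fun _ => 0) (m' := fun _ => 0) (R := fun _ => (s.1 : ℝ))
        (A := 0) he hr1 hMr h0 (min_le_right (s.1 : ℝ) r) hε
        (fun ρ _ _ => ⟨le_rfl, hasDerivAt_const _ _, by simp⟩)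
        (fun ρ _ hρ => ⟨hρ.trans (min_le_left _ _), hrow.1.2.2.1.trans (by norm_num)⟩) hpos ?_
        hz0 hz1
      intro ρ hρ0 hρ1 ℓ W σ C T K p δ q g d hℓ hℓr hW hcon
      have hρr := hρ1.trans (min_le_right _ _)
      have hρp : 0 < ρ := h0.trans hρ0
      refine hrow.contactForm_nonneg hρ0.le (by linarith) hℓ ?_ hW hcon
      have h2 : Real.log (r / ρ) ≤ Real.log (41422 / 100000 / ρa) := by
        refine Real.log_le_log (div_pos (by linarith) hρp) ?_
        gcongr
        linarith
      have h3 := log_le_sub_inv_div_two (x := 41422 / 100000 / (ρa : ℝ)) (by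
        rw [le_div_iff₀ h0]
        linarith)
      rw [one_div_div] at h3
      linarith
    rcases le_total ‖z‖ s.1 with hz | hz
    · exact key z hz0 (le_min hz hz1)
    · refine ih s.1 hc.2 (h0.trans hrow.1.2.1) (fun x hx => key x ?_ ?_) z hz hz1
      · rw [hx]
        exact hrow.1.2.1.le
      · rw [hx]
        exact le_min le_rfl (hz.trans hz1)

/-- Positivity of the barrier propagates outwards along a chain of annuli, on each of which the
correction is linear in `|z|`. -/
theorem ConjSystem.barrier_pos_of_rowChain (hφ : IsRealConvex φ) (h : ConjSystem φ ω₁ ω₂ S v)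
    (hM : IsMajorant φ M) {r ε : ℝ} {e : ℂ} (he : ‖e‖ = 1) (hr1 : r ≤ 0.41422)
    (hMr : M r * (2 * r) ≤ 1 - r ^ 2) (hε : 0 < ε)
    (hpos : ∀ z : ℂ, ‖z‖ = 1 / 100 → ∀ m, 9 / 10 ≤ m → 0 < barrier φ ω₁ S v M r e ε m z) :
    ∀ (l : List Row) (ρ m L : ℚ), RowChain ρ m L l → (0 : ℝ) < ρ → ρ ≤ r →
      Real.log (r / ρ) / 2 ≤ L →
      ∀ z : ℂ, ‖z‖ = ρ → 0 < barrier φ ω₁ S v M r e ε m z := by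
  intro l
  induction l with
  | nil =>
    rintro ρ m L ⟨h1, h2⟩ h0 hρr - z hz
    refine hpos z ?_ m ?_
    · rw [hz, h1]
      norm_num
    · have : ((9 / 10 : ℚ) : ℝ) ≤ m := by exact_mod_cast h2
      push_cast at this
      exact this
  | cons s l ih =>
    rintro ρb m L ⟨⟨h1, h2⟩, h3⟩ h0 hρr hL z hz
    have hrow := rowBound_cast h1
    obtain ⟨ha0, hab, hb3, hm0, hmm, -, -⟩ := hrow.1
    have hL2 : Real.log (r / s.ρ) / 2 ≤ s.L := by
      have h4 : Real.log (r / s.ρ) = Real.log (r / ρb) + Real.log (ρb / s.ρ) := by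
        rw [← Real.log_mul (div_pos (by linarith) h0).ne' (div_pos h0 ha0).ne']
        congr 1
        field_simp
      have h5 := log_le_sub_inv_div_two (x := (ρb : ℝ) / s.ρ) (by
        rw [le_div_iff₀ ha0]
        linarith)
      rw [one_div_div] at h5
      have h6 : ((L + (ρb / s.ρ - s.ρ / ρb) / 4 : ℚ) : ℝ) ≤ s.L := by exact_mod_cast h2
      push_cast at h6
      linarith
    have hin := ih s.ρ s.m s.L h3 ha0 (hab.le.trans hρr) hL2
    have hB : 0 ≤ ((s.m : ℝ) - m) / (ρb - s.ρ) := div_nonneg (by linarith) (by linarith)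
    have hBe : ((s.m : ℝ) - m) / (ρb - s.ρ) * (ρb - s.ρ) = s.m - m :=
      div_mul_cancel₀ _ (by linarith)
    have := h.barrier_pos hφ hM (r := r) (ρa := s.ρ) (ρb := ρb) (ε := ε) (e := e) (z := z)
      (m := fun x => m + ((s.m : ℝ) - m) / (ρb - s.ρ) * (ρb - x))
      (m' := fun _ => -(((s.m : ℝ) - m) / (ρb - s.ρ))) (R := fun _ => (ρb : ℝ))
      (A := ((s.m : ℝ) - m) / (ρb - s.ρ) * ρb) he hr1 hMr ha0 hρr hε
      (fun x hx0 hx1 => ⟨?_, ?_, ?_⟩) (fun x _ hx => ⟨hx, by linarith⟩) ?_ ?_ ?_ ?_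
    · simpa [hz] using this
    · have := mul_nonneg hB (sub_nonneg.2 hx1)
      linarith
    · have := (((hasDerivAt_id x).const_sub (ρb : ℝ)).const_mul
        (((s.m : ℝ) - m) / (ρb - s.ρ))).const_add (m : ℝ)
      simpa using this
    · have := mul_le_mul_of_nonneg_left hx1 hB
      linarith
    · intro x hx
      have := hin x hx
      simpa [hBe] using this
    · intro x hx0 hx1 ℓ W σ C T K p δ q g d hℓ hℓr hW hcon
      refine hrow.contactForm_nonneg hℓ ?_ ?_ ?_ hcon
      · have : Real.log (r / x) ≤ Real.log (r / s.ρ) := by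
          have hx : 0 < x := ha0.trans hx0
          refine Real.log_le_log (div_pos (by linarith) hx) ?_
          have : 0 < r := by linarith
          gcongr
        linarith
      · have := mul_nonneg hB (sub_nonneg.2 hx1)
        linarith
      · have := mul_le_mul_of_nonneg_left hx0.le hB
        linarith
    · rw [hz]
      exact hab.le
    · rw [hz]

/-! ### A neighbourhood of the centre -/

/-- Bounds of the constants near the centre. -/
theorem small_radius_bounds {ρ : ℝ} (h0 : 0 < ρ) (h1 : ρ ≤ 1 / 100) :
    (1 ≤ multUpper ρ ∧ multUpper ρ ≤ 1.0205) ∧ slopeBound ρ ^ 2 ≤ 0.001 ∧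
      0.95 ≤ multLower ρ ∧ distBound ρ ≤ 0.0101 := by
  have hu0 : 0 < distBound ρ := by rw [distBound]; positivity
  have hu1 : distBound ρ ≤ 0.0101 := by
    have : ρ ^ 3 ≤ (1 / 100) ^ 3 := by gcongr
    rw [distBound]
    linarith
  have hT : 0 ≤ slopeBound ρ ∧ slopeBound ρ ≤ 0.031 := by
    rw [slopeBound]
    generalize distBound ρ = u at *
    have h2 : u * (1 + 3 / 5 * u ^ 2) ≤ 0.0102 := by nlinarith
    have h3 : 0 < u * (1 + 3 / 5 * u ^ 2) := by positivity
    generalize u * (1 + 3 / 5 * u ^ 2) = t at *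
    have h4 : 0.99 ≤ 1 - ρ ^ 2 - 2 * ρ * t := by nlinarith
    have h5 : 0 ≤ 1 - ρ ^ 2 := by nlinarith
    constructor
    · exact div_nonneg (by positivity) (by linarith)
    · rw [div_le_iff₀ (by linarith)]
      nlinarith
  have hT2 : slopeBound ρ ^ 2 ≤ 0.001 := by nlinarith [hT.1, hT.2]
  refine ⟨⟨?_, ?_⟩, hT2, ?_, hu1⟩
  · rw [multUpper, le_div_iff₀ (by linarith)]
    linarith
  · rw [multUpper, div_le_iff₀ (by linarith)]
    linarith
  · rw [multLower]
    have h6 : 4 * ρ / (1 + ρ) ^ 2 ≤ 0.04 := by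
      rw [div_le_iff₀ (by positivity)]
      nlinarith
    have h7 : (1 + slopeBound ρ ^ 2 / 2) * (4 * ρ / (1 + ρ) ^ 2) ≤ 1.0005 * 0.0401 := by
      gcongr
      · linarith
      · linarith
    nlinarith

theorem small_radius_coeff {ρ : ℝ} (h0 : 0 < ρ) (h1 : ρ ≤ 1 / 100) :
    (0 ≤ (1 + ρ ^ 2) / (1 - ρ) ^ 2 ∧ (1 + ρ ^ 2) / (1 - ρ) ^ 2 ≤ 1.0205) ∧
    (0 ≤ ρ / (1 - ρ) ^ 2 ∧ ρ / (1 - ρ) ^ 2 ≤ 1.0205 * ρ) ∧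
    (0 ≤ 4 * ρ ^ 2 / (1 - ρ ^ 2) ^ 2 ∧ 4 * ρ ^ 2 / (1 - ρ ^ 2) ^ 2 ≤ 0.0005) := by
  have h2 : 0.9801 ≤ (1 - ρ) ^ 2 := by nlinarith
  have h3 : ρ ^ 2 ≤ 0.0001 := by nlinarith
  have h4 : 0.99 ≤ (1 - ρ ^ 2) ^ 2 := by nlinarith
  refine ⟨⟨by positivity, ?_⟩, ⟨by positivity, ?_⟩, ⟨by positivity, ?_⟩⟩
  · rw [div_le_iff₀ (by linarith)]
    linarith
  · rw [div_le_iff₀ (by linarith)]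
    nlinarith
  · rw [div_le_iff₀ (by linarith)]
    linarith

/-- The value of `κ` makes `1 - l₁ - κ = 4 ρ (1 + ℓ²)` in `core_reduce`, so that
`c₀ = 1 / (4 (1 + ℓ²))` is admissible there and the terms with `c₀ ℓ²` stay bounded. -/
theorem core_nonneg_of_small_radius {ρ ℓ σ C T k p δ : ℝ} (h0 : 0 < ρ) (h1 : ρ ≤ 1 / 100)
    (hℓ : 0 ≤ ℓ) (hρℓ : ρ * ℓ ≤ 0.0188) (hk : 0.95 ≤ k) (hk1 : k ≤ 1.0205)
    (hC : σ ^ 2 + C ^ 2 = 2 * C)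
    (hd : (1 + ρ) ^ 2 * (p ^ 2 + δ ^ 2) ≤ 4 * ρ * (p + T * δ)) :
    0 ≤ coreForm ρ ℓ σ C T k p δ
      - (1 - ℓ * (1 + 4 * ρ ^ 2 / (1 - ρ ^ 2) ^ 2) - 4 * ρ * (1 + ℓ ^ 2)) * (p + T * δ)
      - 0.3 * T ^ 2 := by
  obtain ⟨⟨hA0, hA1⟩, ⟨hB0, hB1⟩, -⟩ := small_radius_coeff h0 h1
  rw [coreForm]
  generalize ℓ * (1 + 4 * ρ ^ 2 / (1 - ρ ^ 2) ^ 2) = l₁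
  obtain ⟨l₂, hl₂⟩ : ∃ x, x = ℓ * ((1 + ρ ^ 2) / (1 - ρ) ^ 2) := ⟨_, rfl⟩
  obtain ⟨l₃, hl₃⟩ : ∃ x, x = ℓ * (ρ / (1 - ρ) ^ 2) := ⟨_, rfl⟩
  obtain ⟨c₀, hc₀⟩ : ∃ x, x = 1 / (4 * (1 + ℓ ^ 2)) := ⟨_, rfl⟩
  have hs : 1 - l₁ - (1 - l₁ - 4 * ρ * (1 + ℓ ^ 2)) = 4 * ρ * (1 + ℓ ^ 2) := by ring
  have hc₀0 : 0 < c₀ := by rw [hc₀]; positivity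
  have hc₀e : c₀ * (1 + ℓ ^ 2) = 1 / 4 := by rw [hc₀]; field_simp
  have hr := core_reduce (e := 0) (σ := σ) (l₁ := l₁) (l₂ := l₂) (l₃ := l₃)
    (κ := 1 - l₁ - 4 * ρ * (1 + ℓ ^ 2)) (c₀ := c₀) h0 (by rw [hs]; positivity) (by
      rw [hs]
      have : c₀ * (4 * ρ * (1 + ℓ ^ 2) * (1 + ρ) ^ 2) = ρ * (1 + ρ) ^ 2 := by
        linear_combination 4 * ρ * (1 + ρ) ^ 2 * hc₀e
      rw [this]
      exact le_mul_of_one_le_right h0.le (by nlinarith)) hd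
  rw [← hl₂, ← hl₃]
  have hl₂0 : 0 ≤ l₂ := by rw [hl₂]; positivity
  have hl₃0 : 0 ≤ l₃ := by rw [hl₃]; positivity
  have hl₂1 : l₂ ≤ 1.0205 * ℓ := by
    rw [hl₂, mul_comm]
    gcongr
  have hl₃1 : l₃ ≤ 0.0192 := by
    have : l₃ ≤ ℓ * (1.0205 * ρ) := by rw [hl₃]; gcongr
    linarith
  have hl₂2 : l₂ ^ 2 ≤ 1.0415 * ℓ ^ 2 := by
    have : l₂ ^ 2 ≤ (1.0205 * ℓ) ^ 2 := by gcongr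
    nlinarith [sq_nonneg ℓ]
  have hc1 : c₀ * (1 + l₂ ^ 2) ≤ 0.2604 := by
    have : c₀ * (1 + l₂ ^ 2) ≤ c₀ * (1.0415 * (1 + ℓ ^ 2)) := by
      gcongr
      linarith
    linarith
  have hc2 : c₀ * (1 - l₂) ^ 2 ≤ 0.2604 := by
    refine le_trans ?_ hc1
    gcongr
    linarith
  have hc3 : c₀ ≤ 1 / 4 := by linarith [mul_nonneg hc₀0.le (sq_nonneg ℓ)]
  have hc4 : c₀ * l₂ ≤ 0.1303 := by
    linarith [mul_nonneg hc₀0.le (sq_nonneg (1 - l₂))]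
  obtain ⟨hC1, -, hσ⟩ := unit_bounds hC
  have h2 : k * (σ ^ 2 / 2) ≤ k * C := by gcongr
  have h3 : (l₃ + c₀ * l₂ ^ 2) * (σ ^ 2 * T ^ 2) ≤ (l₃ + c₀ * l₂ ^ 2) * (1 * T ^ 2) := by gcongr
  have ha : 0.42 ≤ 0.7 - c₀ - (l₃ + c₀ * l₂ ^ 2) := by linarith
  have hc : 0.195 ≤ k / 2 - l₃ - c₀ * (1 - l₂) ^ 2 := by linarith
  have hb1 : k - 1 + 2 * c₀ * (1 - l₂) ≤ 0.521 := by
    linarith [mul_nonneg hc₀0.le hl₂0]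
  have hb2 : -0.521 ≤ k - 1 + 2 * c₀ * (1 - l₂) := by linarith
  have hb : (k - 1 + 2 * c₀ * (1 - l₂)) ^ 2
      ≤ 4 * (0.7 - c₀ - (l₃ + c₀ * l₂ ^ 2)) * (k / 2 - l₃ - c₀ * (1 - l₂) ^ 2) := by
    have e1 : (k - 1 + 2 * c₀ * (1 - l₂)) ^ 2 ≤ 0.521 ^ 2 := sq_le_sq' hb2 hb1
    have e2 := mul_le_mul ha hc (by norm_num) (by linarith)
    linarith
  have hf := form_nonneg (by linarith) hb T σ
  linarith

/-- The correction `m` grows at a rate above one half of that of `ℓ`, so that it outweighs the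
negative part of `κ`. -/
theorem growthBound_of_small_radius {ρ ℓ Λ m f N : ℝ} (h0 : 0 < ρ) (h1 : ρ ≤ 1 / 100)
    (hℓ : 0 ≤ ℓ) (hΛ : 0 ≤ Λ) (hℓΛ : ℓ ≤ 1.87 + Λ) (hm : m = 0.9 + 0.6 * Λ)
    (hρℓ : ρ * ℓ ^ 2 ≤ 0.035) (hρm : ρ * m ≤ 0.009) (hρm2 : ρ * m ^ 2 ≤ 0.0081)
    (hf : 0.95 ≤ f) (hN : 1 ≤ N) (hN1 : N ≤ 1.001) :
    GrowthBound ρ (1 - ℓ * (1 + 4 * ρ ^ 2 / (1 - ρ ^ 2) ^ 2) - 4 * ρ * (1 + ℓ ^ 2)) 0.3 m m 0.3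
      f N := by
  obtain ⟨⟨hk0, hk1⟩, -⟩ := small_radius_bounds h0 h1
  obtain ⟨-, -, ⟨hC0, hC1⟩⟩ := small_radius_coeff h0 h1
  simp only [GrowthBound]
  generalize multUpper ρ = k at *
  generalize 4 * ρ ^ 2 / (1 - ρ ^ 2) ^ 2 = c at *
  have hρ1 : 0 < 1 - ρ := by linarith
  have hm0 : 0.9 ≤ m := by linarith
  have e1 : 0.99 * m ≤ m / (1 + ρ) := by
    rw [le_div_iff₀ (by positivity)]
    nlinarith
  have e2 : ((1 + ρ) ^ 2 + 4 * ρ) / (1 - ρ) ^ 2 ≤ 1.0817 := by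
    rw [div_le_iff₀ (by positivity)]
    nlinarith
  have e2' : 0 ≤ ((1 + ρ) ^ 2 + 4 * ρ) / (1 - ρ) ^ 2 := by positivity
  have e3 : -(1.052 + 1.0005 * Λ) ≤ min (1 - ℓ * (1 + c) - 4 * ρ * (1 + ℓ ^ 2)) 0 := by
    refine le_min ?_ (by linarith)
    have : ℓ * c ≤ ℓ * 0.0005 := by gcongr
    linarith
  have e3' := min_le_right (1 - ℓ * (1 + c) - 4 * ρ * (1 + ℓ ^ 2)) 0
  have e4 : 0 ≤ max (1 - ℓ * (1 + c) - 4 * ρ * (1 + ℓ ^ 2)) 0 / ((1 + ρ) / (1 - ρ)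
      + 2 * ρ * (1 + ρ) / ((1 - ρ) * (1 + 4 * ρ + ρ ^ 2))) :=
    div_nonneg (le_max_right _ _) (by positivity)
  generalize max (1 - ℓ * (1 + c) - 4 * ρ * (1 + ℓ ^ 2)) 0 / ((1 + ρ) / (1 - ρ)
      + 2 * ρ * (1 + ρ) / ((1 - ρ) * (1 + 4 * ρ + ρ ^ 2))) = α at *
  generalize min (1 - ℓ * (1 + c) - 4 * ρ * (1 + ℓ ^ 2)) 0 = κ' at *
  have e5 : m * k * (2 * ρ / (1 - ρ ^ 2)) ≤ 0.0185 := by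
    have : 2 * ρ / (1 - ρ ^ 2) ≤ 2.001 * ρ := by
      rw [div_le_iff₀ (by nlinarith)]
      nlinarith [mul_nonneg h0.le (sq_nonneg ρ)]
    have : 0 ≤ 2 * ρ / (1 - ρ ^ 2) := div_nonneg (by positivity) (by nlinarith)
    have : m * k * (2 * ρ / (1 - ρ ^ 2)) ≤ m * 1.0205 * (2.001 * ρ) := by gcongr
    linarith
  have e6 : (m * k) ^ 2 * (2 * ρ * (1 + ρ) / ((1 - ρ) * (1 + 4 * ρ + ρ ^ 2))) / (2 * 0.3)
      ≤ 0.029 := by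
    have h2 : 2 * ρ * (1 + ρ) / ((1 - ρ) * (1 + 4 * ρ + ρ ^ 2)) ≤ 2.0405 * ρ := by
      rw [div_le_iff₀ (by positivity)]
      have : 0.99 ≤ (1 - ρ) * (1 + 4 * ρ + ρ ^ 2) := by nlinarith [sq_nonneg ρ]
      nlinarith
    have h3 : (m * k) ^ 2 * (2 * ρ * (1 + ρ) / ((1 - ρ) * (1 + 4 * ρ + ρ ^ 2)))
        ≤ (m * 1.0205) ^ 2 * (2.0405 * ρ) := by gcongr
    rw [div_le_iff₀ (by norm_num)]
    linarith
  have e7 : 0.931 * m - 0.285 ≤ f * (m * ((1 - ρ) / (1 + ρ)) - 0.3) := by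
    have h2 : 0.98 ≤ (1 - ρ) / (1 + ρ) := by
      rw [le_div_iff₀ (by positivity)]
      linarith
    have h3 : m * 0.98 ≤ m * ((1 - ρ) / (1 + ρ)) := by gcongr
    have h4 := mul_le_mul hf (sub_le_sub_right h3 0.3) (by linarith) (by linarith)
    linarith
  generalize f * (m * ((1 - ρ) / (1 + ρ)) - 0.3) = g at *
  generalize (m * k) ^ 2 * (2 * ρ * (1 + ρ) / ((1 - ρ) * (1 + 4 * ρ + ρ ^ 2))) / (2 * 0.3) = b at *
  generalize m * k * (2 * ρ / (1 - ρ ^ 2)) = y at *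
  generalize ((1 + ρ) ^ 2 + 4 * ρ) / (1 - ρ) ^ 2 = β at *
  have e8 : -(1.138 + 1.0823 * Λ) ≤ κ' * β := by
    have h2 : κ' * 1.0817 ≤ κ' * β := mul_le_mul_of_nonpos_left e2 e3'
    linarith
  have e10 : N * (0.99 * (0.9 + 0.6 * Λ) - 1.138 - 1.0823 * Λ - 0.0093)
      ≤ N * (m / (1 + ρ) + κ' * β - y / 2) :=
    mul_le_mul_of_nonneg_left (by linarith) (by linarith)
  have e11 : (N - 1) * (0.2563 + 0.4883 * Λ) ≤ 0.001 * (0.2563 + 0.4883 * Λ) := by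
    gcongr
    linarith
  linarith

/-- Here `y = 1 / (10 √ρ)` and `Λ = log y`, while `ℓ` is at most `log (r / ρ) / 2`. -/
theorem contactForm_nonneg_of_small_radius {ρ ℓ Λ m y W σ C T K p δ q g d : ℝ} (h0 : 0 < ρ)
    (hy : 1 ≤ y) (hρy : ρ * y ^ 2 = 1 / 100) (hℓ : 0 ≤ ℓ) (hΛ : 0 ≤ Λ) (hΛy : Λ ≤ y - 1)
    (hℓΛ : ℓ ≤ 1.87 + Λ) (hm : m = 0.9 + 0.6 * Λ) (h : IsContact ρ W σ C T K p δ q g d) :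
    0 ≤ contactForm ρ ℓ σ C m 0.3 T K p δ q g := by
  have h1 : ρ ≤ 1 / 100 := hρy ▸ le_mul_of_one_le_right h0.le (one_le_pow₀ hy)
  have hm0 : 0 ≤ m := by linarith
  have hρℓ2 : ρ * ℓ ^ 2 ≤ 0.035 := by
    have : ℓ ^ 2 ≤ (1.87 * y) ^ 2 := by
      gcongr
      linarith
    have := mul_le_mul_of_nonneg_left this h0.le
    linarith
  have hρm2 : ρ * m ^ 2 ≤ 0.0081 := by
    have : m ^ 2 ≤ (0.9 * y) ^ 2 := by
      gcongr
      linarith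
    have := mul_le_mul_of_nonneg_left this h0.le
    linarith
  have hsq : ∀ x b : ℝ, 0 ≤ b → ρ * x ^ 2 ≤ 100 * b ^ 2 → ρ * x ≤ b := by
    intro x b hb hx
    refine le_of_sq_le_sq ?_ hb
    have := mul_le_mul h1 hx (by positivity) (by norm_num)
    linarith
  have hρℓ : ρ * ℓ ≤ 0.0188 := hsq _ _ (by norm_num) (by linarith)
  have hρm : ρ * m ≤ 0.009 := hsq _ _ (by norm_num) (by linarith)
  obtain ⟨⟨hk0, hk1⟩, hT, hk2, hu⟩ := small_radius_bounds h0 h1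
  have hu1 : distBound ρ < 1 := by linarith
  have hK := h.K_le_multUpper h0 (by linarith)
  have hkK := (h.multLower_le h0 (by linarith) hu1).trans (h.le_K h0 hu1)
  have hG : ∀ f, 0.95 ≤ f → GrowthBounds ρ
      (1 - ℓ * (1 + 4 * ρ ^ 2 / (1 - ρ ^ 2) ^ 2) - 4 * ρ * (1 + ℓ ^ 2)) 0.3 m m 0.3 f := by
    intro f hf
    have := sq_nonneg (slopeBound ρ)
    refine ⟨?_, ?_, ?_, ?_⟩ <;>
    refine growthBound_of_small_radius h0 h1 hℓ hΛ hℓΛ hm hρℓ2 hρm hρm2 ?_ ?_ ?_ <;> linarith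
  exact h.contactForm_nonneg h0 (by linarith) (by norm_num) (by norm_num) hm0 le_rfl le_rfl le_rfl
    hkK (by linarith) hK (hG _ (by linarith)) (hG _ hk2)
    (core_nonneg_of_small_radius h0 h1 hℓ hρℓ (by linarith) hk1 h.unit h.disc)
    (core_nonneg_of_small_radius h0 h1 hℓ hρℓ hk2 (by linarith) h.unit h.disc)

/-! ### The sharp bound of `v / S` -/

namespace ConjSystem

variable {φ ω₁ ω₂ S v : ℂ → ℂ} {M : ℝ → ℝ}

/-- The correction is nonnegative, so that the barrier increases with `m`. -/
theorem barrier_mono (hφ : IsRealConvex φ) (h : ConjSystem φ ω₁ ω₂ S v) {r ε m₁ m₂ : ℝ} {e z : ℂ}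
    (hz : z ∈ ball (0 : ℂ) 1) (hm : m₁ ≤ m₂) :
    barrier φ ω₁ S v M r e ε m₁ z ≤ barrier φ ω₁ S v M r e ε m₂ z := by
  have hz1 : ‖z‖ < 1 := by simpa using hz
  have h1 := hφ.deriv_neg_pos (norm_nonneg z) hz1
  have h2 : 0 ≤ ‖z‖ + (ω₁ z).re := by
    have := h.norm₁ z hz
    have := neg_le_of_abs_le ((Complex.abs_re_le_norm (ω₁ z)).trans this)
    linarith
  unfold barrier
  gcongr

/-- The barrier is positive near the centre: `S(0) = 1`, and the weight grows only
logarithmically. -/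
theorem exists_barrier_pos (hφ : IsRealConvex φ) (h : ConjSystem φ ω₁ ω₂ S v)
    (hM : IsMajorant φ M) {r ε : ℝ} {e : ℂ} (he : ‖e‖ = 1) (hr : 1 / 3 ≤ r) (hr1 : r ≤ 0.41422)
    (hε : 0 < ε) :
    ∃ ρa, 0 < ρa ∧ ρa < 1 / 100 ∧ ∀ z : ℂ, ‖z‖ = ρa → ∀ m, 0 ≤ m →
      0 < barrier φ ω₁ S v M r e ε m z := by
  obtain ⟨y', hy', -⟩ := h.hasDerivAt_quot hφ (z := 0) (by norm_num)
  have hc : Tendsto (fun x => v x / S x) (𝓝 0) (𝓝 1) := by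
    have := hy'.continuousAt.tendsto
    simpa [h.v_zero, h.S_zero] using this
  obtain ⟨η, hη, hηb⟩ := Metric.tendsto_nhds_nhds.1 hc (ε / 2) (by linarith)
  obtain ⟨ρ, hρ⟩ : ∃ ρ, ρ = min (min (η / 2) (1 / 200)) ((ε / 16) ^ 2 / 2) := ⟨_, rfl⟩
  have hρ1 : ρ ≤ η / 2 := by rw [hρ]; exact (min_le_left _ _).trans (min_le_left _ _)
  have hρ2 : ρ ≤ 1 / 200 := by rw [hρ]; exact (min_le_left _ _).trans (min_le_right _ _)
  have hρ3 : ρ ≤ (ε / 16) ^ 2 / 2 := by rw [hρ]; exact min_le_right _ _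
  have hρ0 : 0 < ρ := by
    rw [hρ]
    exact lt_min (lt_min (by linarith) (by norm_num)) (by positivity)
  refine ⟨ρ, hρ0, by linarith, fun z hz m hm => ?_⟩
  have hzb : z ∈ ball (0 : ℂ) 1 := by
    simp only [mem_ball, dist_zero_right]
    linarith
  refine lt_of_lt_of_le ?_ (h.barrier_mono hφ hzb hm)
  have hM1 := hM.one_le hφ hρ0.le (by linarith)
  have hw0 := hM.weight_nonneg hφ hρ0 (by linarith : ρ ≤ r) (by linarith)
  have hw1 := hM.weight_le hφ hρ0 (by linarith : ρ ≤ r) (by linarith)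
  have hy : ‖v z / S z - 1‖ < ε / 2 := by
    have := hηb (x := z) (by rw [dist_zero_right]; linarith)
    rwa [dist_eq_norm] at this
  have hS := h.norm_S_sub_one_le hφ (z := z) (by linarith)
  have hS0 := h.S_ne_zero hφ (z := z) (by linarith)
  have hinv : ‖(S z)⁻¹ - 1‖ ≤ 2 * ρ := by
    have e1 : ‖S z - 1‖ ≤ 1.1 * ρ := by
      rw [hz] at hS
      have : ρ ^ 3 ≤ (1 / 200) ^ 2 * ρ := by
        rw [pow_succ]
        gcongr
      linarith
    have e3 : (S z)⁻¹ - 1 = -(S z - 1) / S z := by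
      field_simp
      ring
    have e4 : (0.99 : ℝ) ≤ ‖S z‖ := by
      have := norm_sub_norm_le 1 (S z)
      rw [norm_one, norm_sub_rev] at this
      linarith
    rw [e3, norm_div, norm_neg, div_le_iff₀ (by linarith)]
    nlinarith
  have hre : -(4 * ρ) ≤ ((1 + e.im * Complex.I) * (S z)⁻¹).re - 1 := by
    have e1 : ((1 + e.im * Complex.I) * (S z)⁻¹).re - 1
        = ((1 + e.im * Complex.I) * ((S z)⁻¹ - 1)).re := by
      rw [mul_sub, Complex.sub_re]
      simp
    have e2 : ‖(1 : ℂ) + e.im * Complex.I‖ ≤ 2 := by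
      refine (norm_add_le _ _).trans ?_
      have := Complex.abs_im_le_norm e
      rw [he] at this
      simp
      linarith
    rw [e1]
    refine neg_le_of_abs_le ((Complex.abs_re_le_norm _).trans ?_)
    rw [norm_mul]
    have := mul_le_mul e2 hinv (norm_nonneg _) (by norm_num)
    linarith
  have hlog : IsMajorant.weight M r ρ * (4 * ρ) ≤ 8 * √ρ := by
    have e1 : Real.log (r / ρ) ≤ 2 * (1 / √ρ) := by
      have e2 : Real.log (r / ρ) ≤ Real.log (1 / ρ) :=
        Real.log_le_log (div_pos (by linarith) hρ0) (by gcongr; linarith)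
      have e3 : Real.log (1 / ρ) = 2 * Real.log (1 / √ρ) := by
        rw [← Real.log_rpow (by positivity), one_div, one_div, Real.rpow_two, inv_pow,
          Real.sq_sqrt hρ0.le]
      have e4 := Real.log_le_self (x := 1 / √ρ) (by positivity)
      linarith
    have e5 : IsMajorant.weight M r ρ * (4 * ρ) ≤ 2 * (1 / √ρ) * (4 * ρ) := by
      gcongr
      linarith
    refine e5.trans_eq ?_
    have : √ρ ≠ 0 := (Real.sqrt_pos.2 hρ0).ne'
    field_simp
    rw [Real.sq_sqrt hρ0.le]
    ring
  have hsq : 8 * √ρ < ε / 2 := by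
    have : √ρ < ε / 16 := by
      rw [Real.sqrt_lt' (by linarith)]
      have : 0 < (ε / 16) ^ 2 := by positivity
      linarith
    linarith
  have hey : (e * (v z / S z)).re < 1 + ε / 2 := by
    have e1 : ‖v z / S z‖ < 1 + ε / 2 := by
      have := norm_add_le (v z / S z - 1) 1
      rw [sub_add_cancel, norm_one] at this
      linarith
    have := Complex.re_le_norm (e * (v z / S z))
    rw [norm_mul, he, one_mul] at this
    linarith
  unfold barrier
  rw [hz]
  have := mul_le_mul_of_nonneg_left hre hw0
  linarith

/-- For `|z| ≤ 1 / 100` the correction `m = 9 / 10 + 3 / 10 log (1 / (100 |z|))` keeps pace with the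
logarithmic growth of the weight. -/
theorem barrier_pos_deep (hφ : IsRealConvex φ) (h : ConjSystem φ ω₁ ω₂ S v)
    (hM : IsMajorant φ M) {r ε : ℝ} {e : ℂ} (he : ‖e‖ = 1) (hr : 1 / 3 ≤ r) (hr1 : r ≤ 0.41422)
    (hMr : M r * (2 * r) ≤ 1 - r ^ 2) (hε : 0 < ε) {z : ℂ} (hz : ‖z‖ = 1 / 100) :
    0 < barrier φ ω₁ S v M r e ε (9 / 10) z := by
  obtain ⟨ρa, ha0, ha1, hpos⟩ := h.exists_barrier_pos hφ hM he hr hr1 hε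
  have hlog0 : ∀ x : ℝ, 0 < x → x ≤ 1 / 100 → 0 ≤ Real.log (1 / 100 / x) := by
    intro x hx hx1
    exact Real.log_nonneg (by rwa [le_div_iff₀ hx, one_mul])
  have := h.barrier_pos hφ hM (r := r) (ρa := ρa) (ρb := 1 / 100) (ε := ε) (e := e) (z := z)
      (m := fun x => 9 / 10 + 3 / 10 * Real.log (1 / 100 / x))
      (m' := fun x => 3 / 10 * (-1 / x)) (R := fun x => x)
      (A := 0.3) he hr1 hMr ha0 (by linarith) hε
      (fun x hx0 hx1 => ⟨?_, ?_, ?_⟩) (fun x _ hx => ⟨le_rfl, by linarith⟩) ?_ ?_ ?_ ?_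
  · simpa [hz] using this
  · have := hlog0 x (by linarith) hx1
    linarith
  · have hx : 0 < x := by linarith
    have h1 := ((hasDerivAt_const x (1 / 100 : ℝ)).div (hasDerivAt_id x) hx.ne').log
      (by simp [hx.ne'])
    refine ((h1.const_mul (3 / 10)).const_add (9 / 10)).congr_deriv ?_
    simp only [Pi.div_apply, id_eq]
    field_simp
    ring
  · have hx : 0 < x := by linarith
    have : x * (3 / 10 * (-1 / x)) = -0.3 := by
      field_simp
      norm_num
    rw [this]
  · intro x hx
    exact hpos x hx _ (by linarith [hlog0 ρa ha0 ha1.le])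
  · intro x hx0 hx1 ℓ W σ C T K p δ q g d hℓ hℓr hW hcon
    have hx : 0 < x := ha0.trans hx0
    have hq : 0 < 1 / 100 / x := by positivity
    have hy2 : √(1 / 100 / x) ^ 2 = 1 / 100 / x := Real.sq_sqrt hq.le
    have hy1 : 1 ≤ √(1 / 100 / x) := by
      rw [Real.one_le_sqrt, le_div_iff₀ hx]
      linarith
    refine contactForm_nonneg_of_small_radius (y := √(1 / 100 / x))
      (Λ := Real.log (1 / 100 / x) / 2) hx hy1 ?_ hℓ ?_ ?_ ?_ (by ring) hcon
    · rw [hy2]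
      field_simp
    · have := hlog0 x hx hx1
      linarith
    · rw [← Real.log_sqrt hq.le]
      exact Real.log_le_sub_one_of_pos (by positivity)
    · have e1 : Real.log (r / x) = Real.log (100 * r) + Real.log (1 / 100 / x) := by
        rw [← Real.log_mul (by linarith) hq.ne']
        congr 1
        field_simp
      have e2 : Real.log (100 * r) ≤ 3.74 := by
        have e3 : Real.log (100 * r) = Real.log (100 * r / 2 ^ 5) + 5 * Real.log 2 := by
          rw [Real.log_div (by linarith) (by norm_num), Real.log_pow]
          norm_num
        have e4 : Real.log (100 * r / 2 ^ 5) ≤ Real.log 1.295 :=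
          Real.log_le_log (by linarith) (by linarith)
        have e5 := log_le_sub_inv_div_two (x := 1.295) (by norm_num)
        have e6 := Real.log_two_lt_d9
        norm_num at e4 e5 e6 ⊢
        linarith
      linarith
  · rw [hz]
    exact ha1.le
  · rw [hz]

/-- The sharp bound of `v / S = f / (z f')` by the majorant. -/
theorem norm_quot_le (hφ : IsRealConvex φ) (h : ConjSystem φ ω₁ ω₂ S v)
    (hM : IsMajorant φ M) {r : ℝ} (hr : 1 / 3 ≤ r) (hr1 : r ≤ 0.41422)
    (hMr : M r * (2 * r) ≤ 1 - r ^ 2) {z : ℂ} (hz : ‖z‖ = r) : ‖v z / S z‖ ≤ M r := by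
  refine le_of_forall_pos_lt_add fun ε hε => ?_
  obtain ⟨e, he, hey⟩ : ∃ e : ℂ, ‖e‖ = 1 ∧ (e * (v z / S z)).re = ‖v z / S z‖ := by
    rcases eq_or_ne (v z / S z) 0 with h0 | h0
    · exact ⟨1, norm_one, by simp [h0]⟩
    · have hn : ‖v z / S z‖ ≠ 0 := norm_ne_zero_iff.2 h0
      refine ⟨‖v z / S z‖ / (v z / S z),
        by rw [norm_div, Complex.norm_real, norm_norm, div_self hn], ?_⟩
      rw [div_mul_cancel₀ _ h0, Complex.ofReal_re]
  -- with this `e`, the barrier at `|z| = r` is `M r + ε - |v z / S z|`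
  have hr0 : 0 < r := by linarith
  have hdeep : ∀ x : ℂ, ‖x‖ = 1 / 100 → ∀ m, 9 / 10 ≤ m → 0 < barrier φ ω₁ S v M r e ε m x := by
    intro x hx m hm
    refine (h.barrier_pos_deep hφ hM he hr hr1 hMr hε hx).trans_le (h.barrier_mono hφ ?_ hm)
    simp only [mem_ball, dist_zero_right]
    linarith
  have hlog : Real.log (r / (1 / 3 : ℚ)) / 2 ≤ (11 / 100 : ℚ) := by
    have e1 : Real.log (r / (1 / 3 : ℚ)) ≤ Real.log 1.243 :=
      Real.log_le_log (by push_cast; linarith) (by push_cast; linarith)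
    have e2 := log_le_sub_inv_div_two (x := 1.243) (by norm_num)
    push_cast at e1 ⊢
    norm_num at e1 e2 ⊢
    linarith
  have h1 := h.barrier_pos_of_rowChain hφ hM he hr1 hMr hε hdeep rowTable (1 / 3) 0 (11 / 100)
    rowChain_rowTable (by norm_num) (by push_cast; linarith) hlog
  have h2 := h.barrier_pos_outer hφ hM he hr1 hMr hε outerRowTable (1 / 3)
    outerRowChain_outerRowTable (by norm_num) (by simpa using h1) z (by push_cast; linarith) hz.le
  unfold barrier at h2
  rw [hz, IsMajorant.weight_self M hr0, hey] at h2
  linarith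

end ConjSystem

/-! ### Rotations, the system of a function in the class, and the majorant of a solution -/

/-- The reflected function `z ↦ conj (f (conj z))` is differentiable. -/
theorem differentiableOn_conj_conj {f : ℂ → ℂ} (hf : DifferentiableOn ℂ f (ball 0 1)) :
    DifferentiableOn ℂ (fun z => conj (f (conj z))) (ball 0 1) := by
  intro z hz
  have hz' : conj z ∈ ball (0 : ℂ) 1 := by simpa using hz
  have h := (hf.differentiableAt (isOpen_ball.mem_nhds hz')).hasDerivAt.conj_conj
  rw [Complex.conj_conj] at h
  exact h.differentiableAt.differentiableWithinAt

theorem hasDerivAt_conj_conj_of_diff {f : ℂ → ℂ} (hf : DifferentiableOn ℂ f (ball 0 1)) {z : ℂ}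
    (hz : z ∈ ball (0 : ℂ) 1) :
    HasDerivAt (fun z => conj (f (conj z))) (conj (deriv f (conj z))) z := by
  have hz' : conj z ∈ ball (0 : ℂ) 1 := by simpa using hz
  have h := (hf.differentiableAt (isOpen_ball.mem_nhds hz')).hasDerivAt.conj_conj
  rw [Complex.conj_conj] at h
  exact h

/-- A convex function whose image is symmetric with respect to the real axis is real on the real
axis, after a rotation of the disc. -/
theorem exists_rotation_isRealConvex {φ : ℂ → ℂ} (hconv : IsConvexFunction φ) (hφ0 : φ 0 = 1)
    (hre : ∀ z ∈ ball (0 : ℂ) 1, 0 < (φ z).re)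
    (hsymm : ∀ w ∈ φ '' ball (0 : ℂ) 1, conj w ∈ φ '' ball (0 : ℂ) 1) :
    ∃ κ : ℂ, ‖κ‖ = 1 ∧ IsRealConvex fun z => φ (κ * z) := by
  have h0b : (0 : ℂ) ∈ ball (0 : ℂ) 1 := by simp
  obtain ⟨_, -, -, h⟩ := exists_analytic_inverse hconv.analytic hconv.univalent
  have hd0 : deriv φ 0 ≠ 0 := (h 0 h0b).2
  have hn0 : ‖deriv φ 0‖ ≠ 0 := norm_ne_zero_iff.2 hd0
  obtain ⟨κ, hκ⟩ : ∃ κ, κ = conj (deriv φ 0) / ‖deriv φ 0‖ := ⟨_, rfl⟩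
  have hκ1 : ‖κ‖ = 1 := by
    rw [hκ, norm_div, Complex.norm_conj, Complex.norm_real, norm_norm, div_self hn0]
  have hκ0 : κ ≠ 0 := norm_ne_zero_iff.1 (by rw [hκ1]; exact one_ne_zero)
  have hmaps : ∀ z ∈ ball (0 : ℂ) 1, κ * z ∈ ball (0 : ℂ) 1 := by
    intro z hz
    simpa [hκ1] using hz
  have himage : (fun z => φ (κ * z)) '' ball (0 : ℂ) 1 = φ '' ball (0 : ℂ) 1 := by
    apply subset_antisymm
    · rintro _ ⟨z, hz, rfl⟩
      exact ⟨κ * z, hmaps z hz, rfl⟩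
    · rintro _ ⟨z, hz, rfl⟩
      refine ⟨κ⁻¹ * z, by simpa [hκ1] using hz, ?_⟩
      simp only
      rw [mul_inv_cancel_left₀ hκ0]
  have hconvκ : IsConvexFunction fun z => φ (κ * z) := by
    refine ⟨fun z hz => ?_, fun x hx y hy hxy => ?_, ?_⟩
    · exact (hconv.analytic _ (hmaps z hz)).comp (f := fun z => κ * z)
        (analyticAt_const.mul analyticAt_id)
    · exact mul_left_cancel₀ hκ0 (hconv.univalent (hmaps x hx) (hmaps y hy) hxy)
    · rw [himage]
      exact hconv.convex_image
  have hder : HasDerivAt (fun z => φ (κ * z)) ((‖deriv φ 0‖ : ℝ) : ℂ) 0 := by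
    have h1 : HasDerivAt φ (deriv φ 0) (κ * 0) := by
      rw [mul_zero]
      exact (hconv.analytic 0 h0b).differentiableAt.hasDerivAt
    refine (h1.comp (0 : ℂ) ((hasDerivAt_id (0 : ℂ)).const_mul κ)).congr_deriv ?_
    have hn0' : ((‖deriv φ 0‖ : ℝ) : ℂ) ≠ 0 := by exact_mod_cast hn0
    rw [hκ]
    field_simp
    rw [Complex.mul_conj, Complex.normSq_eq_norm_sq]
    norm_cast
  refine ⟨κ, hκ1, hconvκ, by simpa using hφ0, fun z hz => hre _ (hmaps z hz), ?_, ?_⟩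
  · -- `B = φ⁻¹ ∘ conj ∘ φ ∘ conj` maps the disc into itself, with `B(0) = 0` and `B'(0) = 1`
    obtain ⟨χ, hχ⟩ : ∃ χ, χ = fun z => φ (κ * z) := ⟨_, rfl⟩
    rw [← hχ] at hconvκ himage hder
    have hχ0 : χ 0 = 1 := by rw [hχ]; simpa using hφ0
    obtain ⟨g, hg, hopen, hinv⟩ := exists_analytic_inverse hconvκ.analytic hconvκ.univalent
    have hχd : DifferentiableOn ℂ χ (ball 0 1) := hconvκ.analytic.differentiableOn
    have himg : ∀ z ∈ ball (0 : ℂ) 1, conj (χ (conj z)) ∈ χ '' ball (0 : ℂ) 1 := by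
      intro z hz
      rw [himage]
      refine hsymm _ ?_
      rw [← himage]
      exact ⟨conj z, by simpa using hz, rfl⟩
    have hBd : DifferentiableOn ℂ (fun z => g (conj (χ (conj z)))) (ball 0 1) :=
      hg.comp (differentiableOn_conj_conj hχd) himg
    have hB0 : g (conj (χ (conj 0))) = 0 := by
      rw [map_zero, hχ0, map_one, ← hχ0, (hinv 0 h0b).1]
    have hBmaps : ∀ z ∈ ball (0 : ℂ) 1, g (conj (χ (conj z))) ∈ ball (0 : ℂ) 1 := by
      intro z hz
      obtain ⟨x, hx, hxz⟩ := himg z hz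
      rw [← hxz, (hinv x hx).1]
      exact hx
    have hBχ : ∀ z ∈ ball (0 : ℂ) 1, χ (g (conj (χ (conj z)))) = conj (χ (conj z)) := by
      intro z hz
      obtain ⟨x, hx, hxz⟩ := himg z hz
      rw [← hxz, (hinv x hx).1]
    have hBder : HasDerivAt (fun z => g (conj (χ (conj z)))) 1 0 := by
      have h1 := hasDerivAt_conj_conj_of_diff hχd h0b
      rw [map_zero, hder.deriv, Complex.conj_ofReal] at h1
      have h2 := (hBd.differentiableAt (isOpen_ball.mem_nhds h0b)).hasDerivAt
      have h3 : HasDerivAt χ ((‖deriv φ 0‖ : ℝ) : ℂ) (g (conj (χ (conj 0)))) := by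
        rw [hB0]
        exact hder
      have h4 := h3.comp (0 : ℂ) h2
      have h5 : (χ ∘ fun z => g (conj (χ (conj z)))) =ᶠ[𝓝 0] fun z => conj (χ (conj z)) := by
        filter_upwards [isOpen_ball.mem_nhds h0b] with z hz
        exact hBχ z hz
      have h6 := (h4.congr_of_eventuallyEq h5.symm).unique h1
      have hn0' : ((‖deriv φ 0‖ : ℝ) : ℂ) ≠ 0 := by exact_mod_cast hn0
      have h7 : deriv (fun z => g (conj (χ (conj z)))) 0 = 1 := by
        refine mul_left_cancel₀ hn0' ?_
        rw [h6, mul_one]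
      rwa [h7] at h2
    have haff := Complex.affine_of_mapsTo_ball_of_norm_dslope_eq_div (R₂ := 1) hBd
      (fun z hz => by
        simp only [hB0]
        exact ball_subset_closedBall (hBmaps z hz)) h0b
      (by rw [dslope_same, hBder.deriv]; simp)
    intro z hz
    have h1 := haff hz
    simp only [hB0, dslope_same, hBder.deriv, sub_zero, smul_eq_mul, mul_one, zero_add] at h1
    have h2 := hBχ z hz
    rw [h1] at h2
    change φ (κ * conj z) = conj (φ (κ * z))
    have h3 : χ z = conj (χ (conj z)) := h2
    rw [hχ] at h3
    simp only at h3
    rw [h3, Complex.conj_conj]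
  · rw [hder.deriv, Complex.ofReal_re]
    positivity

/-- The system satisfied by `S = f' / F'` and `v = f / (z F')`, where `2 F = f + conj f(conj)`. -/
theorem ClassCc.exists_conjSystem {φ f : ℂ → ℂ} (hφ : IsRealConvex φ) (hf : ClassCc φ f) :
    ∃ ω₁ ω₂ S v G : ℂ → ℂ, ConjSystem φ ω₁ ω₂ S v ∧ ∀ z ∈ ball (0 : ℂ) 1,
      deriv f z = S z * G z ∧ f z = z * (v z * G z) := by
  obtain ⟨⟨hfa, hf0, hf1⟩, hG0, ω, hωa, hω0, hωn, hω⟩ := hf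
  have h0b : (0 : ℂ) ∈ ball (0 : ℂ) 1 := by simp
  have hfd : DifferentiableOn ℂ f (ball 0 1) := hfa.differentiableOn
  have hfd' : DifferentiableOn ℂ (deriv f) (ball 0 1) := hfa.deriv.differentiableOn
  have hconj : ∀ z ∈ ball (0 : ℂ) 1, conj z ∈ ball (0 : ℂ) 1 := fun z hz => by simpa using hz
  have hsum : ∀ z ∈ ball (0 : ℂ) 1,
      deriv (conjSum f) z = deriv f z + conj (deriv f (conj z)) := by
    intro z hz
    exact ((hfd.differentiableAt (isOpen_ball.mem_nhds hz)).hasDerivAt.add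
      (hasDerivAt_conj_conj_of_diff hfd hz)).deriv
  obtain ⟨G, hG⟩ : ∃ G, G = fun z => (deriv f z + conj (deriv f (conj z))) / 2 := ⟨_, rfl⟩
  have hGne : ∀ z ∈ ball (0 : ℂ) 1, G z ≠ 0 := by
    intro z hz
    rw [hG]
    have := hG0 z hz
    rw [hsum z hz] at this
    exact div_ne_zero this two_ne_zero
  have hGd : DifferentiableOn ℂ G (ball 0 1) := by
    rw [hG]
    exact (hfd'.add (differentiableOn_conj_conj hfd')).div_const 2
  have hG1 : G 0 = 1 := by
    rw [hG]
    simp only [map_zero, hf1, map_one]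
    norm_num
  have hGc : ∀ z, conj (G (conj z)) = G z := by
    intro z
    rw [hG]
    simp only [map_div₀, map_add, Complex.conj_conj]
    rw [add_comm]
    congr 1
    exact map_ofNat _ 2
  -- `z f'' = φ(ω) F' - f'`
  have hf2 : ∀ z ∈ ball (0 : ℂ) 1, z * deriv (deriv f) z = φ (ω z) * G z - deriv f z := by
    intro z hz
    have h1 := hω z hz
    simp only at h1
    have h2 : deriv (fun w => w * deriv f w) z = deriv f z + z * deriv (deriv f) z := by
      have := (hasDerivAt_id z).mul
        (hfd'.differentiableAt (isOpen_ball.mem_nhds hz)).hasDerivAt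
      refine this.deriv.trans ?_
      simp
    have h3 : deriv (conjSum f) z = 2 * G z := by
      rw [hsum z hz, hG]
      ring
    rw [h2, h3, div_eq_iff (mul_ne_zero two_ne_zero (hGne z hz))] at h1
    linear_combination h1 / 2
  have hconj2 : ∀ z ∈ ball (0 : ℂ) 1, z * conj (deriv (deriv f) (conj z))
      = φ (conj (ω (conj z))) * G z - conj (deriv f (conj z)) := by
    intro z hz
    have h1 := congrArg conj (hf2 (conj z) (hconj z hz))
    simp only [map_mul, map_sub, Complex.conj_conj, hGc] at h1
    rw [h1, hφ.map_conj _ (ConjSystem.mem_ball_of_norm_le (hconj z hz) (hωn _ (hconj z hz)))]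
  have hGder : ∀ z ∈ ball (0 : ℂ) 1,
      z * deriv G z = ((φ (ω z) + φ (conj (ω (conj z)))) / 2 - 1) * G z := by
    intro z hz
    have h1 : deriv G z = (deriv (deriv f) z + conj (deriv (deriv f) (conj z))) / 2 := by
      have := ((hfd'.differentiableAt (isOpen_ball.mem_nhds hz)).hasDerivAt.add
        (hasDerivAt_conj_conj_of_diff hfd' hz)).div_const 2
      rw [hG]
      exact this.deriv
    have h2 : G z * 2 = deriv f z + conj (deriv f (conj z)) := by rw [hG]; ring
    rw [h1]
    linear_combination (hf2 z hz + hconj2 z hz) / 2 + h2 / 2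
  have hDd : DifferentiableOn ℂ (dslope f 0) (ball 0 1) :=
    (Complex.differentiableOn_dslope (isOpen_ball.mem_nhds h0b)).2 hfd
  have hD : ∀ z, z * dslope f 0 z = f z := by
    intro z
    have := sub_smul_dslope f 0 z
    simpa [hf0] using this
  refine ⟨ω, fun z => conj (ω (conj z)), fun z => deriv f z / G z, fun z => dslope f 0 z / G z,
    G, ⟨hωa.differentiableOn, differentiableOn_conj_conj hωa.differentiableOn, hωn, ?_,
      hfd'.div hGd hGne, hDd.div hGd hGne, by simp [hf1, hG1], by simp [hf1, hG1], ?_, ?_⟩, ?_⟩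
  · intro z hz
    simpa using hωn _ (hconj z hz)
  · intro z hz
    have hne := hGne z hz
    have h1 := ((hfd'.differentiableAt (isOpen_ball.mem_nhds hz)).hasDerivAt.div
      (hGd.differentiableAt (isOpen_ball.mem_nhds hz)).hasDerivAt hne).deriv
    have h2 : z * ((deriv (deriv f) z * G z - deriv f z * deriv G z) / G z ^ 2)
        = (z * deriv (deriv f) z * G z - deriv f z * (z * deriv G z)) / G z ^ 2 := by ring
    change z * deriv (deriv f / G) z = _
    rw [h1, h2, hf2 z hz, hGder z hz]
    field_simp
    ring
  · intro z hz
    have hne := hGne z hz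
    have hDz := (hDd.differentiableAt (isOpen_ball.mem_nhds hz)).hasDerivAt
    have h1 := (hDz.div (hGd.differentiableAt (isOpen_ball.mem_nhds hz)).hasDerivAt hne).deriv
    have h2 : z * ((deriv (dslope f 0) z * G z - dslope f 0 z * deriv G z) / G z ^ 2)
        = (z * deriv (dslope f 0) z * G z - dslope f 0 z * (z * deriv G z)) / G z ^ 2 := by ring
    have h3 : z * deriv (dslope f 0) z = deriv f z - dslope f 0 z := by
      have h4 := ((hasDerivAt_id z).mul hDz).deriv
      have h5 : (id * dslope f 0) = f := funext hD
      rw [h5] at h4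
      simp only [id_eq, one_mul] at h4
      rw [h4]
      ring
    change z * deriv (dslope f 0 / G) z = _
    rw [h1, h2, h3, hGder z hz]
    field_simp
    ring
  · intro z hz
    have hne := hGne z hz
    refine ⟨by field_simp, ?_⟩
    rw [div_mul_cancel₀ _ hne, hD]

theorem IsBriotBouquetSolution.map_zero {φ ψ : ℂ → ℂ} (hψ : IsBriotBouquetSolution φ ψ)
    (hφ0 : φ 0 = 1) : ψ 0 = 1 := by
  have := hψ.equation 0 (by simp)
  simpa [hφ0] using this

/-- The reciprocal of a solution of the Briot–Bouquet equation solves a linear equation. -/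
theorem IsBriotBouquetSolution.isMajorant {φ ψ : ℂ → ℂ} (hφ : IsRealConvex φ)
    (hψ : IsBriotBouquetSolution φ ψ) : IsMajorant φ fun ρ => (ψ (-(ρ : ℂ)))⁻¹.re := by
  have key : ∀ ρ : ℝ, 0 ≤ ρ → ρ < 1 → HasDerivAt (fun ρ : ℝ => (ψ (-(ρ : ℂ)))⁻¹.re)
      (deriv ψ (-(ρ : ℂ)) / ψ (-(ρ : ℂ)) ^ 2).re ρ := by
    intro ρ h0 h1
    have hb := neg_ofReal_mem_ball h0 h1
    have hd := (hψ.analytic _ hb).differentiableAt.hasDerivAt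
    have h2 := (hd.inv (hψ.ne_zero _ hb)).scomp ρ (hasDerivAt_neg_ofReal ρ)
    refine (hasDerivAt_re h2).congr_deriv ?_
    simp [neg_div]
  refine ⟨?_, fun ρ h0 h1 => (key ρ h0 h1).differentiableAt, fun ρ h0 h1 => ?_⟩
  · simp [hψ.map_zero hφ.map_zero]
  · have hb := neg_ofReal_mem_ball h0 h1
    rw [(key ρ h0 h1).deriv]
    have h2 := hψ.equation _ hb
    have hne := hψ.ne_zero _ hb
    rw [hφ.apply_neg h0 h1] at h2
    have h3 : (ρ : ℂ) * (deriv ψ (-(ρ : ℂ)) / ψ (-(ρ : ℂ)) ^ 2)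
        = 1 - ((φ (-(ρ : ℂ))).re : ℂ) * (ψ (-(ρ : ℂ)))⁻¹ := by
      rw [← h2]
      field_simp
      ring
    have h4 := congrArg Complex.re h3
    rwa [Complex.re_ofReal_mul, Complex.sub_re, Complex.one_re, Complex.re_ofReal_mul] at h4

theorem IsBriotBouquetSolution.rotate {φ ψ : ℂ → ℂ} (hψ : IsBriotBouquetSolution φ ψ) {κ : ℂ}
    (hκ : ‖κ‖ = 1) : IsBriotBouquetSolution (fun z => φ (κ * z)) fun z => ψ (κ * z) := by
  have hmaps : ∀ z ∈ ball (0 : ℂ) 1, κ * z ∈ ball (0 : ℂ) 1 := by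
    intro z hz
    simpa [hκ] using hz
  refine ⟨fun z hz => ?_, fun z hz => hψ.ne_zero _ (hmaps z hz), fun z hz => ?_⟩
  · exact (hψ.analytic _ (hmaps z hz)).comp (f := fun z => κ * z)
      (analyticAt_const.mul analyticAt_id)
  · have h1 : HasDerivAt (fun z => ψ (κ * z)) (deriv ψ (κ * z) * (κ * 1)) z :=
      (hψ.analytic _ (hmaps z hz)).differentiableAt.hasDerivAt.comp z
        ((hasDerivAt_id z).const_mul κ)
    rw [← hψ.equation _ (hmaps z hz), h1.deriv]
    ring

theorem ClassCc.rotate {φ f : ℂ → ℂ} (hf : ClassCc φ f) {κ : ℂ} (hκ : ‖κ‖ = 1) :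
    ClassCc (fun z => φ (κ * z)) f := by
  obtain ⟨hA, hG0, ω, hωa, hω0, hωn, hω⟩ := hf
  have hκ0 : κ ≠ 0 := norm_ne_zero_iff.1 (by rw [hκ]; exact one_ne_zero)
  refine ⟨hA, hG0, fun z => κ⁻¹ * ω z, fun z hz => analyticAt_const.mul (hωa z hz), by simp [hω0],
    fun z hz => ?_, fun z hz => ?_⟩
  · simpa [hκ] using hωn z hz
  · rw [hω z hz]
    simp only [mul_inv_cancel_left₀ hκ0]

/-! ### The radius, majorization of derivatives, and sharpness -/

section minModulus

variable {ψ : ℂ → ℂ}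

theorem minModulus_le (ψ : ℂ → ℂ) {z : ℂ} {r : ℝ} (hz : ‖z‖ = r) : minModulus ψ r ≤ ‖ψ z‖ :=
  csInf_le ⟨0, by rintro _ ⟨w, -, rfl⟩; exact norm_nonneg _⟩
    ⟨z, by simpa using hz, rfl⟩

theorem exists_minModulus_eq (hψ : DifferentiableOn ℂ ψ (ball 0 1)) {r : ℝ} (h0 : 0 ≤ r)
    (h1 : r < 1) : ∃ z : ℂ, ‖z‖ = r ∧ ‖ψ z‖ = minModulus ψ r := by
  have hsub : sphere (0 : ℂ) r ⊆ ball 0 1 := sphere_subset_closedBall.trans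
    (closedBall_subset_ball h1)
  have hc : IsCompact ((fun z => ‖ψ z‖) '' sphere (0 : ℂ) r) :=
    (isCompact_sphere 0 r).image_of_continuousOn (hψ.continuousOn.mono hsub).norm
  have hne : ((fun z => ‖ψ z‖) '' sphere (0 : ℂ) r).Nonempty :=
    ((NormedSpace.sphere_nonempty).2 h0).image _
  obtain ⟨z, hz, hz'⟩ := hc.sInf_mem hne
  exact ⟨z, by simpa using hz, hz'⟩

theorem minModulus_zero (ψ : ℂ → ℂ) : minModulus ψ 0 = ‖ψ 0‖ := by
  simp [minModulus]

theorem minModulus_pos (hψ : DifferentiableOn ℂ ψ (ball 0 1))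
    (hne : ∀ z ∈ ball (0 : ℂ) 1, ψ z ≠ 0) {r : ℝ} (h0 : 0 ≤ r) (h1 : r < 1) :
    0 < minModulus ψ r := by
  obtain ⟨z, hz, hz'⟩ := exists_minModulus_eq hψ h0 h1
  rw [← hz']
  exact norm_pos_iff.2 (hne z (by simpa [hz] using h1))

/-- The minimum principle for functions without zeros. -/
theorem minModulus_anti (hψ : DifferentiableOn ℂ ψ (ball 0 1))
    (hne : ∀ z ∈ ball (0 : ℂ) 1, ψ z ≠ 0) {r s : ℝ} (h0 : 0 ≤ r) (hrs : r ≤ s) (h1 : s < 1) :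
    minModulus ψ s ≤ minModulus ψ r := by
  obtain ⟨z, hz, hz'⟩ := exists_minModulus_eq hψ h0 (hrs.trans_lt h1)
  have hs := minModulus_pos hψ hne (h0.trans hrs) h1
  have h2 := norm_le_of_sphere (f := fun z => (ψ z)⁻¹) (C := (minModulus ψ s)⁻¹) h1
    (hψ.inv hne) (fun w hw => by
      rw [norm_inv]
      exact inv_anti₀ hs (minModulus_le ψ hw)) (hz.trans_le hrs)
  rw [norm_inv] at h2
  rw [← hz']
  refine (inv_le_inv₀ ?_ hs).1 h2
  exact norm_pos_iff.2 (hne z (by simpa [hz] using hrs.trans_lt h1))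

theorem continuousOn_minModulus (hψ : DifferentiableOn ℂ ψ (ball 0 1)) {R : ℝ} (h1 : R < 1) :
    ContinuousOn (minModulus ψ) (Icc 0 R) := by
  have hmem : ∀ x : Icc (0 : ℝ) R, ∀ w : sphere (0 : ℂ) 1,
      ((x : ℝ) : ℂ) * (w : ℂ) ∈ ball (0 : ℂ) 1 := by
    intro x w
    have hw : ‖(w : ℂ)‖ = 1 := by simp
    rw [mem_ball, dist_zero_right, norm_mul, hw, mul_one, Complex.norm_real,
      Real.norm_of_nonneg x.2.1]
    exact x.2.2.trans_lt h1
  have hf : Continuous fun q : Icc (0 : ℝ) R × sphere (0 : ℂ) 1 =>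
      ‖ψ (((q.1 : ℝ) : ℂ) * (q.2 : ℂ))‖ := by
    have hg : Continuous fun q : Icc (0 : ℝ) R × sphere (0 : ℂ) 1 =>
        ((q.1 : ℝ) : ℂ) * (q.2 : ℂ) := by fun_prop
    exact (hψ.continuousOn.comp_continuous hg fun q => hmem q.1 q.2).norm
  have h := IsCompact.continuous_sInf (K := (univ : Set (sphere (0 : ℂ) 1)))
    (f := fun (x : Icc (0 : ℝ) R) (w : sphere (0 : ℂ) 1) => ‖ψ (((x : ℝ) : ℂ) * (w : ℂ))‖)
    isCompact_univ hf
  rw [continuousOn_iff_continuous_domRestrict]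
  refine h.congr fun x => ?_
  simp only [domRestrict_apply, minModulus]
  congr 1
  ext t
  constructor
  · rintro ⟨w, -, rfl⟩
    have hw : ‖(w : ℂ)‖ = 1 := by simp
    refine ⟨((x : ℝ) : ℂ) * (w : ℂ), ?_, rfl⟩
    rw [mem_sphere, dist_zero_right, norm_mul, hw, mul_one, Complex.norm_real,
      Real.norm_of_nonneg x.2.1]
  · rintro ⟨z, hz, rfl⟩
    rw [mem_sphere, dist_zero_right] at hz
    rcases eq_or_ne z 0 with rfl | hz0
    · refine ⟨⟨1, by simp⟩, mem_univ _, ?_⟩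
      rw [norm_zero] at hz
      simp [← hz]
    · have hzn : (‖z‖ : ℂ) ≠ 0 := by simpa using hz0
      refine ⟨⟨z / ‖z‖, by simp [hz0]⟩, mem_univ _, ?_⟩
      simp only
      rw [← hz, mul_div_cancel₀ _ hzn]

/-- The equation `(1 - r²) m(r) = 2 r` has a least root, and its left side is smaller than the
right side exactly beyond it. -/
theorem exists_isLeast_root (hψ : DifferentiableOn ℂ ψ (ball 0 1))
    (hne : ∀ z ∈ ball (0 : ℂ) 1, ψ z ≠ 0) (h0 : ψ 0 = 1) {s : ℝ} (hs0 : 0 < s) (hs1 : s < 1)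
    (hs : (1 - s ^ 2) * minModulus ψ s ≤ 2 * s) :
    ∃ r : ℝ, IsLeast {r : ℝ | r ∈ Ioo (0 : ℝ) 1 ∧ (1 - r ^ 2) * minModulus ψ r - 2 * r = 0} r ∧
      0 < r ∧ r ≤ s ∧ ∀ t, r < t → t < 1 → (1 - t ^ 2) * minModulus ψ t < 2 * t := by
  have hc : ContinuousOn (fun r => (1 - r ^ 2) * minModulus ψ r - 2 * r) (Icc 0 s) :=
    ((by fun_prop : Continuous fun r : ℝ => 1 - r ^ 2).continuousOn.mul
      (continuousOn_minModulus hψ hs1)).sub (by fun_prop)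
  have hanti : ∀ r t : ℝ, 0 ≤ r → r < t → t < 1 →
      (1 - t ^ 2) * minModulus ψ t - 2 * t < (1 - r ^ 2) * minModulus ψ r - 2 * r := by
    intro r t hr hrt ht
    have h1 := minModulus_anti hψ hne hr hrt.le ht
    have h2 := minModulus_pos hψ hne (hr.trans hrt.le) ht
    have h3 : (1 - t ^ 2) * minModulus ψ t ≤ (1 - r ^ 2) * minModulus ψ r :=
      mul_le_mul (by nlinarith) h1 h2.le (by nlinarith)
    linarith
  have hm0 : minModulus ψ 0 = 1 := by rw [minModulus_zero, h0, norm_one]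
  obtain ⟨r, ⟨hr0, hrs⟩, hr⟩ := intermediate_value_Icc' hs0.le hc
    (show (0 : ℝ) ∈ Icc _ _ from ⟨by linarith, by simp [hm0]⟩)
  simp only at hr
  have hr0' : 0 < r := by
    refine lt_of_le_of_ne hr0 fun h => ?_
    rw [← h, hm0] at hr
    norm_num at hr
  refine ⟨r, ⟨⟨⟨hr0', hrs.trans_lt hs1⟩, hr⟩, fun t ht => ?_⟩, hr0', hrs, fun t hrt ht => ?_⟩
  · by_contra! h
    have := hanti t r ht.1.1.le h (hrs.trans_lt hs1)
    have := ht.2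
    linarith
  · have := hanti r t hr0 hrt ht
    linarith

end minModulus

/-- The radius at which the majorant `M` reaches `(1 - r²) / (2 r)`. -/
theorem IsMajorant.exists_radius {φ : ℂ → ℂ} {M : ℝ → ℝ} (hφ : IsRealConvex φ)
    (hM : IsMajorant φ M) : ∃ r, 1 / 3 ≤ r ∧ r < 0.41422 ∧ M r * (2 * r) = 1 - r ^ 2 := by
  have hc : ContinuousOn (fun r => (1 - r ^ 2) - M r * (2 * r)) (Icc (1 / 3) 0.41422) :=
    ContinuousOn.sub (by fun_prop) ((hM.continuousOn.mono fun x hx =>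
      ⟨by linarith [hx.1], by linarith [hx.2]⟩).mul (by fun_prop))
  have h1 := hM.le_one_add hφ (ρ := 1 / 3) (by norm_num) (by norm_num)
  have h2 := hM.one_le hφ (ρ := 0.41422) (by norm_num) (by norm_num)
  obtain ⟨r, ⟨hr0, hr1⟩, hr⟩ := intermediate_value_Icc' (by norm_num) hc
    (show (0 : ℝ) ∈ Icc _ _ from ⟨by norm_num at h2 ⊢; linarith, by norm_num at h1 ⊢; linarith⟩)
  simp only at hr
  refine ⟨r, hr0, lt_of_le_of_ne hr1 fun h => ?_, by linarith⟩
  rw [h] at hr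
  norm_num at h2 hr
  linarith

/-- The sharp lower bound of `|z f' / f|` for the class. -/
theorem ClassCc.two_mul_norm_le {φ f : ℂ → ℂ} {M : ℝ → ℝ} (hφ : IsRealConvex φ)
    (hM : IsMajorant φ M) (hf : ClassCc φ f) {r : ℝ} (hr : 1 / 3 ≤ r) (hr1 : r < 0.41422)
    (hMr : M r * (2 * r) = 1 - r ^ 2) {z : ℂ} (hz : ‖z‖ ≤ r) :
    2 * ‖f z‖ ≤ (1 - ‖z‖ ^ 2) * ‖deriv f z‖ := by
  obtain ⟨ω₁, ω₂, S, v, G, h, hSG⟩ := hf.exists_conjSystem hφ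
  have hr0 : 0 < r := by linarith
  have hzb : z ∈ ball (0 : ℂ) 1 := by
    simp only [mem_ball, dist_zero_right]
    linarith
  have hS0 : ∀ w ∈ closedBall (0 : ℂ) r, S w ≠ 0 := fun w hw =>
    h.S_ne_zero hφ (by simp only [mem_closedBall, dist_zero_right] at hw; linarith)
  have hsub : closedBall (0 : ℂ) r ⊆ ball 0 1 := closedBall_subset_ball (by linarith)
  have hquot : ‖v z / S z‖ ≤ M r := by
    rcases hz.eq_or_lt with hz' | hz'
    · exact h.norm_quot_le hφ hM hr hr1.le hMr.le hz'
    have hd : DiffContOnCl ℂ (fun w => v w / S w) (ball 0 r) :=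
      ((h.diffv.mono hsub).div (h.diffS.mono hsub) hS0).diffContOnCl_ball subset_rfl
    refine Complex.norm_le_of_forall_mem_frontier_norm_le isBounded_ball hd (fun w hw => ?_)
      (subset_closure (show z ∈ ball (0 : ℂ) r by simpa using hz'))
    rw [frontier_ball _ hr0.ne', mem_sphere, dist_zero_right] at hw
    exact h.norm_quot_le hφ hM hr hr1.le hMr.le hw
  have hSz : 0 < ‖S z‖ := norm_pos_iff.2 (hS0 z (by simpa using hz))
  obtain ⟨e1, e2⟩ := hSG z hzb
  rw [e1, e2, norm_mul, norm_mul, norm_mul]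
  rw [norm_div, div_le_iff₀ hSz] at hquot
  -- `(1 - t²) / (2 t)` decreases
  have h2 : 2 * ‖z‖ * M r ≤ 1 - ‖z‖ ^ 2 := by
    refine le_of_mul_le_mul_right ?_ hr0
    have h3 : 2 * ‖z‖ * M r * r = ‖z‖ * (1 - r ^ 2) := by rw [← hMr]; ring
    rw [h3]
    have : 0 ≤ (r - ‖z‖) * (1 + ‖z‖ * r) := mul_nonneg (by linarith) (by positivity)
    linarith
  have h4 := mul_le_mul_of_nonneg_left hquot (by positivity : 0 ≤ 2 * ‖z‖)
  have h5 := mul_le_mul_of_nonneg_right h2 hSz.le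
  have h6 : 2 * ‖z‖ * ‖v z‖ * ‖G z‖ ≤ (1 - ‖z‖ ^ 2) * ‖S z‖ * ‖G z‖ :=
    mul_le_mul_of_nonneg_right (by linarith) (norm_nonneg _)
  linarith

/-- Majorization of the derivatives from a lower bound of `|f' / f|`, by the Schwarz–Pick
inequality. -/
theorem MajorizedBy.norm_deriv_le {f g : ℂ → ℂ} (hf : DifferentiableOn ℂ f (ball 0 1))
    (hg : MajorizedBy g f) {z : ℂ} (hz : z ∈ ball (0 : ℂ) 1)
    (h : 2 * ‖f z‖ ≤ (1 - ‖z‖ ^ 2) * ‖deriv f z‖) : ‖deriv g z‖ ≤ ‖deriv f z‖ := by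
  obtain ⟨Φ, hΦa, hΦ1, hΦ⟩ := hg
  have hz1 : ‖z‖ < 1 := by simpa using hz
  have hsp := schwarz_pick_deriv hΦa.differentiableOn hΦ1 hz1
  have hd : deriv g z = deriv Φ z * f z + Φ z * deriv f z := by
    have h1 : g =ᶠ[𝓝 z] fun w => Φ w * f w := by
      filter_upwards [isOpen_ball.mem_nhds hz] with w hw
      exact hΦ w hw
    rw [h1.deriv_eq]
    exact ((hΦa z hz).differentiableAt.hasDerivAt.mul
      (hf.differentiableAt (isOpen_ball.mem_nhds hz)).hasDerivAt).deriv
  have hn : ‖deriv g z‖ ≤ ‖deriv Φ z‖ * ‖f z‖ + ‖Φ z‖ * ‖deriv f z‖ := by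
    rw [hd, ← norm_mul, ← norm_mul]
    exact norm_add_le _ _
  have h2 : 2 * (‖deriv Φ z‖ * ‖f z‖) ≤ (1 - ‖Φ z‖ ^ 2) * ‖deriv f z‖ := by
    have e1 := mul_le_mul_of_nonneg_left h (norm_nonneg (deriv Φ z))
    have e2 := mul_le_mul_of_nonneg_right hsp (norm_nonneg (deriv f z))
    linarith
  have h3 : 0 ≤ (1 - ‖Φ z‖) ^ 2 * ‖deriv f z‖ := by positivity
  linarith

/-- A solution that is real on the negative radius is real on the real axis. -/
theorem map_conj_of_neg_real {ψ : ℂ → ℂ} (hψ : AnalyticOnNhd ℂ ψ (ball 0 1))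
    (h : ∀ r ∈ Ioo (0 : ℝ) 1, conj (ψ (-(r : ℂ))) = ψ (-(r : ℂ))) :
    ∀ z ∈ ball (0 : ℂ) 1, conj (ψ (conj z)) = ψ z := by
  have hc : AnalyticOnNhd ℂ (fun z => conj (ψ (conj z))) (ball 0 1) :=
    (differentiableOn_conj_conj hψ.differentiableOn).analyticOnNhd isOpen_ball
  refine hc.eqOn_of_preconnected_of_frequently_eq hψ (convex_ball (0 : ℂ) 1).isPreconnected
    (z₀ := 0) (by simp) ?_
  have ht : Tendsto (fun r : ℝ => -(r : ℂ)) (𝓝[>] 0) (𝓝[≠] 0) := by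
    refine tendsto_nhdsWithin_iff.2 ⟨?_, ?_⟩
    · have : ContinuousAt (fun r : ℝ => -(r : ℂ)) 0 := by fun_prop
      have h2 := this.tendsto
      simp only [Complex.ofReal_zero, neg_zero] at h2
      exact h2.mono_left nhdsWithin_le_nhds
    · filter_upwards [self_mem_nhdsWithin] with r hr
      have : r ≠ 0 := ne_of_gt hr
      simpa using this
  refine ht.frequently (Eventually.frequently ?_)
  filter_upwards [Ioo_mem_nhdsGT (zero_lt_one' ℝ)] with r hr
  simp only [map_neg, Complex.conj_ofReal]
  exact h r hr

/-- The extremal function, with `z f' / f = ψ`. -/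
theorem IsBriotBouquetSolution.exists_extremal {φ ψ : ℂ → ℂ} (hφ0 : φ 0 = 1)
    (hψ : IsBriotBouquetSolution φ ψ) (hsymm : ∀ z ∈ ball (0 : ℂ) 1, conj (ψ (conj z)) = ψ z) :
    ∃ f : ℂ → ℂ, ClassCc φ f ∧ ∀ z ∈ ball (0 : ℂ) 1,
      z * deriv f z = ψ z * f z ∧ deriv f z ≠ 0 := by
  have h0b : (0 : ℂ) ∈ ball (0 : ℂ) 1 := by simp
  have hψ0 := hψ.map_zero hφ0
  have hψd : DifferentiableOn ℂ ψ (ball 0 1) := hψ.analytic.differentiableOn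
  have hconj : ∀ z ∈ ball (0 : ℂ) 1, conj z ∈ ball (0 : ℂ) 1 := fun z hz => by simpa using hz
  obtain ⟨D, hDdef⟩ : ∃ D, D = dslope ψ 0 := ⟨_, rfl⟩
  have hDd : DifferentiableOn ℂ D (ball 0 1) := by
    rw [hDdef]
    exact (Complex.differentiableOn_dslope (isOpen_ball.mem_nhds h0b)).2 hψd
  have hD : ∀ z, z * D z = ψ z - 1 := by
    intro z
    have := sub_smul_dslope ψ 0 z
    simpa [hψ0, hDdef] using this
  have hDsymm : ∀ z ∈ ball (0 : ℂ) 1, conj (D (conj z)) = D z := by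
    have hne : ∀ z ∈ ball (0 : ℂ) 1, z ≠ 0 → conj (D (conj z)) = D z := by
      intro z hz hz0
      refine mul_left_cancel₀ hz0 ?_
      have := congrArg conj (hD (conj z))
      rw [map_mul, Complex.conj_conj, map_sub, hsymm z hz, map_one] at this
      rw [this, hD]
    intro z hz
    rcases eq_or_ne z 0 with rfl | hz0
    · have h1 : deriv ψ 0 = conj (deriv ψ (conj 0)) := by
        have h2 := (hasDerivAt_conj_conj_of_diff hψd h0b).deriv
        rw [← h2]
        refine Filter.EventuallyEq.deriv_eq ?_
        filter_upwards [isOpen_ball.mem_nhds h0b] with w hw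
        exact (hsymm w hw).symm
      rw [_root_.map_zero] at h1 ⊢
      rw [hDdef, dslope_same, ← h1]
    · exact hne z hz hz0
  obtain ⟨H₀, hH₀⟩ := hDd.isExactOn_ball
  -- a primitive that is real on the real axis
  obtain ⟨H, hH⟩ : ∃ H : ℂ → ℂ, H = fun z => (H₀ z + conj (H₀ (conj z))) / 2 - (H₀ 0).re :=
    ⟨_, rfl⟩
  have hHd : ∀ z ∈ ball (0 : ℂ) 1, HasDerivAt H (D z) z := by
    intro z hz
    have h1 := (hH₀ (conj z) (hconj z hz)).conj_conj
    rw [Complex.conj_conj, hDsymm z hz] at h1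
    have h2 := (((hH₀ z hz).add h1).div_const 2).sub_const ((H₀ 0).re : ℂ)
    rw [hH]
    refine h2.congr_deriv ?_
    ring
  have hH0 : H 0 = 0 := by
    rw [hH]
    simp only [_root_.map_zero]
    rw [Complex.add_conj]
    push_cast
    ring
  have hHc : ∀ z, conj (H (conj z)) = H z := by
    intro z
    rw [hH]
    simp only [map_sub, map_div₀, map_add, Complex.conj_conj, Complex.conj_ofReal]
    rw [add_comm (conj (H₀ (conj z)))]
    congr 2
    exact map_ofNat _ 2
  obtain ⟨f, hf⟩ : ∃ f : ℂ → ℂ, f = fun z => z * Complex.exp (H z) := ⟨_, rfl⟩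
  have hfd : ∀ z ∈ ball (0 : ℂ) 1, HasDerivAt f (ψ z * Complex.exp (H z)) z := by
    intro z hz
    have h1 := (hasDerivAt_id z).mul (hHd z hz).cexp
    rw [hf]
    refine h1.congr_deriv ?_
    simp only [id_eq]
    linear_combination Complex.exp (H z) * hD z
  have hfdiff : DifferentiableOn ℂ f (ball 0 1) :=
    fun z hz => (hfd z hz).differentiableAt.differentiableWithinAt
  have hfc : ∀ z, conj (f (conj z)) = f z := by
    intro z
    rw [hf]
    simp only [map_mul, Complex.conj_conj, ← Complex.exp_conj, hHc]
  have hfne : ∀ z ∈ ball (0 : ℂ) 1, deriv f z ≠ 0 := by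
    intro z hz
    rw [(hfd z hz).deriv]
    exact mul_ne_zero (hψ.ne_zero z hz) (Complex.exp_ne_zero _)
  have hzf : ∀ z ∈ ball (0 : ℂ) 1, z * deriv f z = ψ z * f z := by
    intro z hz
    rw [(hfd z hz).deriv, hf]
    ring
  have hsum : conjSum f = fun z => 2 * f z := by
    funext z
    rw [conjSum, hfc]
    ring
  have hsumd : ∀ z ∈ ball (0 : ℂ) 1, deriv (conjSum f) z = 2 * deriv f z := by
    intro z hz
    rw [hsum]
    exact ((hfd z hz).differentiableAt.hasDerivAt.const_mul 2).deriv
  refine ⟨f, ⟨⟨hfdiff.analyticOnNhd isOpen_ball, by simp [hf], ?_⟩, fun z hz => ?_, id,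
    fun z _ => analyticAt_id, rfl, fun z _ => le_rfl, fun z hz => ?_⟩,
    fun z hz => ⟨hzf z hz, hfne z hz⟩⟩
  · rw [(hfd 0 h0b).deriv, hψ0, hH0]
    simp
  · rw [hsumd z hz]
    exact mul_ne_zero two_ne_zero (hfne z hz)
  · have h1 : (fun w => w * deriv f w) =ᶠ[𝓝 z] fun w => ψ w * f w := by
      filter_upwards [isOpen_ball.mem_nhds hz] with w hw
      exact hzf w hw
    have h2 : deriv (fun w => ψ w * f w) z = deriv ψ z * f z + ψ z * deriv f z :=
      ((hψ.analytic z hz).differentiableAt.hasDerivAt.mul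
        (hfd z hz).differentiableAt.hasDerivAt).deriv
    have hψz := hψ.ne_zero z hz
    have hfz := hfne z hz
    simp only [id_eq]
    rw [h1.deriv_eq, h2, hsumd z hz, ← hψ.equation z hz]
    have h3 := hzf z hz
    rw [div_eq_iff (mul_ne_zero two_ne_zero hfz)]
    field_simp
    linear_combination (-deriv ψ z) * h3

/-- Beyond the radius the majorization of the derivatives fails for an automorphism `Φ` of the
disc with `Φ(-r)` close to `1`. -/
theorem exists_majorizedBy_norm_deriv_lt {f : ℂ → ℂ} (hf : DifferentiableOn ℂ f (ball 0 1))
    {r m : ℝ} (hr0 : 0 < r) (hr1 : r < 1) (hm : 0 < m) (hrm : (1 - r ^ 2) * m < 2 * r)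
    (hfr : -(r : ℂ) * deriv f (-(r : ℂ)) = m * f (-(r : ℂ))) (hne : deriv f (-(r : ℂ)) ≠ 0) :
    ∃ g : ℂ → ℂ, AnalyticOnNhd ℂ g (ball 0 1) ∧ MajorizedBy g f ∧
      ‖deriv f (-(r : ℂ))‖ < ‖deriv g (-(r : ℂ))‖ := by
  have hzb := neg_ofReal_mem_ball hr0.le hr1
  obtain ⟨t, ht0, ht1⟩ : ∃ t : ℝ, max 0 ((1 - r ^ 2) * m / r - 1) < t ∧ t < 1 := by
    refine exists_between (max_lt one_pos ?_)
    rw [sub_lt_iff_lt_add, div_lt_iff₀ hr0]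
    linarith
  have htpos : 0 < t := (le_max_left _ _).trans_lt ht0
  have htr : (1 - r ^ 2) * m < (1 + t) * r := by
    have := (le_max_right _ _).trans_lt ht0
    rwa [sub_lt_iff_lt_add, div_lt_iff₀ hr0, add_comm] at this
  have hrn : ‖(-(r : ℂ))‖ < 1 := by simpa using hzb
  have htn : ‖(t : ℂ)‖ < 1 := by rwa [Complex.norm_real, Real.norm_of_nonneg htpos.le]
  obtain ⟨b, hb⟩ : ∃ b : ℂ → ℂ, b = fun z => (z - -(r : ℂ)) / (1 - conj (-(r : ℂ)) * z) :=
    ⟨_, rfl⟩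
  have hbd0 : ∀ z ∈ ball (0 : ℂ) 1, 1 - conj (-(r : ℂ)) * z ≠ 0 := fun z hz =>
    one_sub_conj_mul_ne_zero hrn (le_of_lt (by simpa using hz))
  have hb1 : ∀ z ∈ ball (0 : ℂ) 1, ‖b z‖ ≤ 1 := by
    intro z hz
    rw [hb, norm_div]
    exact div_le_one_of_le₀ (norm_sub_le_norm_one_sub_conj_mul hrn.le
      (le_of_lt (by simpa using hz)))
      (norm_nonneg _)
  have hbdiff : DifferentiableOn ℂ b (ball 0 1) := by
    rw [hb]
    exact DifferentiableOn.div (by fun_prop) (by fun_prop) hbd0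
  obtain ⟨Φ, hΦ⟩ : ∃ Φ : ℂ → ℂ, Φ = fun z => (t - b z) / (1 - conj (t : ℂ) * b z) := ⟨_, rfl⟩
  have hΦd0 : ∀ z ∈ ball (0 : ℂ) 1, 1 - conj (t : ℂ) * b z ≠ 0 := fun z hz =>
    one_sub_conj_mul_ne_zero htn (hb1 z hz)
  have hΦ1 : ∀ z ∈ ball (0 : ℂ) 1, ‖Φ z‖ ≤ 1 := by
    intro z hz
    rw [hΦ, norm_div, norm_sub_rev]
    exact div_le_one_of_le₀ (norm_sub_le_norm_one_sub_conj_mul htn.le (hb1 z hz))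
      (norm_nonneg _)
  have hΦdiff : DifferentiableOn ℂ Φ (ball 0 1) := by
    rw [hΦ]
    exact DifferentiableOn.div (hbdiff.const_sub _) ((hbdiff.const_mul _).const_sub _) hΦd0
  have hr2 : (0 : ℝ) < 1 - r ^ 2 := by nlinarith
  have hr2c : (1 : ℂ) - r ^ 2 ≠ 0 := by exact_mod_cast hr2.ne'
  have hb0 : b (-(r : ℂ)) = 0 := by rw [hb]; simp
  have hbder : HasDerivAt b (1 / (1 - r ^ 2)) (-(r : ℂ)) := by
    have h1 := ((hasDerivAt_id (-(r : ℂ))).sub_const (-(r : ℂ))).div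
      (((hasDerivAt_id (-(r : ℂ))).const_mul (conj (-(r : ℂ)))).const_sub 1) (hbd0 _ hzb)
    rw [hb]
    refine h1.congr_deriv ?_
    simp only [id_eq, map_neg, Complex.conj_ofReal, sub_self, zero_mul, sub_zero, one_mul]
    have : (1 : ℂ) - -(r : ℂ) * -(r : ℂ) = 1 - r ^ 2 := by ring
    rw [this]
    field_simp
  have hΦ0 : Φ (-(r : ℂ)) = t := by rw [hΦ]; simp [hb0]
  have hΦder : HasDerivAt Φ (-((1 - t ^ 2) / (1 - r ^ 2))) (-(r : ℂ)) := by
    have h1 := (hbder.const_sub (t : ℂ)).div ((hbder.const_mul (conj (t : ℂ))).const_sub 1)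
      (hΦd0 _ hzb)
    rw [hΦ]
    refine h1.congr_deriv ?_
    rw [hb0, Complex.conj_ofReal]
    field_simp
    ring
  refine ⟨fun z => Φ z * f z, (hΦdiff.mul hf).analyticOnNhd isOpen_ball,
    ⟨Φ, hΦdiff.analyticOnNhd isOpen_ball, hΦ1, fun z _ => rfl⟩, ?_⟩
  have hg := hΦder.mul (hf.differentiableAt (isOpen_ball.mem_nhds hzb)).hasDerivAt
  have hmc : (m : ℂ) ≠ 0 := by exact_mod_cast hm.ne'
  have hg' : deriv (fun z => Φ z * f z) (-(r : ℂ))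
      = (((1 - t ^ 2) * r / ((1 - r ^ 2) * m) + t : ℝ) : ℂ) * deriv f (-(r : ℂ)) := by
    refine hg.deriv.trans ?_
    have hf' : f (-(r : ℂ)) = -(r : ℂ) * deriv f (-(r : ℂ)) / m := by
      rw [hfr]
      field_simp
    rw [hΦ0, hf']
    push_cast
    field_simp
  have hbig : 1 < (1 - t ^ 2) * r / ((1 - r ^ 2) * m) + t := by
    rw [← sub_lt_iff_lt_add, lt_div_iff₀ (by positivity)]
    have := mul_lt_mul_of_pos_left htr (by linarith : 0 < 1 - t)
    linarith
  rw [hg', norm_mul, Complex.norm_real, Real.norm_of_nonneg (by linarith)]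
  exact lt_mul_of_one_lt_left (norm_pos_iff.2 hne) hbig

theorem theorem2p1 (φ ψ : ℂ → ℂ)
    (hconv : IsConvexFunction φ)
    (hφ0 : φ 0 = 1)
    (hre : ∀ z ∈ Metric.ball (0 : ℂ) 1, 0 < (φ z).re)
    (hsymm : ∀ w ∈ φ '' Metric.ball (0 : ℂ) 1, conj w ∈ φ '' Metric.ball (0 : ℂ) 1)
    (hψ : IsBriotBouquetSolution φ ψ) :
    ∃ rψ : ℝ,
      -- `rψ` is the smallest root in `(0, 1)`
      IsLeast {r : ℝ | r ∈ Set.Ioo (0 : ℝ) 1 ∧ (1 - r ^ 2) * minModulus ψ r - 2 * r = 0} rψ ∧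
      -- the majorization result
      (∀ f g : ℂ → ℂ, ClassCc φ f → AnalyticOnNhd ℂ g (Metric.ball 0 1) → MajorizedBy g f →
        ∀ z : ℂ, ‖z‖ ≤ rψ → ‖deriv g z‖ ≤ ‖deriv f z‖) ∧
      -- sharpness
      ((∀ r ∈ Set.Ioo (0 : ℝ) 1, ψ (-(r : ℂ)) = (minModulus ψ r : ℂ)) →
        ∀ r ∈ Set.Ioo rψ 1, ∃ f g : ℂ → ℂ, ClassCc φ f ∧
          AnalyticOnNhd ℂ g (Metric.ball 0 1) ∧ MajorizedBy g f ∧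
          ∃ z : ℂ, ‖z‖ = r ∧ ‖deriv f z‖ < ‖deriv g z‖) := by
  obtain ⟨κ, hκ, hφκ⟩ := exists_rotation_isRealConvex hconv hφ0 hre hsymm
  have hM := (hψ.rotate hκ).isMajorant hφκ
  obtain ⟨s, hs0, hs1, hs⟩ := hM.exists_radius hφκ
  have hψd : DifferentiableOn ℂ ψ (ball 0 1) := hψ.analytic.differentiableOn
  have hs3 : 0 < s := by linarith
  have hs4 : 0 < 1 - s ^ 2 := by nlinarith
  -- `m(s) ≤ |ψ(-κ s)| ≤ 1 / M(s)`
  have hms : (1 - s ^ 2) * minModulus ψ s ≤ 2 * s := by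
    have hb : κ * -(s : ℂ) ∈ ball (0 : ℂ) 1 := by
      simpa [hκ, abs_of_pos hs3] using (by linarith : s < 1)
    have h1 := minModulus_le ψ (z := κ * -(s : ℂ)) (r := s) (by simp [hκ, abs_of_pos hs3])
    have h2 := Complex.re_le_norm (ψ (κ * -(s : ℂ)))⁻¹
    have hpos : 0 < ‖ψ (κ * -(s : ℂ))‖ := norm_pos_iff.2 (hψ.ne_zero _ hb)
    rw [norm_inv, ← one_div ‖_‖, le_div_iff₀ hpos] at h2
    rw [← hs]
    have hM1 := hM.one_le hφκ hs3.le (by linarith)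
    calc _ ≤ (ψ (κ * -(s : ℂ)))⁻¹.re * (2 * s) * ‖ψ (κ * -(s : ℂ))‖ := by
          gcongr
      _ = (ψ (κ * -(s : ℂ)))⁻¹.re * ‖ψ (κ * -(s : ℂ))‖ * (2 * s) := by ring
      _ ≤ 1 * (2 * s) := by gcongr
      _ = 2 * s := one_mul _
  obtain ⟨r, hr, hr0, hrs, hlt⟩ := exists_isLeast_root hψd hψ.ne_zero (hψ.map_zero hφ0) hs3
    (by linarith) hms
  refine ⟨r, hr, fun f g hf _ hg z hz => ?_, fun hm t ht => ?_⟩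
  · refine hg.norm_deriv_le hf.classA.analytic.differentiableOn ?_
      ((hf.rotate hκ).two_mul_norm_le hφκ hM hs0 hs1 hs (hz.trans hrs))
    simp only [mem_ball, dist_zero_right]
    linarith
  · have ht0 : 0 < t := hr0.trans ht.1
    obtain ⟨f, hf, hfψ⟩ := hψ.exists_extremal hφ0 (map_conj_of_neg_real hψ.analytic
      fun x hx => by rw [hm x hx, Complex.conj_ofReal])
    obtain ⟨h1, h2⟩ := hfψ _ (neg_ofReal_mem_ball ht0.le ht.2)
    rw [hm t ⟨ht0, ht.2⟩] at h1
    obtain ⟨g, hga, hgf, hlt'⟩ := exists_majorizedBy_norm_deriv_lt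
      hf.classA.analytic.differentiableOn ht0 ht.2 (minModulus_pos hψd hψ.ne_zero ht0.le ht.2)
      (hlt t ht.1 ht.2) h1 h2
    exact ⟨f, g, hf, hga, hgf, _, by simp [abs_of_pos ht0], hlt'⟩
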